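/- A \emph{computable valued field} is a field $K$ with a surjective valuation $v\colon K\to\Gamma\cup\{\infty\}$, where $\Gamma$ is an ordered abelian group, such that the domains of $K$ and $\Gamma$ are computable subsets of $\omega$, and the addition and multiplication of $K$, the addition and the ordering of $\Gamma$, and $v$ are computable. It has a \emph{splitting algorithm} if the set of reducible polynomials in $K[X]$ (given by their coefficients) is computable. Extensions of $v$ to a field $L\supseteq K$ are counted up to equivalence of valuations on $L$. There is a computable valued field $(K,v)$, with $K$ algebraic over $\mathbb{Q}$ and with a splitting algorithm, such that the number of extensions of $v$ to $K(a)$ cannot be computed uniformly in $a$, for $a$ algebraic over $K$. That is: no algorithm computes, from the minimal polynomial over $K$ of an arbitrary $a$ algebraic over $K$, the number of extensions of $v$ to $K(a)$; and, for every computable embedding of $K$ into a computable field $\overline{K}$ that is an algebraic closure of $K$, no algorithm computes, from an arbitrary $a\in\overline{K}$, the number of extensions of $v$ to $K(a)$. -/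

import Mathlib

/-- A presentation of the set `A` with a computable subset of `ℕ` as its domain: the elements of `A`
are identified with the members of a computable set of natural numbers. -/
structure Coding (A : Type) where
  code : A → ℕ
  injective : Function.Injective code
  domain_computable : ComputablePred fun n : ℕ => n ∈ Set.range code

namespace Coding

variable {A B : Type}

/-- `f : A → B` is computable with respect to the two presentations. -/
def IsComputableMap (cA : Coding A) (cB : Coding B) (f : A → B) : Prop :=
  ∃ g : ℕ → ℕ, Computable g ∧ ∀ a, g (cA.code a) = cB.code (f a)

/-- The binary operation `op` on `A` is computable with respect to the presentation. -/
def IsComputableOp (c : Coding A) (op : A → A → A) : Prop :=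
  ∃ g : ℕ → ℕ → ℕ, Computable₂ g ∧ ∀ a b, g (c.code a) (c.code b) = c.code (op a b)

/-- The binary relation `R` on `A` is computable with respect to the presentation. -/
def IsComputableRel (c : Coding A) (R : A → A → Prop) : Prop :=
  ∃ g : ℕ → ℕ → Bool, Computable₂ g ∧ ∀ a b, g (c.code a) (c.code b) = true ↔ R a b

/-- The presentation makes `K` a computable field. -/
structure IsComputableField {K : Type} [Field K] (c : Coding K) : Prop where
  add : c.IsComputableOp (· + ·)
  mul : c.IsComputableOp (· * ·)

/-- The presentation makes `Γ` a computable ordered group. -/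
structure IsComputableOrderedGroup {Γ : Type} [AddCommGroup Γ] [LinearOrder Γ]
    (c : Coding Γ) : Prop where
  add : c.IsComputableOp (· + ·)
  le : c.IsComputableRel (· ≤ ·)

end Coding

/-- The presentations `cK`, `cΓ` make `(K, v)` with `v : K → Γ ∪ {∞}` a computable valued field.
The valuation is surjective, so that `Γ` is its value group; `v` is computed on the nonzero
elements, where its values lie in `Γ`. -/
structure IsComputableValuedField {K Γ : Type} [Field K] [AddCommGroup Γ] [LinearOrder Γ]
    [IsOrderedAddMonoid Γ] (cK : Coding K) (cΓ : Coding Γ)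
    (v : AddValuation K (WithTop Γ)) : Prop where
  field : cK.IsComputableField
  group : cΓ.IsComputableOrderedGroup
  surjective : ∀ γ : Γ, ∃ x : K, v x = (γ : WithTop Γ)
  valuation : ∃ g : ℕ → ℕ, Computable g ∧
    ∀ (x : K) (γ : Γ), v x = (γ : WithTop Γ) → g (cK.code x) = cΓ.code γ

/-- The polynomial `a₀ + a₁ X + ⋯ + aₙ Xⁿ` with coefficient list `[a₀, a₁, …, aₙ]`. -/
noncomputable def polyOfList {K : Type} [Field K] : List K → Polynomial K
  | [] => 0
  | a :: l => Polynomial.C a + Polynomial.X * polyOfList l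

/-- `p` is a product of two non-constant polynomials. -/
def IsReduciblePoly {K : Type} [Field K] (p : Polynomial K) : Prop :=
  ∃ f g : Polynomial K, 0 < f.natDegree ∧ 0 < g.natDegree ∧ p = f * g

/-- The splitting set, i.e. the set of reducible polynomials over `K`, is computable, where
polynomials are given by the lists of the codes of their coefficients. -/
def HasSplittingAlgorithm {K : Type} [Field K] (c : Coding K) : Prop :=
  ∃ d : List ℕ → Bool, Computable d ∧
    ∀ l : List K, d (l.map c.code) = true ↔ IsReduciblePoly (polyOfList l)

/-- A valuation `w` on `L`, with value group `Δ`, extending the valuation `v` on `K`: restricted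
to `K` it is `v` up to the identification of value groups. -/
structure ValExtension {K Γ : Type} [Field K] [AddCommGroup Γ] [LinearOrder Γ]
    [IsOrderedAddMonoid Γ] (v : AddValuation K (WithTop Γ))
    (L : Type) [Field L] [Algebra K L] : Type 1 where
  Δ : Type
  [addCommGroup : AddCommGroup Δ]
  [linearOrder : LinearOrder Δ]
  [isOrderedAddMonoid : IsOrderedAddMonoid Δ]
  w : AddValuation L (WithTop Δ)
  surjective : ∀ δ : Δ, ∃ x : L, w x = (δ : WithTop Δ)
  isEquiv_comap : v.IsEquiv (w.comap (algebraMap K L))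

attribute [instance] ValExtension.addCommGroup ValExtension.linearOrder
  ValExtension.isOrderedAddMonoid

/-- Two extensions are the same if they are equivalent valuations on `L`. -/
instance ValExtension.setoid {K Γ : Type} [Field K] [AddCommGroup Γ] [LinearOrder Γ]
    [IsOrderedAddMonoid Γ] (v : AddValuation K (WithTop Γ))
    (L : Type) [Field L] [Algebra K L] : Setoid (ValExtension v L) where
  r e₁ e₂ := e₁.w.IsEquiv e₂.w
  iseqv :=
    { refl := fun _ => AddValuation.IsEquiv.refl
      symm := fun h => AddValuation.IsEquiv.symm h
      trans := fun h h' => AddValuation.IsEquiv.trans h h' }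

/-- The number of extensions of `v` to `L` (it is finite if `L / K` is finite). -/
noncomputable def numExtensions {K Γ : Type} [Field K] [AddCommGroup Γ] [LinearOrder Γ]
    [IsOrderedAddMonoid Γ] (v : AddValuation K (WithTop Γ))
    (L : Type) [Field L] [Algebra K L] : ℕ :=
  Nat.card (Quotient (ValExtension.setoid v L))

/-- Some algorithm computes the number of extensions of `v` to `K(a)` from the minimal polynomial
of `a` over `K`, for all `a` algebraic over `K`. -/
def CanCountExtensionsFromMinpoly {K Γ : Type} [Field K] [AddCommGroup Γ] [LinearOrder Γ]
    [IsOrderedAddMonoid Γ] (cK : Coding K) (v : AddValuation K (WithTop Γ)) : Prop :=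
  ∃ g : List ℕ →. ℕ, Partrec g ∧
    ∀ (a : AlgebraicClosure K) (l : List K), polyOfList l = minpoly K a →
      numExtensions v (IntermediateField.adjoin K {a}) ∈ g (l.map cK.code)

/-- Some algorithm computes the number of extensions of `v` to `K(a)` from the element `a` of the
presented algebraic extension `L` of `K`. -/
def CanCountExtensionsIn {K Γ : Type} [Field K] [AddCommGroup Γ] [LinearOrder Γ]
    [IsOrderedAddMonoid Γ] (v : AddValuation K (WithTop Γ))
    {L : Type} [Field L] [Algebra K L] (cL : Coding L) : Prop :=
  ∃ g : ℕ →. ℕ, Partrec g ∧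
    ∀ a : L, numExtensions v (IntermediateField.adjoin K {a}) ∈ g (cL.code a)

-- Fix a computable copy Ω of the algebraic closure of ℚ, a c.e. undecidable set P of natural
-- numbers and a computable injective sequence of odd primes q_n. The field K ⊆ Ω is the union of a
-- computable chain of simple extensions of ℚ: when n is seen to enter P, a q_n-th root of 2r is
-- adjoined for some odd prime r, and otherwise nothing happens (`exists_decidable_field`).
--
-- Each step is ramified of prime degree q_n over 2, because 2r has the value of 2 and no element of
-- the field so far has q_n-th power of that value. Hence the 2-adic valuation extends uniquely at
-- each step (`ValDetermined.adjoin_root`), and so it has exactly one extension v to K. Steps for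
-- other primes never create a q_n-th root of the value of 2 (`NoRootOfTwo.adjoin_root`).
--
-- Let a be a q_n-th root of 2. If n is not in P, then K(a)/K is again ramified of degree q_n and v
-- has one extension (`card_extensions_eq_one`). If n is in P, then K contains b with b^q = 2r, and
-- a/b is a q-th root of the 1-unit 1/r. In residue characteristic 2 with q odd, exactly one q-th
-- root of a 1-unit is again a 1-unit. All the roots are conjugate over K, since uniqueness of v
-- keeps q-th roots of odd primes out of K (`ValDetermined.pow_mul_ne`). So v has several extensions
-- to K(a) (`card_extensions_ne_one`). The number is 1 exactly when n is not in P, and an algorithm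
-- for it would decide P.
--
-- What makes K tame is the free choice of r: by pigeonhole it can be chosen so that the new field
-- contains none of finitely many prescribed elements outside the old one (`exists_generic_root`).
-- At stage s the first s + 1 elements of Ω are protected, so membership in K is decidable. A
-- decidable subfield of Ω has a splitting algorithm, as one can search for the roots in Ω and test
-- which products of linear factors are defined over K (`computablePred_isReduciblePoly`). Finally v
-- is computable because, when the valuation over 2 is unique, both membership and non-membership in
-- its ring are witnessed by polynomial identities coming from Chevalley's theorem
-- (`ValDetermined.mem_iff`, `ValDetermined.notMem_iff`).

attribute [fun_prop] Computable

/-! ### Closure properties of computable functions -/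

namespace Computable

/-- Reads the list by position, so that a fold becomes primitive recursion on a number. The default
`d` is never reached, since only positions below the length are read. -/
theorem foldl_eq_rec {β σ : Type*} (h : σ → β → σ) (d : β) (l : List β) (s : σ) :
    l.foldl h s = Nat.rec (motive := fun _ => σ) s (fun n t => h t (l.getD n d)) l.length := by
  induction l using List.reverseRecOn with
  | nil => rfl
  | append_singleton l a ih =>
    rw [List.foldl_append, ih, List.length_append]
    simp only [List.foldl_cons, List.foldl_nil, List.length_cons, List.length_nil]
    have key : ∀ m ≤ l.length, (Nat.rec (motive := fun _ => σ) s (fun n t => h t (l.getD n d)) m : σ)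
        = Nat.rec (motive := fun _ => σ) s (fun n t => h t ((l ++ [a]).getD n d)) m := by
      intro m hm
      induction m with
      | zero => rfl
      | succ m ihm =>
        have : (l ++ [a]).getD m d = l.getD m d := by
          simp [List.getD, List.getElem?_append_left (show m < l.length by omega)]
        simp only [ihm (by omega), this]
    rw [key _ le_rfl]
    simp [List.getD]

variable {α β γ σ : Type*} [Primcodable α] [Primcodable β] [Primcodable γ] [Primcodable σ]

@[fun_prop] theorem fp_id : Computable (fun a : α => a) := Computable.id

@[fun_prop] theorem fp_const (s : σ) : Computable (fun _ : α => s) := Computable.const s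

@[fun_prop] theorem fp_comp {f : β → σ} {g : α → β} (hf : Computable f) (hg : Computable g) :
    Computable (fun a => f (g a)) := hf.comp hg

@[fun_prop] theorem fp_pair {f : α → β} {g : α → γ} (hf : Computable f) (hg : Computable g) :
    Computable (fun a => (f a, g a)) := hf.pair hg

@[fun_prop] theorem fp_fst {f : α → β × γ} (hf : Computable f) : Computable (fun a => (f a).1) :=
  Computable.fst.comp hf

@[fun_prop] theorem fp_snd {f : α → β × γ} (hf : Computable f) : Computable (fun a => (f a).2) :=
  Computable.snd.comp hf

@[fun_prop] theorem fp_add {f g : α → ℕ} (hf : Computable f) (hg : Computable g) :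
    Computable (fun a => f a + g a) := Primrec.nat_add.to_comp.comp hf hg

@[fun_prop] theorem fp_mul {f g : α → ℕ} (hf : Computable f) (hg : Computable g) :
    Computable (fun a => f a * g a) := Primrec.nat_mul.to_comp.comp hf hg

@[fun_prop] theorem fp_sub {f g : α → ℕ} (hf : Computable f) (hg : Computable g) :
    Computable (fun a => f a - g a) := Primrec.nat_sub.to_comp.comp hf hg

@[fun_prop] theorem fp_mod {f g : α → ℕ} (hf : Computable f) (hg : Computable g) :
    Computable (fun a => f a % g a) := Primrec.nat_mod.to_comp.comp hf hg

@[fun_prop] theorem fp_max {f g : α → ℕ} (hf : Computable f) (hg : Computable g) :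
    Computable (fun a => max (f a) (g a)) := Primrec.nat_max.to_comp.comp hf hg

@[fun_prop] theorem fp_pow {f g : α → ℕ} (hf : Computable f) (hg : Computable g) :
    Computable (fun a => f a ^ g a) :=
  (Primrec₂.unpaired'.1 Nat.Primrec.pow).to_comp.comp hf hg

@[fun_prop] theorem fp_unpair {f : α → ℕ} (hf : Computable f) :
    Computable (fun a => Nat.unpair (f a)) := Computable.unpair.comp hf

@[fun_prop] theorem fp_encode {f : α → β} (hf : Computable f) :
    Computable (fun a => Encodable.encode (f a)) := Computable.encode.comp hf

@[fun_prop] theorem fp_decode {f : α → ℕ} (hf : Computable f) :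
    Computable (fun a => (Encodable.decode (f a) : Option β)) := Computable.decode.comp hf

@[fun_prop] theorem fp_ofNat {δ : Type*} [Denumerable δ] {f : α → ℕ} (hf : Computable f) :
    Computable (fun a => Denumerable.ofNat δ (f a)) := (Computable.ofNat δ).comp hf

@[fun_prop] theorem fp_append {f g : α → List β} (hf : Computable f) (hg : Computable g) :
    Computable (fun a => f a ++ g a) := Primrec.list_append.to_comp.comp hf hg

@[fun_prop] theorem fp_cons {f : α → β} {g : α → List β} (hf : Computable f)
    (hg : Computable g) : Computable (fun a => f a :: g a) :=
  Primrec.list_cons.to_comp.comp hf hg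

@[fun_prop] theorem fp_length {f : α → List β} (hf : Computable f) :
    Computable (fun a => (f a).length) := Primrec.list_length.to_comp.comp hf

@[fun_prop] theorem fp_reverse {f : α → List β} (hf : Computable f) :
    Computable (fun a => (f a).reverse) := Primrec.list_reverse.to_comp.comp hf

@[fun_prop] theorem fp_range {f : α → ℕ} (hf : Computable f) :
    Computable (fun a => List.range (f a)) := Primrec.list_range.to_comp.comp hf

@[fun_prop] theorem fp_getD {f : α → List β} {g : α → ℕ} (d : β) (hf : Computable f)
    (hg : Computable g) : Computable (fun a => (f a).getD (g a) d) :=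
  (Primrec.list_getD d).to_comp.comp hf hg

@[fun_prop] theorem fp_and {f g : α → Bool} (hf : Computable f) (hg : Computable g) :
    Computable (fun a => (f a && g a)) := Primrec.and.to_comp.comp hf hg

@[fun_prop] theorem fp_or {f g : α → Bool} (hf : Computable f) (hg : Computable g) :
    Computable (fun a => (f a || g a)) := Primrec.or.to_comp.comp hf hg

@[fun_prop] theorem fp_rec {f : α → ℕ} {g : α → σ} {h : α → ℕ → σ → σ} (hf : Computable f)
    (hg : Computable g) (hh : Computable fun p : α × ℕ × σ => h p.1 p.2.1 p.2.2) :
    Computable (fun a => Nat.rec (motive := fun _ => σ) (g a) (fun n s => h a n s) (f a)) :=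
  Computable.nat_rec hf hg (h := fun a p => h a p.1 p.2) hh

@[fun_prop] theorem fp_foldl {f : α → List β} {g : α → σ} {h : α → σ → β → σ} (hf : Computable f)
    (hg : Computable g) (hh : Computable fun p : α × σ × β => h p.1 p.2.1 p.2.2) :
    Computable (fun a => (f a).foldl (fun s b => h a s b) (g a)) := by
  -- Reading by position needs a default entry; without one every list is empty.
  rcases isEmpty_or_nonempty β with hβ | ⟨⟨d⟩⟩
  · refine hg.of_eq fun a => ?_
    rcases f a with _ | ⟨b, _⟩
    · rfl
    · exact hβ.elim b
  · have : Computable fun a => Nat.rec (motive := fun _ => σ) (g a)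
        (fun n t => h a t ((f a).getD n d)) (f a).length := by fun_prop
    exact this.of_eq fun a => (foldl_eq_rec (h a) d (f a) (g a)).symm

@[fun_prop] theorem fp_foldr {f : α → List β} {g : α → σ} {h : α → β → σ → σ} (hf : Computable f)
    (hg : Computable g) (hh : Computable fun p : α × β × σ => h p.1 p.2.1 p.2.2) :
    Computable (fun a => (f a).foldr (fun b s => h a b s) (g a)) := by
  have : Computable fun a => (f a).reverse.foldl (fun s b => h a b s) (g a) := by fun_prop
  exact this.of_eq fun a => by simp

@[fun_prop] theorem fp_map {f : α → List β} {h : α → β → σ} (hf : Computable f)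
    (hh : Computable fun p : α × β => h p.1 p.2) :
    Computable (fun a => (f a).map (fun b => h a b)) := by
  have : Computable fun a => (f a).foldr (fun b s => h a b :: s) [] := by fun_prop
  exact this.of_eq fun a => by induction f a <;> simp_all

@[fun_prop] theorem fp_flatMap {f : α → List β} {h : α → β → List σ} (hf : Computable f)
    (hh : Computable fun p : α × β => h p.1 p.2) :
    Computable (fun a => (f a).flatMap (fun b => h a b)) := by
  have : Computable fun a => (f a).foldr (fun b s => h a b ++ s) [] := by fun_prop
  exact this.of_eq fun a => by induction f a <;> simp_all

@[fun_prop] theorem fp_all {f : α → List β} {h : α → β → Bool} (hf : Computable f)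
    (hh : Computable fun p : α × β => h p.1 p.2) :
    Computable (fun a => (f a).all (fun b => h a b)) := by
  have : Computable fun a => (f a).foldr (fun b s => h a b && s) true := by fun_prop
  exact this.of_eq fun a => by induction f a <;> simp_all

end Computable

/-! ### Closure properties of decidable predicates -/

namespace ComputablePred

variable {α β : Type*} [Primcodable α] [Primcodable β]

theorem comp' {p : β → Prop} {f : α → β} (hp : ComputablePred p) (hf : Computable f) :
    ComputablePred fun a => p (f a) := by
  obtain ⟨g, hg, rfl⟩ := computable_iff.1 hp
  exact computable_iff.2 ⟨fun a => g (f a), hg.comp hf, rfl⟩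

theorem and' {p q : α → Prop} (hp : ComputablePred p) (hq : ComputablePred q) :
    ComputablePred fun a => p a ∧ q a := by
  obtain ⟨f, hf, rfl⟩ := computable_iff.1 hp
  obtain ⟨g, hg, rfl⟩ := computable_iff.1 hq
  exact computable_iff.2 ⟨fun a => f a && g a, by fun_prop, by simp⟩

theorem or' {p q : α → Prop} (hp : ComputablePred p) (hq : ComputablePred q) :
    ComputablePred fun a => p a ∨ q a := by
  obtain ⟨f, hf, rfl⟩ := computable_iff.1 hp
  obtain ⟨g, hg, rfl⟩ := computable_iff.1 hq
  exact computable_iff.2 ⟨fun a => f a || g a, by fun_prop, by simp⟩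

theorem imp' {p q : α → Prop} (hp : ComputablePred p) (hq : ComputablePred q) :
    ComputablePred fun a => p a → q a :=
  (hp.not.or' hq).of_eq fun a => by tauto

theorem eq' {f g : α → β} (hf : Computable f) (hg : Computable g) :
    ComputablePred fun a => f a = g a := by
  classical
  exact ComputablePred.comp' (p := fun x : β × β => x.1 = x.2) (f := fun a => (f a, g a))
    (PrimrecPred.computablePred Primrec.eq) (by fun_prop)

theorem le' {f g : α → ℕ} (hf : Computable f) (hg : Computable g) :
    ComputablePred fun a => f a ≤ g a :=
  ComputablePred.comp' (p := fun x : ℕ × ℕ => x.1 ≤ x.2) (f := fun a => (f a, g a))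
    (PrimrecPred.computablePred Primrec.nat_le) (by fun_prop)

theorem forall_mem {L : α → List β} {p : α → β → Prop} (hL : Computable L)
    (hp : ComputablePred fun x : α × β => p x.1 x.2) :
    ComputablePred fun a => ∀ b ∈ L a, p a b := by
  obtain ⟨f, hf, hpf⟩ := computable_iff.1 hp
  have hpf' : ∀ a b, p a b ↔ f (a, b) = true := fun a b => by rw [congrFun hpf (a, b)]
  exact computable_iff.2 ⟨fun a => (L a).all fun b => f (a, b), by fun_prop, by
    funext a; simp [hpf']⟩

theorem exists_mem {L : α → List β} {p : α → β → Prop} (hL : Computable L)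
    (hp : ComputablePred fun x : α × β => p x.1 x.2) :
    ComputablePred fun a => ∃ b ∈ L a, p a b :=
  (forall_mem hL (p := fun a b => ¬ p a b) hp.not).not.of_eq fun a => by push Not; rfl

theorem forall_lt {N : α → ℕ} {p : α → ℕ → Prop} (hN : Computable N)
    (hp : ComputablePred fun x : α × ℕ => p x.1 x.2) :
    ComputablePred fun a => ∀ n < N a, p a n :=
  (forall_mem (L := fun a => List.range (N a)) (p := p) (by fun_prop) hp).of_eq fun a => by simp

theorem ite' {σ : Type*} [Primcodable σ] {p : α → Prop} [DecidablePred p] {f g : α → σ}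
    (hp : ComputablePred p) (hf : Computable f) (hg : Computable g) :
    Computable fun a => if p a then f a else g a :=
  (Computable.cond hp.decide hf hg).of_eq fun a => by by_cases h : p a <;> simp [h]

end ComputablePred

/-! ### C.e. predicates, search and computable dependent choice -/

namespace REPred

variable {α β σ : Type*} [Primcodable α] [Primcodable β] [Primcodable σ]

/-- A c.e. predicate is the union of an increasing computable sequence of decidable ones. -/
theorem exists_stages {p : α → Prop} (hp : REPred p) :
    ∃ f : α → ℕ → Bool, (Computable fun x : α × ℕ => f x.1 x.2) ∧
      (∀ a k l, k ≤ l → f a k = true → f a l = true) ∧ ∀ a, p a ↔ ∃ k, f a k = true := by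
  obtain ⟨c, hc⟩ := Nat.Partrec.Code.exists_code.1 hp
  refine ⟨fun a k => (Nat.Partrec.Code.evaln k c (Encodable.encode a)).isSome, ?_, ?_, ?_⟩
  · exact Primrec.option_isSome.to_comp.comp (Nat.Partrec.Code.primrec_evaln.to_comp.comp
      (g := fun x : α × ℕ => ((x.2, c), Encodable.encode x.1)) (by fun_prop))
  · intro a k l hkl h
    obtain ⟨x, hx⟩ := Option.isSome_iff_exists.1 h
    exact Option.isSome_iff_exists.2 ⟨x, Nat.Partrec.Code.evaln_mono hkl hx⟩
  · intro a
    have h1 : p a ↔ (Nat.Partrec.Code.eval c (Encodable.encode a)).Dom := by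
      rw [hc]; simp [Part.assert, Part.bind]
    rw [h1, Part.dom_iff_mem]
    constructor
    · rintro ⟨x, hx⟩
      obtain ⟨k, hk⟩ := Nat.Partrec.Code.evaln_complete.1 hx
      exact ⟨k, Option.isSome_iff_exists.2 ⟨x, hk⟩⟩
    · rintro ⟨k, hk⟩
      obtain ⟨x, hx⟩ := Option.isSome_iff_exists.1 hk
      exact ⟨x, Nat.Partrec.Code.evaln_complete.2 ⟨k, hx⟩⟩

/-- Unbounded minimization halts exactly when there is a witness. -/
theorem of_exists_nat {p : α → ℕ → Prop} (hp : ComputablePred fun x : α × ℕ => p x.1 x.2) :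
    REPred fun a => ∃ n, p a n := by
  obtain ⟨f, hf, hpf⟩ := ComputablePred.computable_iff.1 hp
  have hpf' : ∀ a b, p a b ↔ f (a, b) = true := fun a b => by rw [congrFun hpf (a, b)]
  have : Partrec fun a => Nat.rfind fun n => Part.some (f (a, n)) :=
    Partrec.rfind (Computable.partrec (f := fun x : α × ℕ => f (x.1, x.2)) (by fun_prop))
  refine this.dom_re.of_eq fun a => ?_
  constructor
  · intro h
    exact ⟨_, (hpf' _ _).2 (by simpa using Nat.rfind_spec (Part.get_mem h))⟩
  · rintro ⟨n, hn⟩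
    obtain ⟨m, hm, -⟩ := Nat.rfind_min' (p := fun n => f (a, n)) ((hpf' _ _).1 hn)
    exact Part.dom_iff_mem.2 ⟨m, hm⟩

theorem comp' {p : β → Prop} {f : α → β} (hp : REPred p) (hf : Computable f) :
    REPred fun a => p (f a) :=
  Partrec.comp (f := fun b => Part.assert (p b) fun _ => Part.some ()) hp hf

/-- Dovetailing: one number codes both a candidate `b` and the stage up to which it is tested. -/
theorem exists' {p : α → β → Prop} (hp : REPred fun x : α × β => p x.1 x.2) :
    REPred fun a => ∃ b, p a b := by
  obtain ⟨f, hf, -, hpf⟩ := hp.exists_stages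
  have : REPred fun a => ∃ n : ℕ, ∃ b ∈ (Encodable.decode n.unpair.1 : Option β).toList,
      f (a, b) n.unpair.2 = true := by
    refine of_exists_nat ?_
    refine ComputablePred.exists_mem
      (L := fun x : α × ℕ => (Encodable.decode x.2.unpair.1 : Option β).toList)
      (p := fun x b => f (x.1, b) x.2.unpair.2 = true) ?_ ?_
    · exact Primrec.optionToList.to_comp.comp (by fun_prop)
    · exact ComputablePred.eq' (by fun_prop) (by fun_prop)
  refine this.of_eq fun a => ?_
  constructor
  · rintro ⟨n, b, -, h⟩
    exact ⟨b, (hpf (a, b)).2 ⟨_, h⟩⟩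
  · rintro ⟨b, h⟩
    obtain ⟨k, hk⟩ := (hpf (a, b)).1 h
    exact ⟨Nat.pair (Encodable.encode b) k, b, by simp, by simpa using hk⟩

theorem and' {p q : α → Prop} (hp : REPred p) (hq : REPred q) : REPred fun a => p a ∧ q a := by
  have : Partrec fun a => (Part.assert (p a) fun _ => Part.some ()).bind fun _ : Unit =>
      Part.assert (q a) fun _ => Part.some () :=
    Partrec.bind hp (Partrec.comp (f := fun a => Part.assert (q a) fun _ => Part.some ()) hq
      Computable.fst)
  exact this.dom_re.of_eq fun a => by simp [Part.assert, Part.bind]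

theorem or' {p q : α → Prop} (hp : REPred p) (hq : REPred q) : REPred fun a => p a ∨ q a := by
  obtain ⟨f, hf, -, hpf⟩ := hp.exists_stages
  obtain ⟨g, hg, -, hqg⟩ := hq.exists_stages
  refine (of_exists_nat (p := fun a n => f a n = true ∨ g a n = true) ?_).of_eq fun a => ?_
  · exact (ComputablePred.eq' (by fun_prop) (by fun_prop)).or'
      (ComputablePred.eq' (by fun_prop) (by fun_prop))
  · rw [hpf, hqg, exists_or]

/-- The stages increase, so finitely many confirmations all occur by the largest of their stages. -/
theorem forall_mem {L : α → List β} {p : α → β → Prop} (hL : Computable L)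
    (hp : REPred fun x : α × β => p x.1 x.2) : REPred fun a => ∀ b ∈ L a, p a b := by
  obtain ⟨f, hf, hmono, hpf⟩ := hp.exists_stages
  refine (of_exists_nat (p := fun a n => ∀ b ∈ L a, f (a, b) n = true) ?_).of_eq fun a => ?_
  · exact ComputablePred.forall_mem (L := fun x : α × ℕ => L x.1)
      (p := fun x b => f (x.1, b) x.2 = true) (by fun_prop)
      (ComputablePred.eq' (by fun_prop) (by fun_prop))
  · constructor
    · rintro ⟨n, h⟩ b hb
      exact (hpf (a, b)).2 ⟨n, h b hb⟩
    · intro h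
      generalize L a = l at h
      induction l with
      | nil => exact ⟨0, by simp⟩
      | cons b l ih =>
        obtain ⟨n, hn⟩ := ih fun c hc => h c (List.mem_cons_of_mem _ hc)
        obtain ⟨m, hm⟩ := (hpf (a, b)).1 (h b (by simp))
        refine ⟨max n m, fun c hc => ?_⟩
        rcases List.mem_cons.1 hc with rfl | hc
        · exact hmono _ _ _ (le_max_right _ _) hm
        · exact hmono _ _ _ (le_max_left _ _) (hn c hc)

theorem forall_lt {N : α → ℕ} {p : α → ℕ → Prop} (hN : Computable N)
    (hp : REPred fun x : α × ℕ => p x.1 x.2) : REPred fun a => ∀ n < N a, p a n :=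
  (forall_mem (L := fun a => List.range (N a)) (p := p) (by fun_prop) hp).of_eq fun a => by simp

/-- A c.e. relation contains the graph of a partial computable function with the same domain. -/
theorem uniformize {R : α → β → Prop} (hR : REPred fun x : α × β => R x.1 x.2) :
    ∃ f : α →. β, Partrec f ∧ (∀ a, ∀ b ∈ f a, R a b) ∧ ∀ a, (∃ b, R a b) → (f a).Dom := by
  obtain ⟨f, hf, -, hRf⟩ := hR.exists_stages
  let g : α → ℕ → Option β := fun a n =>
    (Encodable.decode n.unpair.1 : Option β).bind fun b =>
      bif f (a, b) n.unpair.2 then some b else none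
  have hg : Computable₂ g := by
    refine Computable.option_bind (f := fun x : α × ℕ => Encodable.decode x.2.unpair.1)
      (g := fun x b => bif f (x.1, b) x.2.unpair.2 then some b else none) (by fun_prop) ?_
    refine Computable.cond (c := fun y : (α × ℕ) × β => f (y.1.1, y.2) y.1.2.unpair.2)
      (f := fun y => some y.2) (g := fun _ => none) (by fun_prop) ?_ (by fun_prop)
    exact Computable.option_some.comp Computable.snd
  have hgs : ∀ a n b, b ∈ g a n ↔ Encodable.decode n.unpair.1 = some b ∧
      f (a, b) n.unpair.2 = true := by
    intro a n b
    simp only [g, Option.mem_def, Option.bind_eq_some_iff]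
    constructor
    · rintro ⟨c, hc, h⟩
      cases hfc : f (a, c) n.unpair.2 <;> simp [hfc] at h
      subst h; exact ⟨hc, hfc⟩
    · rintro ⟨h1, h2⟩
      exact ⟨b, h1, by simp [h2]⟩
  refine ⟨fun a => Nat.rfindOpt (g a), Partrec.rfindOpt hg, ?_, ?_⟩
  · intro a b hb
    obtain ⟨n, hn⟩ := Nat.rfindOpt_spec hb
    exact (hRf (a, b)).2 ⟨_, ((hgs a n b).1 hn).2⟩
  · rintro a ⟨b, hb⟩
    obtain ⟨k, hk⟩ := (hRf (a, b)).1 hb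
    exact Nat.rfindOpt_dom.2 ⟨Nat.pair (Encodable.encode b) k, b, (hgs _ _ _).2 (by simpa using hk)⟩

/-- Used to obtain field operations such as subtraction, inversion and root extraction: it is enough
that a solution of a recognizable equation exists. -/
theorem exists_computable {R : α → β → Prop} (hR : REPred fun x : α × β => R x.1 x.2)
    (h : ∀ a, ∃ b, R a b) : ∃ f : α → β, Computable f ∧ ∀ a, R a (f a) := by
  obtain ⟨f, hf, hfR, hfd⟩ := hR.uniformize
  exact ⟨fun a => (f a).get (hfd a (h a)), hf.of_eq_tot fun a => Part.get_mem _,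
    fun a => hfR a _ (Part.get_mem _)⟩

/-- Dependent choice along a c.e. relation gives a computable sequence. -/
theorem exists_sequence {R : ℕ → σ → σ → Prop} (Inv : ℕ → σ → Prop) {x₀ : σ}
    (hR : REPred fun x : ℕ × σ × σ => R x.1 x.2.1 x.2.2) (h₀ : Inv 0 x₀)
    (h : ∀ n x, Inv n x → ∃ y, R n x y) (hInv : ∀ n x y, Inv n x → R n x y → Inv (n + 1) y) :
    ∃ s : ℕ → σ, Computable s ∧ s 0 = x₀ ∧ ∀ n, Inv n (s n) ∧ R n (s n) (s (n + 1)) := by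
  obtain ⟨f, hf, hfR, hfd⟩ := (hR.comp' (f := fun x : (ℕ × σ) × σ => (x.1.1, x.1.2, x.2))
    (by fun_prop)).uniformize (R := fun (a : ℕ × σ) b => R a.1 a.2 b)
  -- The invariant travels with the state, as it is what guarantees that the search for the next
  -- state halts.
  let u : ∀ n : ℕ, {x // Inv n x} := fun n => Nat.rec ⟨x₀, h₀⟩ (fun n x =>
    ⟨(f (n, x.1)).get (hfd (n, x.1) (h n x.1 x.2)),
      hInv n x.1 _ x.2 (hfR (n, x.1) _ (Part.get_mem _))⟩) n
  refine ⟨fun n => (u n).1, ?_, rfl, fun n => ⟨(u n).2, hfR (n, (u n).1) _ (Part.get_mem _)⟩⟩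
  have : Partrec fun n : ℕ => (n.rec (motive := fun _ => Part σ) (Part.some x₀)
      (fun y IH => IH.bind fun i => f (y, i)) : Part σ) :=
    Partrec.nat_rec (f := fun n : ℕ => n) (g := fun _ => Part.some x₀) (h := fun _ p => f p)
      Computable.id (Computable.const x₀) (hf.comp Computable.snd)
  refine this.of_eq_tot fun n => ?_
  induction n with
  | zero => exact Part.mem_some _
  | succ n ih => exact Part.mem_bind ih (Part.get_mem _)

end REPred

/-! ### Presentations obtained from enumerations -/

namespace Coding

open Classical in
/-- A surjection from `ℕ` with decidable kernel gives a presentation, an element being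
represented by its least preimage. -/
noncomputable def ofSurjective {A : Type} (φ : ℕ → A) (hφ : Function.Surjective φ)
    (h : ComputablePred fun x : ℕ × ℕ => φ x.1 = φ x.2) : Coding A where
  code a := Nat.find (hφ a)
  injective a b hab := by
    rw [← Nat.find_spec (hφ a), ← Nat.find_spec (hφ b)]
    exact congrArg φ hab
  domain_computable := by
    -- The codes are the numbers `n` with no smaller `m` naming the same element.
    refine (ComputablePred.forall_lt (N := fun n : ℕ => n) (p := fun n m => ¬ φ m = φ n)
      (by fun_prop) (h.comp' (f := fun x : ℕ × ℕ => (x.2, x.1)) (by fun_prop)).not).of_eq ?_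
    intro n
    constructor
    · intro hn
      refine ⟨φ n, ?_⟩
      exact (Nat.find_eq_iff _).2 ⟨rfl, fun m hm => hn m hm⟩
    · rintro ⟨a, rfl⟩ m hm
      rw [Nat.find_spec (hφ a)]
      exact Nat.find_min (hφ a) hm

variable {A : Type} {φ : ℕ → A} {hφ : Function.Surjective φ}
    {h : ComputablePred fun x : ℕ × ℕ => φ x.1 = φ x.2}

theorem apply_ofSurjective_code (a : A) : φ ((ofSurjective φ hφ h).code a) = a :=
  by classical exact Nat.find_spec (hφ a)

/-- Replacing an index by the least equivalent one is computable, so operations may be computed on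
arbitrary indices and normalized afterwards. -/
theorem exists_normalForm : ∃ g : ℕ → ℕ, Computable g ∧
    ∀ n, g n = (ofSurjective φ hφ h).code (φ n) := by
  classical
  refine ⟨fun n => Nat.find (hφ (φ n)), ?_, fun n => rfl⟩
  exact Computable.find (P := fun n m => φ m = φ n)
    (h.comp' (f := fun x : ℕ × ℕ => (x.2, x.1)) (by fun_prop)) fun n => hφ (φ n)

theorem isComputableOp_ofSurjective {op : A → A → A} (f : ℕ → ℕ → ℕ)
    (hf : Computable fun x : ℕ × ℕ => f x.1 x.2) (hfop : ∀ m n, φ (f m n) = op (φ m) (φ n)) :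
    (ofSurjective φ hφ h).IsComputableOp op := by
  obtain ⟨g, hg, hgn⟩ := exists_normalForm (hφ := hφ) (h := h)
  refine ⟨fun m n => g (f m n), ?_, fun a b => ?_⟩
  · exact Computable₂.mk (by fun_prop)
  · simp only [hgn]
    rw [hfop, apply_ofSurjective_code (φ := φ), apply_ofSurjective_code (φ := φ)]

end Coding

open Polynomial

/-! ### Integer arithmetic and finite search spaces of integer lists -/

namespace Computable

variable {α β : Type*} [Primcodable α] [Primcodable β]

/-- The code is 2z for z ≥ 0 and -2z - 1 for z < 0; truncated subtraction merges the two cases, the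
second summand being 0 when z ≥ 0. -/
theorem encode_int (z : ℤ) :
    Encodable.encode z = 2 * z.toNat + (2 * (-z).toNat - 1) := by
  rcases z with n | n
  · have : Encodable.encode (Int.ofNat n) = 2 * n := rfl
    rw [this]; simp only [Int.ofNat_eq_natCast]; omega
  · have : Encodable.encode (Int.negSucc n) = 2 * n + 1 := rfl
    rw [this]; omega

theorem ofNat_int_eq {n : ℕ} {z : ℤ} (h : n = 2 * z.toNat + (2 * (-z).toNat - 1)) :
    Denumerable.ofNat ℤ n = z := by
  rw [h, ← encode_int, Denumerable.ofNat_encode]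

@[fun_prop] theorem fp_int_toNat {f : α → ℤ} (hf : Computable f) :
    Computable (fun a => (f a).toNat) := by
  have : Computable fun a => bif (Encodable.encode (f a)).bodd then 0
      else (Encodable.encode (f a)).div2 :=
    Computable.cond (Computable.nat_bodd.comp (by fun_prop)) (by fun_prop)
      (Computable.nat_div2.comp (by fun_prop))
  refine this.of_eq fun a => ?_
  rw [encode_int]
  generalize f a = z
  rcases z with n | n
  · have : 2 * (Int.ofNat n).toNat + (2 * (-Int.ofNat n).toNat - 1) = 2 * n := by
      simp only [Int.ofNat_eq_natCast]; omega
    rw [this]; simp [Nat.div2_val]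
  · have : 2 * (Int.negSucc n).toNat + (2 * (-Int.negSucc n).toNat - 1) = 2 * n + 1 := by omega
    rw [this]; simp

@[fun_prop] theorem fp_natCast_sub {f g : α → ℕ} (hf : Computable f) (hg : Computable g) :
    Computable (fun a => (f a : ℤ) - (g a : ℤ)) := by
  have : Computable fun a => Denumerable.ofNat ℤ (2 * (f a - g a) + (2 * (g a - f a) - 1)) := by
    fun_prop
  exact this.of_eq fun a => ofNat_int_eq (by omega)

@[fun_prop] theorem fp_natCast {f : α → ℕ} (hf : Computable f) :
    Computable (fun a => (f a : ℤ)) := by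
  have : Computable fun a => (f a : ℤ) - ((0 : ℕ) : ℤ) := by fun_prop
  exact this.of_eq fun a => by simp

@[fun_prop] theorem fp_int_neg {f : α → ℤ} (hf : Computable f) : Computable (fun a => -f a) := by
  have : Computable fun a => Denumerable.ofNat ℤ
      (bif (Encodable.encode (f a)).bodd then Encodable.encode (f a) + 1
        else Encodable.encode (f a) - 1) := by
    refine Computable.fp_ofNat (Computable.cond (Computable.nat_bodd.comp (by fun_prop))
      (by fun_prop) (by fun_prop))
  refine this.of_eq fun a => ?_
  rw [encode_int]
  generalize f a = z
  apply ofNat_int_eq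
  rcases z with n | n
  · have : 2 * (Int.ofNat n).toNat + (2 * (-Int.ofNat n).toNat - 1) = 2 * n := by
      simp only [Int.ofNat_eq_natCast]; omega
    rw [this]
    simp only [Int.ofNat_eq_natCast, Nat.bodd_mul, Nat.bodd_two, Bool.false_and, cond_false]; omega
  · have : 2 * (Int.negSucc n).toNat + (2 * (-Int.negSucc n).toNat - 1) = 2 * n + 1 := by omega
    have hb : (2 * n + 1).bodd = true := by simp
    rw [this, hb, cond_true]; omega

@[fun_prop] theorem fp_int_add {f g : α → ℤ} (hf : Computable f) (hg : Computable g) :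
    Computable (fun a => f a + g a) := by
  have : Computable fun a => (((f a).toNat + (g a).toNat : ℕ) : ℤ)
      - (((-f a).toNat + (-g a).toNat : ℕ) : ℤ) := by fun_prop
  exact this.of_eq fun a => by push_cast; omega

@[fun_prop] theorem fp_int_sub {f g : α → ℤ} (hf : Computable f) (hg : Computable g) :
    Computable (fun a => f a - g a) := by
  have : Computable fun a => f a + -g a := by fun_prop
  exact this.of_eq fun a => by ring

@[fun_prop] theorem fp_int_mul {f g : α → ℤ} (hf : Computable f) (hg : Computable g) :
    Computable (fun a => f a * g a) := by
  have : Computable fun a =>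
      (((f a).toNat * (g a).toNat + (-f a).toNat * (-g a).toNat : ℕ) : ℤ)
      - (((f a).toNat * (-g a).toNat + (-f a).toNat * (g a).toNat : ℕ) : ℤ) := by fun_prop
  refine this.of_eq fun a => ?_
  have h1 : f a = (f a).toNat - (-f a).toNat := by omega
  have h2 : g a = (g a).toNat - (-g a).toNat := by omega
  conv_rhs => rw [h1, h2]
  push_cast; ring

end Computable

/-- All lists of length `d` with entries in `L`. -/
def tuples {β : Type*} (L : List β) (d : ℕ) : List (List β) :=
  Nat.rec [[]] (fun _ T => T.flatMap fun t => L.map fun b => b :: t) d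

theorem mem_tuples {β : Type*} {L : List β} {d : ℕ} {l : List β} :
    l ∈ tuples L d ↔ l.length = d ∧ ∀ b ∈ l, b ∈ L := by
  induction d generalizing l with
  | zero =>
    have : tuples L 0 = [[]] := rfl
    rw [this, List.mem_singleton, List.length_eq_zero_iff]
    exact ⟨fun h => ⟨h, by simp [h]⟩, fun h => h.1⟩
  | succ d ih =>
    have : tuples L (d + 1) = (tuples L d).flatMap fun t => L.map fun b => b :: t := rfl
    rw [this, List.mem_flatMap]
    constructor
    · rintro ⟨t, ht, hl⟩
      obtain ⟨b, hb, rfl⟩ := List.mem_map.1 hl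
      obtain ⟨h1, h2⟩ := ih.1 ht
      refine ⟨by simp [h1], fun c hc => ?_⟩
      rcases List.mem_cons.1 hc with rfl | hc
      exacts [hb, h2 c hc]
    · rintro ⟨h1, h2⟩
      rcases l with _ | ⟨b, t⟩
      · simp at h1
      · exact ⟨t, ih.2 ⟨by simpa using h1, fun c hc => h2 c (by simp [hc])⟩,
          List.mem_map.2 ⟨b, h2 b (by simp), rfl⟩⟩

@[fun_prop] theorem Computable.fp_tuples {α β : Type*} [Primcodable α] [Primcodable β]
    {f : α → List β} {g : α → ℕ} (hf : Computable f) (hg : Computable g) :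
    Computable (fun a => tuples (f a) (g a)) := by
  have : Computable fun a => Nat.rec (motive := fun _ => List (List β)) [[]]
      (fun _ T => T.flatMap fun t => (f a).map fun b => b :: t) (g a) := by fun_prop
  exact this

/-- The integers between `-B` and `B`. -/
def intRange (B : ℕ) : List ℤ := (List.range (2 * B + 1)).map fun n : ℕ => (n : ℤ) - (B : ℤ)

theorem mem_intRange {B : ℕ} {z : ℤ} : z ∈ intRange B ↔ z.natAbs ≤ B := by
  simp only [intRange, List.mem_map, List.mem_range]
  constructor
  · rintro ⟨n, hn, rfl⟩; omega
  · intro h; exact ⟨(z + B).toNat, by omega, by omega⟩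

@[fun_prop] theorem Computable.fp_intRange {α : Type*} [Primcodable α]
    {f : α → ℕ} (hf : Computable f) : Computable (fun a => intRange (f a)) := by
  unfold intRange; fun_prop

/-! ### Integer polynomials as coefficient lists, and bounds for factors -/

namespace IntPoly

/-- The integer polynomial with the given coefficient list. -/
noncomputable def toPoly (l : List ℤ) : ℤ[X] := l.foldr (fun a p => C a + X * p) 0

@[simp] theorem toPoly_nil : toPoly [] = 0 := rfl

@[simp] theorem toPoly_cons (a : ℤ) (l : List ℤ) : toPoly (a :: l) = C a + X * toPoly l := rfl

theorem coeff_toPoly (l : List ℤ) (n : ℕ) : (toPoly l).coeff n = l.getD n 0 := by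
  induction l generalizing n with
  | nil => simp
  | cons a l ih =>
    cases n with
    | zero => simp
    | succ n => simp only [toPoly_cons, coeff_add, coeff_C_succ, coeff_X_mul, ih,
        List.getD_cons_succ, zero_add]

theorem degree_toPoly_lt (l : List ℤ) : (toPoly l).degree < l.length := by
  rw [degree_lt_iff_coeff_zero]
  intro m hm
  rw [coeff_toPoly, List.getD_eq_default _ _ hm]

theorem toPoly_map_range (f : ℕ → ℤ) (p : ℤ[X]) (d : ℕ) (h : ∀ n < d, f n = p.coeff n)
    (hd : p.degree < d) : toPoly ((List.range d).map f) = p := by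
  ext n
  rw [coeff_toPoly]
  by_cases hn : n < d
  · simp [List.getD, hn, h n hn]
  · rw [List.getD_eq_default _ _ (by simpa using hn)]
    exact (coeff_eq_zero_of_degree_lt (hd.trans_le (by exact_mod_cast not_lt.1 hn))).symm

/-- The list is padded to the prescribed length and has only coefficients of `p` as entries, which
is the form needed to find `p` in a finite search by `tuples`. -/
theorem toPoly_surjective (p : ℤ[X]) (d : ℕ) (hd : p.degree < d) :
    ∃ l : List ℤ, l.length = d ∧ toPoly l = p ∧ ∀ a ∈ l, ∃ n, a = p.coeff n :=
  ⟨(List.range d).map p.coeff, by simp, toPoly_map_range _ p d (fun _ _ => rfl) hd, fun a ha => by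
    obtain ⟨n, -, rfl⟩ := List.mem_map.1 ha; exact ⟨n, rfl⟩⟩

theorem exists_toPoly (p : ℤ[X]) : ∃ l : List ℤ, toPoly l = p := by
  obtain ⟨l, -, h, -⟩ := toPoly_surjective p (p.natDegree + 1)
    (degree_le_natDegree.trans_lt (by exact_mod_cast Nat.lt_succ_self _))
  exact ⟨l, h⟩

def add (p q : List ℤ) : List ℤ :=
  (List.range (max p.length q.length)).map fun n => p.getD n 0 + q.getD n 0

def sub (p q : List ℤ) : List ℤ :=
  (List.range (max p.length q.length)).map fun n => p.getD n 0 - q.getD n 0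

def mul (p q : List ℤ) : List ℤ :=
  p.foldr (fun a r => add (q.map fun b => a * b) (0 :: r)) []

def comp (p q : List ℤ) : List ℤ := p.foldr (fun a r => add [a] (mul q r)) []

@[simp] theorem toPoly_add (p q : List ℤ) : toPoly (add p q) = toPoly p + toPoly q := by
  refine toPoly_map_range _ _ _ (fun n _ => by simp [coeff_toPoly]) ?_
  refine (degree_add_le _ _).trans_lt (max_lt ?_ ?_)
  · exact (degree_toPoly_lt p).trans_le (by exact_mod_cast le_max_left _ _)
  · exact (degree_toPoly_lt q).trans_le (by exact_mod_cast le_max_right _ _)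

@[simp] theorem toPoly_sub (p q : List ℤ) : toPoly (sub p q) = toPoly p - toPoly q := by
  refine toPoly_map_range _ _ _ (fun n _ => by simp [coeff_toPoly]) ?_
  refine (degree_sub_le _ _).trans_lt (max_lt ?_ ?_)
  · exact (degree_toPoly_lt p).trans_le (by exact_mod_cast le_max_left _ _)
  · exact (degree_toPoly_lt q).trans_le (by exact_mod_cast le_max_right _ _)

theorem toPoly_smul (a : ℤ) (q : List ℤ) : toPoly (q.map fun b => a * b) = C a * toPoly q := by
  induction q with
  | nil => simp
  | cons b q ih => simp only [List.map_cons, toPoly_cons, ih, C_mul]; ring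

@[simp] theorem toPoly_mul (p q : List ℤ) : toPoly (mul p q) = toPoly p * toPoly q := by
  induction p with
  | nil => simp [mul]
  | cons a p ih =>
    have : mul (a :: p) q = add (q.map fun b => a * b) (0 :: mul p q) := rfl
    rw [this, toPoly_add, toPoly_smul, toPoly_cons, ih, toPoly_cons]
    simp; ring

@[simp] theorem toPoly_comp (p q : List ℤ) : toPoly (comp p q) = (toPoly p).comp (toPoly q) := by
  induction p with
  | nil => simp [comp]
  | cons a p ih =>
    have : comp (a :: p) q = add [a] (mul q (comp p q)) := rfl
    rw [this, toPoly_add, toPoly_mul, ih]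
    simp

theorem aeval_toPoly {R : Type*} [CommRing R] (x : R) (l : List ℤ) :
    aeval x (toPoly l) = l.foldr (fun (a : ℤ) (s : R) => (a : R) + x * s) 0 := by
  induction l with
  | nil => simp
  | cons a l ih => simp [ih]

variable {α : Type*} [Primcodable α]

@[fun_prop] theorem computable_add {f g : α → List ℤ} (hf : Computable f) (hg : Computable g) :
    Computable (fun a => add (f a) (g a)) := by unfold add; fun_prop

@[fun_prop] theorem computable_sub {f g : α → List ℤ} (hf : Computable f) (hg : Computable g) :
    Computable (fun a => sub (f a) (g a)) := by unfold sub; fun_prop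

@[fun_prop] theorem computable_mul {f g : α → List ℤ} (hf : Computable f) (hg : Computable g) :
    Computable (fun a => mul (f a) (g a)) := by unfold mul; fun_prop

@[fun_prop] theorem computable_comp {f g : α → List ℤ} (hf : Computable f) (hg : Computable g) :
    Computable (fun a => comp (f a) (g a)) := by unfold comp; fun_prop

theorem toPoly_eq_zero_iff (l : List ℤ) : toPoly l = 0 ↔ ∀ a ∈ l, a = 0 := by
  constructor
  · intro h a ha
    obtain ⟨n, hn, rfl⟩ := List.getElem_of_mem ha
    have := coeff_toPoly l n
    rw [h] at this
    simpa [hn] using this.symm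
  · intro h
    ext n
    rw [coeff_toPoly, coeff_zero]
    by_cases hn : n < l.length
    · simpa [hn] using h _ (List.getElem_mem hn)
    · exact List.getD_eq_default _ _ (not_lt.1 hn)

theorem computablePred_eq_zero {f : α → List ℤ} (hf : Computable f) :
    ComputablePred fun a => toPoly (f a) = 0 :=
  (ComputablePred.forall_mem (L := f) (p := fun _ b => b = 0) hf
    (ComputablePred.eq' (by fun_prop) (by fun_prop))).of_eq fun a => (toPoly_eq_zero_iff _).symm

theorem computablePred_eq {f g : α → List ℤ} (hf : Computable f) (hg : Computable g) :
    ComputablePred fun a => toPoly (f a) = toPoly (g a) :=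
  (computablePred_eq_zero (f := fun a => sub (f a) (g a)) (by fun_prop)).of_eq fun a => by
    rw [toPoly_sub, sub_eq_zero]

/-- Divisibility of integer polynomials is c.e. -/
theorem rePred_dvd {f g : α → List ℤ} (hf : Computable f) (hg : Computable g) :
    REPred fun a => toPoly (f a) ∣ toPoly (g a) := by
  refine (REPred.exists' (p := fun a (u : List ℤ) => toPoly (g a) = toPoly (mul (f a) u))
    (computablePred_eq (by fun_prop) (by fun_prop)).to_re).of_eq fun a => ?_
  constructor
  · rintro ⟨u, hu⟩; exact ⟨toPoly u, by rw [hu, toPoly_mul]⟩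
  · rintro ⟨u, hu⟩
    obtain ⟨l, rfl⟩ := exists_toPoly u
    exact ⟨l, by rw [hu, toPoly_mul]⟩

/-- A bound for the coefficients of the divisors of a polynomial. -/
def factorBound (l : List ℤ) : ℕ :=
  2 ^ l.length * l.foldr (fun a s => a.toNat + (-a).toNat + s) 0

@[fun_prop] theorem computable_factorBound {f : α → List ℤ} (hf : Computable f) :
    Computable (fun a => factorBound (f a)) := by unfold factorBound; fun_prop

theorem sum_norm_coeff_toPoly_le (l : List ℤ) :
    (((toPoly l).map (Int.castRingHom ℂ)).sum fun _ a => ‖a‖) ≤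
      (l.foldr (fun a s => a.toNat + (-a).toNat + s) 0 : ℕ) := by
  rcases eq_or_ne l [] with rfl | hl
  · simp
  rw [sum_over_range' _ (fun _ => norm_zero) l.length]
  · clear hl
    induction l with
    | nil => simp
    | cons a l ih =>
      rw [List.length_cons, Finset.sum_range_succ']
      simp only [coeff_map, coeff_toPoly, List.getD_cons_succ, List.getD_cons_zero] at ih ⊢
      simp only [List.foldr_cons]
      push_cast
      have ha : ‖(Int.castRingHom ℂ) a‖ = (a.toNat : ℝ) + ((-a).toNat : ℝ) := by
        simp only [eq_intCast, Complex.norm_intCast]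
        have : |a| = (a.toNat : ℤ) + ((-a).toNat : ℤ) := by rw [Int.abs_eq_natAbs]; omega
        exact_mod_cast this
      rw [ha]; linarith
  · by_cases h : (toPoly l).map (Int.castRingHom ℂ) = 0
    · rw [h]
      simpa using List.length_pos_iff.2 hl
    · rw [natDegree_lt_iff_degree_lt h]
      exact (degree_map_le).trans_lt (degree_toPoly_lt l)

/-- The coefficients of a divisor of a nonzero polynomial are bounded. -/
theorem natAbs_coeff_le_of_dvd {g : ℤ[X]} {l : List ℤ} (hl : toPoly l ≠ 0) (hg : g ∣ toPoly l)
    (n : ℕ) : (g.coeff n).natAbs ≤ factorBound l := by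
  obtain ⟨h, hh⟩ := hg
  have hh0 : h ≠ 0 := by rintro rfl; simp at hh; exact hl hh
  have hg0 : g ≠ 0 := by rintro rfl; simp at hh; exact hl hh
  -- The cofactor `h` is a nonzero integer polynomial, so its Mahler measure is at least 1 and that
  -- of `g` is at most that of the product, hence at most the sum of the absolute values of its
  -- coefficients. A coefficient exceeds the measure by at most a binomial factor.
  have key := norm_coeff_le_choose_mul_mahlerMeasure_of_one_le_mahlerMeasure n
    (g.map (Int.castRingHom ℂ)) (h.map (Int.castRingHom ℂ)) (one_le_mahlerMeasure_of_ne_zero hh0)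
  rw [← Polynomial.map_mul, ← hh] at key
  have h1 := (mahlerMeasure_le_sum_norm_coeff _).trans (sum_norm_coeff_toPoly_le l)
  have hdeg : (g.map (Int.castRingHom ℂ)).natDegree ≤ l.length := by
    refine natDegree_map_le.trans ((natDegree_le_of_dvd ⟨h, hh⟩ hl).trans ?_)
    exact natDegree_le_of_degree_le (degree_toPoly_lt l).le
  have h2 : ((g.map (Int.castRingHom ℂ)).natDegree.choose n : ℝ) ≤ (2 ^ l.length : ℕ) := by
    exact_mod_cast (Nat.choose_le_two_pow _ _).trans (Nat.pow_le_pow_right (by norm_num) hdeg)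
  have h3 := key.trans (mul_le_mul h2 h1 (mahlerMeasure_nonneg _) (by positivity))
  rw [coeff_map, eq_intCast, Complex.norm_intCast] at h3
  have h4 : ((g.coeff n).natAbs : ℝ) = |((g.coeff n : ℤ) : ℝ)| := by
    rw [Nat.cast_natAbs, Int.cast_abs]
  rw [← h4] at h3
  unfold factorBound
  exact_mod_cast h3

end IntPoly

/-- If `θ` is integral and `N ≠ 0`, then `1 / N` is an integral polynomial in `θ + 1 / N`. -/
theorem inv_mem_adjoin_add_inv {E : Type*} [Field E] [CharZero E] {θ : E} (hθ : IsIntegral ℤ θ)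
    {N : ℤ} (hN : N ≠ 0) : ((N : E)⁻¹) ∈ Algebra.adjoin ℤ {θ + (N : E)⁻¹} := by
  set δ := θ + (N : E)⁻¹ with hδ
  set R := Algebra.adjoin ℤ {δ} with hR
  have hδR : δ ∈ R := Algebra.self_mem_adjoin_singleton ℤ δ
  have hN' : (N : E) ≠ 0 := by exact_mod_cast hN
  obtain ⟨p, hp, hpθ⟩ := hθ
  have hpθ' : aeval θ p = 0 := hpθ
  -- With δ = θ + 1/N one has Nθ = Nδ - 1. The monic equation of Nθ is congruent to X^d modulo N, so
  -- (Nδ - 1)^d lies in Nℤ[δ]. Since (Nδ - 1)^d also differs from (-1)^d by a multiple of Nδ, N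
  -- divides 1 in ℤ[δ].
  have h1 := scaleRoots_aeval_eq_zero (r := N) hpθ'
  have hdvd : C N ∣ p.scaleRoots N - X ^ p.natDegree := by
    rw [C_dvd_iff_dvd_coeff]
    intro i
    rw [coeff_sub, coeff_scaleRoots, coeff_X_pow]
    rcases lt_trichotomy i p.natDegree with hi | rfl | hi
    · rw [if_neg hi.ne, sub_zero]
      exact Dvd.dvd.mul_left (dvd_pow_self _ (by omega)) _
    · simp [hp.coeff_natDegree]
    · rw [if_neg hi.ne', coeff_eq_zero_of_natDegree_lt hi]; simp
  obtain ⟨r, hr⟩ := hdvd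
  have hy : (algebraMap ℤ E) N * θ = N * δ - 1 := by
    rw [hδ]; simp only [eq_intCast]; field_simp; ring
  have h2 : ((N : E) * δ - 1) ^ p.natDegree = -(N * aeval ((N : E) * δ - 1) r) := by
    have h3 := congrArg (aeval ((N : E) * δ - 1)) hr
    rw [map_sub, ← hy, h1] at h3
    rw [← hy]
    simp only [map_pow, aeval_X, map_mul, eq_intCast, map_intCast] at h3 ⊢
    linear_combination -h3
  obtain ⟨t, ht⟩ := sub_dvd_pow_sub_pow ((⟨(N : E) * δ - 1, R.sub_mem (R.mul_mem
    (intCast_mem R N) hδR) R.one_mem⟩ : R)) (-1) p.natDegree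
  have ht' := congrArg (Subtype.val) ht
  simp only [AddSubgroupClass.coe_sub, SubmonoidClass.coe_pow, MulMemClass.coe_mul,
    NegMemClass.coe_neg, OneMemClass.coe_one] at ht'
  have hs : ((-1 : E) ^ p.natDegree) * ((-1 : E) ^ p.natDegree) = 1 := by
    rw [← mul_pow]; simp
  have h5 : (N : E)⁻¹ = (-1 : E) ^ p.natDegree * (-(aeval ((N : E) * δ - 1) r) - δ * t) := by
    have h6 : (N : E) * (-(aeval ((N : E) * δ - 1) r) - δ * t) = (-1) ^ p.natDegree := by
      rw [h2] at ht'
      linear_combination ht'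
    field_simp
    linear_combination (-1 : E) ^ p.natDegree * h6.symm - hs
  rw [h5]
  refine R.mul_mem (R.pow_mem (R.neg_mem R.one_mem) _) (R.sub_mem (R.neg_mem ?_)
    (R.mul_mem hδR t.2))
  have hz : (N : E) * δ - 1 ∈ R := R.sub_mem (R.mul_mem (intCast_mem R N) hδR) R.one_mem
  have := Subalgebra.aeval_coe R ⟨_, hz⟩ r
  simp only at this
  rw [this]
  exact (aeval (⟨_, hz⟩ : R) r).2

/-! ### Minimal polynomials and generators with integer coefficients -/

section FractionField

variable (k : Type*) [Field k] [CharZero k] [IsFractionRing ℤ k]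
  {E : Type*} [Field E] [Algebra k E]

/-- The primitive integer multiple of the minimal polynomial over `Frac ℤ`. -/
theorem exists_primitive_minpoly (y : E)
    (hy : IsIntegral k y) : ∃ g : ℤ[X], g.IsPrimitive ∧
      g.natDegree = (minpoly k y).natDegree ∧ Irreducible (g.map (algebraMap ℤ k)) ∧
      ∀ p : ℤ[X], aeval y p = 0 ↔ g ∣ p := by
  obtain ⟨b, hbM, hb⟩ := IsLocalization.integerNormalization_spec (nonZeroDivisors ℤ) (minpoly k y)
  set n := IsLocalization.integerNormalization (nonZeroDivisors ℤ) (minpoly k y) with hn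
  have hb0 : b ≠ 0 := nonZeroDivisors.ne_zero hbM
  have hm0 := minpoly.ne_zero hy
  have hn0 : n ≠ 0 := by
    intro h
    rw [h, Polynomial.map_zero] at hb
    exact (smul_ne_zero hb0 hm0) hb.symm
  have hassoc : Associated (n.primPart.map (algebraMap ℤ k)) (minpoly k y) := by
    have h1 : n.map (algebraMap ℤ k) = C (n.content : k) * n.primPart.map (algebraMap ℤ k) := by
      conv_lhs => rw [n.eq_C_content_mul_primPart]
      simp
    rw [h1] at hb
    have hc0 : (n.content : k) ≠ 0 := by exact_mod_cast (mt content_eq_zero_iff.1 hn0)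
    have u1 : IsUnit (C (n.content : k)) := isUnit_C.2 (isUnit_iff_ne_zero.2 hc0)
    have u2 : IsUnit (C (b : k)) := isUnit_C.2 (isUnit_iff_ne_zero.2 (by exact_mod_cast hb0))
    have h2 : b • minpoly k y = C (b : k) * minpoly k y := by
      rw [zsmul_eq_mul]; simp
    have h2' : C (n.content : k) * n.primPart.map (algebraMap ℤ k) = C (b : k) * minpoly k y := by
      rw [← h2]; exact hb
    refine (associated_isUnit_mul_left_iff u1).1 ?_
    rw [h2']
    exact (associated_isUnit_mul_left_iff u2).2 (Associated.refl _)
  refine ⟨n.primPart, n.isPrimitive_primPart, ?_, ?_, ?_⟩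
  · rw [← natDegree_eq_of_degree_eq (degree_eq_degree_of_associated hassoc),
      natDegree_map_eq_of_injective (IsFractionRing.injective ℤ k)]
  · exact hassoc.symm.irreducible (minpoly.irreducible hy)
  · intro p
    -- Gauss's lemma moves divisibility by a primitive polynomial from k[X] to ℤ[X].
    rw [n.isPrimitive_primPart.dvd_iff_fraction_map_dvd_fraction_map (K := k), hassoc.dvd_iff_dvd_left,
      minpoly.dvd_iff, aeval_map_algebraMap]

open IntermediateField in
-- The finite separable extension k(x, y) has finitely many intermediate fields, so two of the
-- fields k(x + ny) coincide. Their common field contains a nonzero integer multiple of y, hence y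
-- and x. A natural multiplier keeps later searches over numbers.
theorem exists_nat_primitive [Algebra.IsAlgebraic k E]
    (x y : E) : ∃ n : ℕ, x ∈ k⟮x + n * y⟯ ∧ y ∈ k⟮x + n * y⟯ := by
  set F : IntermediateField k E := k⟮x, y⟯ with hF
  have hx : x ∈ F := subset_adjoin k _ (by simp)
  have hy : y ∈ F := subset_adjoin k _ (by simp)
  have : FiniteDimensional k F := by
    rw [hF]
    exact finiteDimensional_adjoin fun z _ => (Algebra.IsAlgebraic.isAlgebraic z).isIntegral
  have hfin : Finite (IntermediateField k F) :=
    (Field.exists_primitive_element_iff_finite_intermediateField k F).1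
      ⟨inferInstance, Field.exists_primitive_element k F⟩
  obtain ⟨m, n, hmn, h⟩ := Finite.exists_ne_map_eq_of_infinite
    fun n : ℕ => (IntermediateField.comap F.val k⟮x + n * y⟯)
  have key : ∀ i : ℕ, (⟨x + i * y, F.add_mem hx (F.mul_mem (_root_.natCast_mem F i) hy)⟩ : F) ∈
      IntermediateField.comap F.val k⟮x + i * y⟯ := fun i => mem_adjoin_simple_self k _
  have h1 : x + m * y ∈ k⟮x + m * y⟯ := mem_adjoin_simple_self k _
  have h2 : x + n * y ∈ k⟮x + m * y⟯ := by
    have := key n; rw [← h] at this; exact this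
  have h3 : y ∈ k⟮x + m * y⟯ := by
    have h4 := sub_mem h1 h2
    have h5 : ((m : E) - n) ≠ 0 := sub_ne_zero.2 (by
      have : CharZero E := charZero_of_injective_algebraMap (algebraMap k E).injective
      exact_mod_cast hmn)
    have h6 : y = ((m : E) - n)⁻¹ * (x + m * y - (x + n * y)) := by field_simp; ring
    have h7 := mul_mem (inv_mem (sub_mem (_root_.natCast_mem k⟮x + m * y⟯ m)
      (_root_.natCast_mem k⟮x + m * y⟯ n))) h4
    rwa [← h6] at h7
  refine ⟨m, ?_, h3⟩
  have h4 := sub_mem h1 (mul_mem (_root_.natCast_mem _ m) h3)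
  simpa using h4

open IntermediateField in
theorem exists_int_mul_eq_aeval [Algebra.IsAlgebraic k E]
    {x y : E} (h : x ∈ k⟮y⟯) : ∃ (N : ℤ) (p : ℤ[X]), N ≠ 0 ∧ N * x = aeval y p := by
  have hy : IsAlgebraic k y := Algebra.IsAlgebraic.isAlgebraic y
  rw [← mem_toSubalgebra, adjoin_simple_toSubalgebra_of_isAlgebraic hy,
    Algebra.adjoin_singleton_eq_range_aeval] at h
  obtain ⟨p, rfl⟩ := h
  obtain ⟨b, hbM, hb⟩ := IsLocalization.integerNormalization_spec (nonZeroDivisors ℤ) p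
  refine ⟨b, IsLocalization.integerNormalization (nonZeroDivisors ℤ) p,
    nonZeroDivisors.ne_zero hbM, ?_⟩
  rw [← aeval_map_algebraMap k, hb]
  simp

/-- A primitive element is scaled to an integral θ, and x, y become integer polynomials in θ up to
denominators N₁, N₂. Replacing θ by θ + 1/(N₁N₂) puts the denominators into the ring. Elements of
the closure can thus be written as integer polynomials in a generator, with no fractions. -/
theorem exists_common_int_generator [Algebra.IsAlgebraic k E] (x y : E) :
    ∃ z : E, x ∈ Algebra.adjoin ℤ {z} ∧ y ∈ Algebra.adjoin ℤ {z} := by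
  have : CharZero E := charZero_of_injective_algebraMap (algebraMap k E).injective
  obtain ⟨n, hx, hy⟩ := exists_nat_primitive k x y
  set w := x + n * y
  obtain ⟨m, hm0, hm⟩ : ∃ m : ℤ, m ≠ 0 ∧ IsIntegral ℤ ((m : E) * w) := by
    have : IsAlgebraic ℤ w := (IsFractionRing.isAlgebraic_iff ℤ k E).2
      (Algebra.IsAlgebraic.isAlgebraic w)
    obtain ⟨m, hm0, hm⟩ := this.exists_integral_multiple
    exact ⟨m, hm0, by simpa using hm⟩
  have hw : w ∈ IntermediateField.adjoin k {(m : E) * w} := by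
    have h1 := IntermediateField.mem_adjoin_simple_self k ((m : E) * w)
    have h2 : w = (m : E)⁻¹ * ((m : E) * w) := by
      have : (m : E) ≠ 0 := by exact_mod_cast hm0
      field_simp
    have h3 := mul_mem (inv_mem (intCast_mem (IntermediateField.adjoin k {(m : E) * w}) m)) h1
    rwa [← h2] at h3
  have hle := IntermediateField.adjoin_simple_le_iff.2 hw
  set θ := (m : E) * w
  obtain ⟨N₁, p₁, hN₁, hp₁⟩ := exists_int_mul_eq_aeval k (hle hx)
  obtain ⟨N₂, p₂, hN₂, hp₂⟩ := exists_int_mul_eq_aeval k (hle hy)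
  have hinv := inv_mem_adjoin_add_inv hm (mul_ne_zero hN₁ hN₂)
  set z := θ + (((N₁ * N₂ : ℤ) : E))⁻¹ with hz
  set R := Algebra.adjoin ℤ {z}
  have hθ : θ ∈ R := by
    have := R.sub_mem (Algebra.self_mem_adjoin_singleton ℤ z) hinv
    rwa [hz, add_sub_cancel_right] at this
  have hev : ∀ p : ℤ[X], aeval θ p ∈ R := fun p => by
    have := Subalgebra.aeval_coe R ⟨_, hθ⟩ p
    simp only at this
    rw [this]
    exact (aeval (⟨_, hθ⟩ : R) p).2
  have hN₁' : (N₁ : E) ≠ 0 := by exact_mod_cast hN₁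
  have hN₂' : (N₂ : E) ≠ 0 := by exact_mod_cast hN₂
  refine ⟨z, ?_, ?_⟩
  · have : x = N₂ * ((N₁ * N₂ : ℤ) : E)⁻¹ * aeval θ p₁ := by
      rw [← hp₁]; push_cast; field_simp
    rw [this]
    exact R.mul_mem (R.mul_mem (intCast_mem R _) hinv) (hev _)
  · have : y = N₁ * ((N₁ * N₂ : ℤ) : E)⁻¹ * aeval θ p₂ := by
      rw [← hp₂]; push_cast; field_simp
    rw [this]
    exact R.mul_mem (R.mul_mem (intCast_mem R _) hinv) (hev _)

end FractionField

/-! ### Testing irreducibility, and a computable tower of simple extensions -/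

namespace IntPoly

/-- A decidable test for irreducibility: `f` is not a product of two polynomials of smaller degree
whose coefficients satisfy the a priori bound for factors of `f`. -/
def IrrTest (f : List ℤ) : Prop :=
  f.getD (f.length - 1) 0 ≠ 0 ∧ 2 ≤ f.length ∧
    ∀ g ∈ tuples (intRange (factorBound f)) (f.length - 1),
      ∀ h ∈ tuples (intRange (factorBound f)) (f.length - 1), ¬ toPoly (mul g h) = toPoly f

theorem computablePred_irrTest {α : Type*} [Primcodable α] {f : α → List ℤ} (hf : Computable f) :
    ComputablePred fun a => IrrTest (f a) := by
  refine (ComputablePred.eq' (by fun_prop) (by fun_prop)).not.and'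
    ((ComputablePred.le' (by fun_prop) (by fun_prop)).and' ?_)
  refine ComputablePred.forall_mem
    (p := fun a g => ∀ h ∈ tuples (intRange (factorBound (f a))) ((f a).length - 1),
      ¬ toPoly (mul g h) = toPoly (f a)) (by fun_prop) ?_
  refine ComputablePred.forall_mem
    (L := fun x : α × List ℤ => tuples (intRange (factorBound (f x.1))) ((f x.1).length - 1))
    (p := fun x h => ¬ toPoly (mul x.2 h) = toPoly (f x.1)) (by fun_prop) ?_
  exact (computablePred_eq (by fun_prop) (by fun_prop)).not

/-- The coefficient bound makes the search for divisors finite. -/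
theorem mem_tuples_of_dvd {f : List ℤ} {d : ℕ} (hf : toPoly f ≠ 0) {g : ℤ[X]} (hg : g ∣ toPoly f)
    (hd : g.degree < d) :
    ∃ l ∈ tuples (intRange (factorBound f)) d, toPoly l = g := by
  obtain ⟨l, h1, h2, h3⟩ := toPoly_surjective g d hd
  refine ⟨l, mem_tuples.2 ⟨h1, fun b hb => ?_⟩, h2⟩
  obtain ⟨n, rfl⟩ := h3 b hb
  exact mem_intRange.2 (natAbs_coeff_le_of_dvd hf hg n)

theorem natDegree_toPoly_of_getD {f : List ℤ} (h : f.getD (f.length - 1) 0 ≠ 0) :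
    (toPoly f).natDegree = f.length - 1 := by
  refine natDegree_eq_of_le_of_coeff_ne_zero ?_ (by rwa [coeff_toPoly])
  have h0 : f.length ≠ 0 := by
    intro h0; rw [List.length_eq_zero_iff.1 h0] at h; simp at h
  rw [natDegree_le_iff_coeff_eq_zero]
  intro n hn
  rw [coeff_toPoly, List.getD_eq_default _ _ (by omega)]

section

variable (k : Type*) [Field k] [CharZero k] [IsFractionRing ℤ k]

/-- The primitive minimal polynomial of a root divides `f` over ℤ. A cofactor of positive degree
would give a factorization that the test excludes, so the cofactor is a nonzero constant, a unit
over k. -/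
theorem IrrTest.irreducible {f : List ℤ} (h : IrrTest f) :
    Irreducible ((toPoly f).map (algebraMap ℤ k)) := by
  obtain ⟨h1, h2, h3⟩ := h
  have hdeg := natDegree_toPoly_of_getD h1
  have hinj := IsFractionRing.injective ℤ k
  have hf0 : toPoly f ≠ 0 := by
    intro h0; rw [h0, natDegree_zero] at hdeg; omega
  have hdegk : ((toPoly f).map (algebraMap ℤ k)).natDegree = f.length - 1 := by
    rw [natDegree_map_eq_of_injective hinj, hdeg]
  obtain ⟨y, hy⟩ := IsAlgClosed.exists_aeval_eq_zero (AlgebraicClosure k)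
    ((toPoly f).map (algebraMap ℤ k)) (by
      intro h0
      have := natDegree_eq_zero_iff_degree_le_zero.2 h0.le
      omega)
  rw [aeval_map_algebraMap] at hy
  obtain ⟨g, hgp, -, hgi, hg⟩ := exists_primitive_minpoly k y
    (Algebra.IsAlgebraic.isAlgebraic y).isIntegral
  obtain ⟨q, hq⟩ := (hg _).1 hy
  have hg0 : g ≠ 0 := left_ne_zero_of_mul (hq ▸ hf0)
  have hq0 : q ≠ 0 := right_ne_zero_of_mul (hq ▸ hf0)
  have hsum : g.natDegree + q.natDegree = f.length - 1 := by
    rw [← hdeg, hq, natDegree_mul hg0 hq0]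
  have hgpos : 0 < g.natDegree := by
    have := hgi.natDegree_pos
    rwa [natDegree_map_eq_of_injective hinj] at this
  by_cases hqd : q.natDegree = 0
  · obtain ⟨c, rfl⟩ : ∃ c, q = C c := ⟨_, eq_C_of_natDegree_eq_zero hqd⟩
    have hc : c ≠ 0 := by rintro rfl; simp at hq0
    rw [hq, Polynomial.map_mul, map_C]
    refine ((associated_mul_isUnit_left_iff (isUnit_C.2 (isUnit_iff_ne_zero.2 ?_))).2
      (Associated.refl _)).symm.irreducible hgi
    exact (map_ne_zero_iff _ hinj).2 hc
  · exfalso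
    obtain ⟨l, hl, rfl⟩ := mem_tuples_of_dvd (d := f.length - 1) hf0 (Dvd.intro _ hq.symm)
      ((degree_lt_iff_coeff_zero _ _).2 fun m hm => coeff_eq_zero_of_natDegree_lt (by omega))
    obtain ⟨l', hl', rfl⟩ := mem_tuples_of_dvd (d := f.length - 1) hf0 (Dvd.intro_left _ hq.symm)
      ((degree_lt_iff_coeff_zero _ _).2 fun m hm => coeff_eq_zero_of_natDegree_lt (by omega))
    exact h3 l hl l' hl' (by rw [toPoly_mul, hq])

theorem irrTest_of_irreducible {f : List ℤ} (hlen : (toPoly f).natDegree + 1 = f.length)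
    (hi : Irreducible ((toPoly f).map (algebraMap ℤ k))) : IrrTest f := by
  have hinj := IsFractionRing.injective ℤ k
  have hpos := hi.natDegree_pos
  rw [natDegree_map_eq_of_injective hinj] at hpos
  have hf0 : toPoly f ≠ 0 := by rintro h; simp [h] at hpos
  refine ⟨?_, by omega, fun g hg h hh hgh => ?_⟩
  · rw [← coeff_toPoly, ← hlen, Nat.add_sub_cancel]
    exact leadingCoeff_ne_zero.2 hf0
  · rw [toPoly_mul] at hgh
    have hd : ∀ l ∈ tuples (intRange (factorBound f)) (f.length - 1),
        toPoly l ≠ 0 → (toPoly l).natDegree < (toPoly f).natDegree := by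
      intro l hl h0
      have := degree_toPoly_lt l
      rw [(mem_tuples.1 hl).1, ← natDegree_lt_iff_degree_lt h0] at this
      omega
    have hg0 : toPoly g ≠ 0 := left_ne_zero_of_mul (hgh ▸ hf0)
    have hh0 : toPoly h ≠ 0 := right_ne_zero_of_mul (hgh ▸ hf0)
    have hsum : (toPoly g).natDegree + (toPoly h).natDegree = (toPoly f).natDegree := by
      rw [← hgh, natDegree_mul hg0 hh0]
    have h1 := hd g hg hg0
    have h2 := hd h hh hh0
    rw [← hgh, Polynomial.map_mul] at hi
    rcases hi.isUnit_or_isUnit rfl with hu | hu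
    · have := natDegree_eq_zero_of_isUnit hu
      rw [natDegree_map_eq_of_injective hinj] at this; omega
    · have := natDegree_eq_zero_of_isUnit hu
      rw [natDegree_map_eq_of_injective hinj] at this; omega

variable {Ω : Type*} [Field Ω] [Algebra k Ω]

theorem IrrTest.dvd_of_aeval_eq_zero {f : List ℤ} (h : IrrTest f) {x : Ω}
    (hx : aeval x (toPoly f) = 0) {p : ℤ[X]} (hp : aeval x p = 0) :
    (toPoly f).map (algebraMap ℤ k) ∣ p.map (algebraMap ℤ k) := by
  have h1 := minpoly.dvd k x (p := p.map (algebraMap ℤ k)) (by rwa [aeval_map_algebraMap])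
  have h2 := minpoly.dvd k x (p := (toPoly f).map (algebraMap ℤ k)) (by rwa [aeval_map_algebraMap])
  have h3 : IsIntegral k x :=
    IsAlgebraic.isIntegral ⟨_, (h.irreducible k).ne_zero, by rwa [aeval_map_algebraMap]⟩
  exact ((minpoly.irreducible h3).associated_of_dvd (h.irreducible k) h2).symm.dvd.trans h1

theorem exists_irrTest [Algebra.IsAlgebraic k Ω] (x : Ω) : ∃ f : List ℤ, IrrTest f ∧
    ∀ p : ℤ[X], aeval x p = 0 ↔ toPoly f ∣ p := by
  obtain ⟨g, -, -, hgi, hg⟩ := exists_primitive_minpoly k x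
    (Algebra.IsAlgebraic.isAlgebraic x).isIntegral
  obtain ⟨l, h1, rfl, -⟩ := toPoly_surjective g (g.natDegree + 1)
    (degree_le_natDegree.trans_lt (by exact_mod_cast Nat.lt_succ_self _))
  exact ⟨l, irrTest_of_irreducible k h1.symm hgi, hg⟩

/-- One step in the construction of the algebraic closure: the new generator is a root of the first
component of `s'`, the old generator is the value of the second component at the new one, and the
`n`-th polynomial has a root in the ring generated by the new generator. -/
def TowerStep (n : ℕ) (s s' : List ℤ × List ℤ) : Prop :=
  IrrTest s'.1 ∧ toPoly s'.1 ∣ toPoly (comp s.1 s'.2) ∧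
    (toPoly (Denumerable.ofNat (List ℤ) n).tail = 0 ∨
      ∃ u : List ℤ, toPoly s'.1 ∣ toPoly (comp (Denumerable.ofNat (List ℤ) n) u))

theorem rePred_towerStep :
    REPred fun x : ℕ × (List ℤ × List ℤ) × (List ℤ × List ℤ) => TowerStep x.1 x.2.1 x.2.2 := by
  have htail : Computable fun n : ℕ => (Denumerable.ofNat (List ℤ) n).tail :=
    Primrec.list_tail.to_comp.comp (by fun_prop)
  refine (computablePred_irrTest (by fun_prop)).to_re.and'
    ((rePred_dvd (by fun_prop) (by fun_prop)).and' (REPred.or' ?_ ?_))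
  · exact (computablePred_eq_zero (f := fun x : ℕ × (List ℤ × List ℤ) × (List ℤ × List ℤ) =>
      (Denumerable.ofNat (List ℤ) x.1).tail) (htail.comp (by fun_prop))).to_re
  · exact REPred.exists'
      (p := fun (x : ℕ × (List ℤ × List ℤ) × (List ℤ × List ℤ)) (u : List ℤ) =>
        toPoly x.2.2.1 ∣ toPoly (comp (Denumerable.ofNat (List ℤ) x.1) u))
      (rePred_dvd (by fun_prop) (by fun_prop))

end

theorem IrrTest.exists_root {f : List ℤ} (h : IrrTest f) (k : Type*) [Field k] [CharZero k]
    [IsFractionRing ℤ k] (Ω : Type*) [Field Ω] [Algebra k Ω] [IsAlgClosed Ω] :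
    ∃ x : Ω, aeval x (toPoly f) = 0 := by
  obtain ⟨x, hx⟩ := IsAlgClosed.exists_aeval_eq_zero Ω ((toPoly f).map (algebraMap ℤ k))
    (h.irreducible k).degree_pos.ne'
  exact ⟨x, by rwa [aeval_map_algebraMap] at hx⟩

/-- A nonzero tail says that the polynomial is not constant; the length of the list would not,
because of trailing zeros. -/
theorem exists_aeval_toPoly_of_tail (l : List ℤ) (h : toPoly l.tail ≠ 0) (k : Type*) [Field k] [CharZero k]
    (Ω : Type*) [Field Ω] [Algebra k Ω] [IsAlgClosed Ω] :
    ∃ x : Ω, aeval x (toPoly l) = 0 := by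
  have : CharZero Ω := charZero_of_injective_algebraMap (algebraMap k Ω).injective
  rcases l with _ | ⟨a, l⟩
  · simp at h
  · have h' : toPoly l ≠ 0 := h
    have h1 : (X * toPoly l).degree = (((toPoly l).natDegree + 1 : ℕ) : WithBot ℕ) := by
      rw [degree_mul, degree_X, degree_eq_natDegree h']; push_cast; ring
    have h2 : (toPoly (a :: l)).degree = (((toPoly l).natDegree + 1 : ℕ) : WithBot ℕ) := by
      rw [toPoly_cons, degree_add_eq_right_of_degree_lt, h1]
      rw [h1]; exact degree_C_le.trans_lt (by exact_mod_cast Nat.succ_pos _)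
    obtain ⟨x, hx⟩ := IsAlgClosed.exists_root ((toPoly (a :: l)).map (algebraMap ℤ Ω)) (by
      rw [degree_map_eq_of_injective (algebraMap ℤ Ω).injective_int, h2]
      exact_mod_cast Nat.succ_ne_zero (toPoly l).natDegree)
    exact ⟨x, by rw [IsRoot, eval_map_algebraMap] at hx; exact hx⟩

/-- Ω serves only to show that the search succeeds: with x the current generator and y a root of the
n-th polynomial, take a common generator of ℤ[x] and ℤ[y]. The relation `TowerStep` itself mentions
integer polynomials alone, which makes it c.e. -/
theorem exists_towerStep (k : Type*) [Field k] [CharZero k] [IsFractionRing ℤ k]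
    (Ω : Type*) [Field Ω] [Algebra k Ω] [IsAlgClosed Ω] [Algebra.IsAlgebraic k Ω]
    (n : ℕ) {s : List ℤ × List ℤ} (hs : IrrTest s.1) :
    ∃ s', TowerStep n s s' := by
  set l := Denumerable.ofNat (List ℤ) n
  obtain ⟨x, hx⟩ := hs.exists_root k Ω
  have hc : ∀ {z y : Ω}, y ∈ Algebra.adjoin ℤ {z} → ∃ u : List ℤ, aeval z (toPoly u) = y := by
    intro z y hy
    rw [Algebra.adjoin_singleton_eq_range_aeval] at hy
    obtain ⟨p, hp⟩ := hy
    obtain ⟨u, rfl⟩ := exists_toPoly p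
    exact ⟨u, hp⟩
  by_cases ht : toPoly l.tail = 0
  · obtain ⟨f, hf, hfx⟩ := exists_irrTest k x
    refine ⟨(f, [0, 1]), hf, (hfx _).1 ?_, Or.inl ht⟩
    simp [hx]
  · obtain ⟨y, hy⟩ := exists_aeval_toPoly_of_tail l ht k Ω
    obtain ⟨z, hxz, hyz⟩ := exists_common_int_generator k x y
    obtain ⟨f, hf, hfz⟩ := exists_irrTest k z
    obtain ⟨u, hu⟩ := hc hxz
    obtain ⟨w, hw⟩ := hc hyz
    refine ⟨(f, u), hf, (hfz _).1 ?_, Or.inr ⟨w, (hfz _).1 ?_⟩⟩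
    · rw [toPoly_comp, aeval_comp, hu, hx]
    · rw [toPoly_comp, aeval_comp, hw, hy]

theorem exists_tower (k : Type*) [Field k] [CharZero k] [IsFractionRing ℤ k]
    (Ω : Type*) [Field Ω] [Algebra k Ω] [IsAlgClosed Ω] [Algebra.IsAlgebraic k Ω] :
    ∃ s : ℕ → List ℤ × List ℤ, Computable s ∧
    ∀ n, IrrTest (s n).1 ∧ TowerStep n (s n) (s (n + 1)) := by
  obtain ⟨s, hs, -, h⟩ := REPred.exists_sequence (fun _ (s : List ℤ × List ℤ) => IrrTest s.1)
    (x₀ := ([0, 1], [])) rePred_towerStep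
    (irrTest_of_irreducible k (by simp) (by simpa using irreducible_X))
    (fun n s hs => exists_towerStep k Ω n hs) (fun n s s' _ h => h.1)
  exact ⟨s, hs, h⟩

/-- A compatible system of generators along a tower. -/
theorem exists_generators (k : Type*) [Field k] [CharZero k] [IsFractionRing ℤ k]
    {Ω : Type*} [Field Ω] [Algebra k Ω] [IsAlgClosed Ω] [Algebra.IsAlgebraic k Ω]
    {s : ℕ → List ℤ × List ℤ}
    (hs : ∀ n, IrrTest (s n).1 ∧ TowerStep n (s n) (s (n + 1))) :
    ∃ γ : ℕ → Ω, (∀ n, aeval (γ n) (toPoly (s n).1) = 0) ∧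
      ∀ n, aeval (γ (n + 1)) (toPoly (s (n + 1)).2) = γ n := by
  have hnormal : Normal k Ω := by
    have : IsAlgClosure k Ω := ⟨inferInstance, inferInstance⟩
    exact IsAlgClosure.normal k Ω
  have step : ∀ n (x : Ω), aeval x (toPoly (s n).1) = 0 → ∃ y : Ω,
      aeval y (toPoly (s (n + 1)).1) = 0 ∧ aeval y (toPoly (s (n + 1)).2) = x := by
    intro n x hx
    obtain ⟨-, -, h2, -⟩ := hs n
    obtain ⟨z, hz⟩ := (hs (n + 1)).1.exists_root k Ω
    have hw : aeval (aeval z (toPoly (s (n + 1)).2)) (toPoly (s n).1) = 0 := by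
      obtain ⟨q, hq⟩ := h2
      rw [← aeval_comp, ← toPoly_comp, hq, map_mul, hz, zero_mul]
    set w := aeval z (toPoly (s (n + 1)).2) with hw'
    -- A root z of the next polynomial lies over some root w of the present one, perhaps not over x.
    -- As w and x are conjugate, an automorphism moves z to a root over x.
    have hconj : IsConjRoot k x w := by
      have hi := (hs n).1.irreducible k
      have e1 := minpoly.eq_of_irreducible hi (x := x) (by rwa [aeval_map_algebraMap])
      have e2 := minpoly.eq_of_irreducible hi (x := w) (by rwa [aeval_map_algebraMap])
      exact e1.symm.trans e2
    obtain ⟨σ, hσ⟩ := hconj.exists_algEquiv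
    refine ⟨σ z, ?_, ?_⟩
    · have := (aeval_algHom_apply ((σ : Ω →ₐ[k] Ω).restrictScalars ℤ) z (toPoly (s (n + 1)).1))
      simpa [hz] using this
    · have := (aeval_algHom_apply ((σ : Ω →ₐ[k] Ω).restrictScalars ℤ) z (toPoly (s (n + 1)).2))
      rw [← hw'] at this
      simpa [hσ] using this
  obtain ⟨x₀, hx₀⟩ := (hs 0).1.exists_root k Ω
  choose! next hnext using step
  let γ : ℕ → Ω := fun n => Nat.rec x₀ (fun n x => next n x) n
  have hγ : ∀ n, aeval (γ n) (toPoly (s n).1) = 0 := by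
    intro n
    induction n with
    | zero => exact hx₀
    | succ n ih => exact (hnext n _ ih).1
  exact ⟨γ, hγ, fun n => (hnext n _ (hγ n)).2⟩

end IntPoly

/-- An enumeration of a field with decidable equality and computable operations. -/
structure ComputableEnum {A : Type*} [Field A] (φ : ℕ → A) : Prop where
  surjective : Function.Surjective φ
  eq : ComputablePred fun x : ℕ × ℕ => φ x.1 = φ x.2
  add : ∃ f : ℕ → ℕ → ℕ, (Computable fun x : ℕ × ℕ => f x.1 x.2) ∧ ∀ m n, φ (f m n) = φ m + φ n
  mul : ∃ f : ℕ → ℕ → ℕ, (Computable fun x : ℕ × ℕ => f x.1 x.2) ∧ ∀ m n, φ (f m n) = φ m * φ n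

/-! ### Arithmetic in the tower, and the computable algebraic closure -/

namespace IntPoly

section Tower

variable {Ω : Type*} [Field Ω] (s : ℕ → List ℤ × List ℤ) (γ : ℕ → Ω)

/-- Rewriting a polynomial in the `n`-th generator as one in the `(n + j)`-th generator. -/
def liftTower (n : ℕ) (a : List ℤ) (j : ℕ) : List ℤ :=
  Nat.rec a (fun i b => comp b (s (n + i + 1)).2) j

/-- The value of a polynomial in one of the generators. -/
noncomputable def towerValue (x : ℕ × List ℤ) : Ω := aeval (γ x.1) (toPoly x.2)

variable {s γ}

theorem aeval_liftTower (hγ : ∀ n, aeval (γ (n + 1)) (toPoly (s (n + 1)).2) = γ n)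
    (n : ℕ) (a : List ℤ) (j : ℕ) :
    aeval (γ (n + j)) (toPoly (liftTower s n a j)) = aeval (γ n) (toPoly a) := by
  induction j with
  | zero => rfl
  | succ j ih =>
    have : liftTower s n a (j + 1) = comp (liftTower s n a j) (s (n + j + 1)).2 := rfl
    rw [this, toPoly_comp, aeval_comp, ← add_assoc, hγ, ih]

theorem computable_liftTower (hs : Computable s) {α : Type*} [Primcodable α] {f : α → ℕ}
    {g : α → List ℤ} {h : α → ℕ} (hf : Computable f) (hg : Computable g) (hh : Computable h) :
    Computable fun x => liftTower s (f x) (g x) (h x) := by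
  unfold liftTower; fun_prop

variable (s) in
/-- A binary polynomial operation, performed on a common level of the tower. -/
def towerOp (op : List ℤ → List ℤ → List ℤ) (x y : ℕ × List ℤ) : ℕ × List ℤ :=
  (x.1 + y.1, op (liftTower s x.1 x.2 y.1) (liftTower s y.1 y.2 x.1))

theorem towerValue_towerOp (hγ : ∀ n, aeval (γ (n + 1)) (toPoly (s (n + 1)).2) = γ n)
    {op : List ℤ → List ℤ → List ℤ} {op' : Ω → Ω → Ω}
    (hop : ∀ (z : Ω) p q, aeval z (toPoly (op p q)) = op' (aeval z (toPoly p)) (aeval z (toPoly q)))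
    (x y : ℕ × List ℤ) :
    towerValue γ (towerOp s op x y) = op' (towerValue γ x) (towerValue γ y) := by
  have h1 := aeval_liftTower hγ x.1 x.2 y.1
  have h2 := aeval_liftTower hγ y.1 y.2 x.1
  rw [add_comm y.1 x.1] at h2
  simp only [towerValue, towerOp]
  rw [hop, h1, h2]

theorem towerValue_add (hγ : ∀ n, aeval (γ (n + 1)) (toPoly (s (n + 1)).2) = γ n)
    (x y : ℕ × List ℤ) :
    towerValue γ (towerOp s add x y) = towerValue γ x + towerValue γ y :=
  towerValue_towerOp hγ (op' := (· + ·)) (fun z p q => by simp) x y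

theorem towerValue_sub (hγ : ∀ n, aeval (γ (n + 1)) (toPoly (s (n + 1)).2) = γ n)
    (x y : ℕ × List ℤ) :
    towerValue γ (towerOp s sub x y) = towerValue γ x - towerValue γ y :=
  towerValue_towerOp hγ (op' := (· - ·)) (fun z p q => by simp) x y

theorem towerValue_mul (hγ : ∀ n, aeval (γ (n + 1)) (toPoly (s (n + 1)).2) = γ n)
    (x y : ℕ × List ℤ) :
    towerValue γ (towerOp s mul x y) = towerValue γ x * towerValue γ y :=
  towerValue_towerOp hγ (op' := (· * ·)) (fun z p q => by simp) x y

theorem computable_towerOp (hs : Computable s) {op : List ℤ → List ℤ → List ℤ}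
    (hop : Computable fun x : List ℤ × List ℤ => op x.1 x.2) {α : Type*} [Primcodable α]
    {f g : α → ℕ × List ℤ} (hf : Computable f) (hg : Computable g) :
    Computable fun x => towerOp s op (f x) (g x) := by
  have h1 := computable_liftTower hs (f := fun x => (f x).1)
    (g := fun x => (f x).2) (h := fun x => (g x).1) (by fun_prop) (by fun_prop) (by fun_prop)
  have h2 := computable_liftTower hs (f := fun x => (g x).1)
    (g := fun x => (g x).2) (h := fun x => (f x).1) (by fun_prop) (by fun_prop) (by fun_prop)
  have h3 := hop.comp (h1.pair h2)
  exact Computable.pair (f := fun x => (f x).1 + (g x).1) (by fun_prop) h3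

/-- The value vanishes iff the irreducible polynomial of the generator divides over k, and clearing
denominators makes this an identity over ℤ that can be searched for. The factor `c` is needed
because `(s n).1` may fail to be primitive. -/
theorem towerValue_eq_zero_iff (k : Type*) [Field k] [CharZero k] [IsFractionRing ℤ k] [Algebra k Ω]
    (hirr : ∀ n, IrrTest (s n).1)
    (hroot : ∀ n, aeval (γ n) (toPoly (s n).1) = 0) (x : ℕ × List ℤ) :
    towerValue γ x = 0 ↔ ∃ (c : ℤ) (u : List ℤ), c ≠ 0 ∧
      toPoly (mul [c] x.2) = toPoly (mul (s x.1).1 u) := by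
  have : CharZero Ω := charZero_of_injective_algebraMap (algebraMap k Ω).injective
  have hinj := IsFractionRing.injective ℤ k
  constructor
  · intro h
    obtain ⟨q, hq⟩ := (hirr x.1).dvd_of_aeval_eq_zero k (hroot x.1) h
    obtain ⟨b, hbM, hb⟩ := IsLocalization.integerNormalization_spec (nonZeroDivisors ℤ) q
    obtain ⟨u, hu⟩ := exists_toPoly (IsLocalization.integerNormalization (nonZeroDivisors ℤ) q)
    refine ⟨b, u, nonZeroDivisors.ne_zero hbM, ?_⟩
    apply map_injective _ hinj
    rw [toPoly_mul, toPoly_mul, Polynomial.map_mul, Polynomial.map_mul, hu, hb, hq]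
    simp only [toPoly_cons, toPoly_nil, mul_zero, add_zero, eq_intCast, zsmul_eq_mul,
      Polynomial.map_intCast]
    ring
  · rintro ⟨c, u, hc, h⟩
    have h1 := congrArg (aeval (γ x.1)) h
    rw [toPoly_mul, toPoly_mul, map_mul, map_mul, hroot, zero_mul] at h1
    simp only [toPoly_cons, toPoly_nil, mul_zero, add_zero] at h1
    rcases mul_eq_zero.1 h1 with h2 | h2
    · exfalso; simp at h2; exact hc h2
    · exact h2

theorem rePred_towerValue_eq (k : Type*) [Field k] [CharZero k] [IsFractionRing ℤ k] [Algebra k Ω]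
    (hs : Computable s) (hirr : ∀ n, IrrTest (s n).1)
    (hroot : ∀ n, aeval (γ n) (toPoly (s n).1) = 0)
    (hγ : ∀ n, aeval (γ (n + 1)) (toPoly (s (n + 1)).2) = γ n) :
    REPred fun x : (ℕ × List ℤ) × (ℕ × List ℤ) => towerValue γ x.1 = towerValue γ x.2 := by
  have h0 : REPred fun x : ℕ × List ℤ => towerValue γ x = 0 := by
    refine REPred.of_eq ?_ fun x => (towerValue_eq_zero_iff k hirr hroot x).symm
    refine REPred.exists' (p := fun (x : ℕ × List ℤ) (c : ℤ) => ∃ u : List ℤ, c ≠ 0 ∧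
      toPoly (mul [c] x.2) = toPoly (mul (s x.1).1 u)) ?_
    refine REPred.exists' (p := fun (x : (ℕ × List ℤ) × ℤ) (u : List ℤ) => x.2 ≠ 0 ∧
      toPoly (mul [x.2] x.1.2) = toPoly (mul (s x.1.1).1 u)) ?_
    exact ((ComputablePred.eq' (by fun_prop) (by fun_prop)).not.and'
      (computablePred_eq (by fun_prop) (by fun_prop))).to_re
  refine (h0.comp' (computable_towerOp hs (op := sub) (by fun_prop) Computable.fst Computable.snd)).of_eq fun x => ?_
  rw [towerValue_sub hγ, sub_eq_zero]

/-- The values form a k-subalgebra of Ω, which is a field because Ω/k is algebraic. The tower has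
provided a root for every non-constant integer polynomial, so this field is algebraically closed and
equals Ω. -/
theorem towerValue_surjective (k : Type*) [Field k] [CharZero k] [IsFractionRing ℤ k] [Algebra k Ω]
    [IsAlgClosed Ω] [Algebra.IsAlgebraic k Ω]
    (hs : ∀ n, TowerStep n (s n) (s (n + 1)))
    (hroot : ∀ n, aeval (γ n) (toPoly (s n).1) = 0)
    (hγ : ∀ n, aeval (γ (n + 1)) (toPoly (s (n + 1)).2) = γ n) :
    Function.Surjective (towerValue γ) := by
  have : CharZero Ω := charZero_of_injective_algebraMap (algebraMap k Ω).injective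
  have hint : ∀ a : ℤ, towerValue γ (0, [a]) = (a : Ω) := fun a => by
    simp [towerValue]
  have hrt : ∀ l : List ℤ, toPoly l.tail ≠ 0 → ∃ x, aeval (towerValue γ x) (toPoly l) = 0 := by
    intro l hl
    obtain ⟨-, -, h⟩ := hs (Encodable.encode l)
    rw [Denumerable.ofNat_encode] at h
    obtain ⟨u, q, hq⟩ := h.resolve_left hl
    refine ⟨(Encodable.encode l + 1, u), ?_⟩
    have h1 := congrArg (aeval (γ (Encodable.encode l + 1))) hq
    rwa [map_mul, hroot, zero_mul, toPoly_comp, aeval_comp] at h1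
  let S : Subalgebra k Ω :=
    { carrier := Set.range (towerValue γ)
      mul_mem' := by
        rintro _ _ ⟨x, rfl⟩ ⟨y, rfl⟩; exact ⟨_, towerValue_mul hγ x y⟩
      add_mem' := by
        rintro _ _ ⟨x, rfl⟩ ⟨y, rfl⟩; exact ⟨_, towerValue_add hγ x y⟩
      algebraMap_mem' := by
        intro r
        obtain ⟨a, b, hb, rfl⟩ := IsFractionRing.div_surjective (A := ℤ) r
        have hb0 : b ≠ 0 := nonZeroDivisors.ne_zero hb
        -- Inverses of integers come from the roots of bX - 1.
        obtain ⟨x, hx⟩ := hrt [-1, b] (by simpa using hb0)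
        have hx' : (b : Ω) * towerValue γ x = 1 := by
          simp at hx; linear_combination hx
        refine ⟨towerOp s mul (0, [a]) x, ?_⟩
        rw [towerValue_mul hγ, hint, eq_div_of_mul_eq (by exact_mod_cast hb0)
          ((mul_comm _ _).trans hx')]
        simp [div_eq_mul_inv] }
  let I : IntermediateField k Ω := S.toIntermediateField' (Subalgebra.isField_of_algebraic S)
  have hI : IsAlgClosure k I := by
    refine IsAlgClosure.of_exists_root fun p hp hpi => ?_
    obtain ⟨b, hbM, hb⟩ := IsLocalization.integerNormalization_spec (nonZeroDivisors ℤ) p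
    have hb0 : b ≠ 0 := nonZeroDivisors.ne_zero hbM
    obtain ⟨l, hl⟩ := exists_toPoly (IsLocalization.integerNormalization (nonZeroDivisors ℤ) p)
    rw [← hl] at hb
    have hdeg : 0 < (toPoly l).natDegree := by
      rw [← natDegree_map_eq_of_injective (IsFractionRing.injective ℤ k), hb,
        natDegree_smul_of_smul_regular]
      · exact hpi.natDegree_pos
      · exact IsSMulRegular.of_ne_zero hb0
    have htail : toPoly l.tail ≠ 0 := by
      rcases l with _ | ⟨a, l⟩
      · simp at hdeg
      · intro h0
        have h0' : toPoly l = 0 := h0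
        rw [toPoly_cons, h0', mul_zero, add_zero, natDegree_C] at hdeg
        exact lt_irrefl _ hdeg
    obtain ⟨x, hx⟩ := hrt l htail
    refine ⟨⟨towerValue γ x, x, rfl⟩, ?_⟩
    apply Subtype.val_injective
    rw [← aeval_map_algebraMap k, hb, map_zsmul, smul_eq_zero] at hx
    have hx' := hx.resolve_left hb0
    have := (aeval_algHom_apply I.val ⟨towerValue γ x, x, rfl⟩ p)
    rw [ZeroMemClass.coe_zero]
    exact this.symm.trans hx'
  have := hI.isAlgClosed
  intro y
  obtain ⟨⟨_, x, rfl⟩, hx⟩ := (IsAlgClosed.algebraMap_bijective_of_isIntegral (k := I) (K := Ω)).2 y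
  exact ⟨x, hx⟩

end Tower

/-- The algebraic closure of the prime field of characteristic zero has a computable
presentation. -/
theorem exists_computableEnum (k : Type*) [Field k] [CharZero k] [IsFractionRing ℤ k]
    (Ω : Type*) [Field Ω] [Algebra k Ω] [IsAlgClosed Ω] [Algebra.IsAlgebraic k Ω] :
    ∃ φ : ℕ → Ω, ComputableEnum φ := by
  obtain ⟨s, hs, hst⟩ := exists_tower k Ω
  obtain ⟨γ, hroot, hγ⟩ := exists_generators k (Ω := Ω) hst
  have hsurj := towerValue_surjective k (fun n => (hst n).2) hroot hγ
  have heq := rePred_towerValue_eq k hs (fun n => (hst n).1) hroot hγ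
  -- Equality is c.e. by an identity of polynomials; inequality is c.e. because it means that the
  -- difference has an inverse. Hence equality is decidable.
  have hne : REPred fun x : (ℕ × List ℤ) × (ℕ × List ℤ) =>
      ¬ towerValue γ x.1 = towerValue γ x.2 := by
    refine (REPred.exists' (p := fun (x : (ℕ × List ℤ) × (ℕ × List ℤ)) (z : ℕ × List ℤ) =>
      towerValue γ (towerOp s mul (towerOp s sub x.1 x.2) z) = towerValue γ (0, [1]))
      (heq.comp' (f := fun x : ((ℕ × List ℤ) × (ℕ × List ℤ)) × (ℕ × List ℤ) =>
        (towerOp s mul (towerOp s sub x.1.1 x.1.2) x.2, (0, [1])))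
        (Computable.pair (computable_towerOp hs (by fun_prop) (computable_towerOp hs (by fun_prop)
          (by fun_prop) (by fun_prop)) (by fun_prop)) (by fun_prop)))).of_eq
      fun x => ?_
    have h1 : towerValue γ (0, [1]) = (1 : Ω) := by simp [towerValue]
    constructor
    · rintro ⟨z, hz⟩ h
      rw [towerValue_mul hγ, towerValue_sub hγ, h, h1] at hz
      simp at hz
    · intro h
      obtain ⟨z, hz⟩ := hsurj (towerValue γ x.1 - towerValue γ x.2)⁻¹
      exact ⟨z, by rw [towerValue_mul hγ, towerValue_sub hγ, hz, h1,
        mul_inv_cancel₀ (sub_ne_zero.2 h)]⟩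
  have hdec := ComputablePred.computable_iff_re_compl_re'.2 ⟨heq, hne⟩
  let φ : ℕ → Ω := fun n => towerValue γ (Denumerable.ofNat (ℕ × List ℤ) n)
  have hφ : Function.Surjective φ := fun y => by
    obtain ⟨x, rfl⟩ := hsurj y
    exact ⟨Encodable.encode x, by simp only [φ, Denumerable.ofNat_encode]⟩
  have hφd : ComputablePred fun x : ℕ × ℕ => φ x.1 = φ x.2 :=
    hdec.comp' (f := fun x : ℕ × ℕ => (Denumerable.ofNat (ℕ × List ℤ) x.1,
      Denumerable.ofNat (ℕ × List ℤ) x.2)) (by fun_prop)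
  have hop : ∀ op : List ℤ → List ℤ → List ℤ, (Computable fun x : List ℤ × List ℤ => op x.1 x.2) →
      Computable fun x : ℕ × ℕ => Encodable.encode (towerOp s op
        (Denumerable.ofNat (ℕ × List ℤ) x.1) (Denumerable.ofNat (ℕ × List ℤ) x.2)) := by
    intro op h
    exact Computable.encode.comp (computable_towerOp hs h (by fun_prop) (by fun_prop))
  refine ⟨φ, hφ, hφd, ⟨fun m n => Encodable.encode (towerOp s add
    (Denumerable.ofNat (ℕ × List ℤ) m) (Denumerable.ofNat (ℕ × List ℤ) n)),
    hop add (by fun_prop), fun m n => ?_⟩, ⟨fun m n => Encodable.encode (towerOp s mul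
    (Denumerable.ofNat (ℕ × List ℤ) m) (Denumerable.ofNat (ℕ × List ℤ) n)),
    hop mul (by fun_prop), fun m n => ?_⟩⟩
  · simp only [φ, Denumerable.ofNat_encode]
    exact towerValue_add hγ _ _
  · simp only [φ, Denumerable.ofNat_encode]
    exact towerValue_mul hγ _ _

end IntPoly

/-- `f` is computable with respect to the enumeration `φ` of its codomain. -/
def ComputableVia {α A : Type*} [Primcodable α] (φ : ℕ → A) (f : α → A) : Prop :=
  ∃ g : α → ℕ, Computable g ∧ ∀ a, φ (g a) = f a

/-! ### Computing in an enumerated field -/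

namespace ComputableVia

variable {α β A : Type*} [Primcodable α] [Primcodable β] {φ : ℕ → A}

theorem apply {f : α → ℕ} (hf : Computable f) : ComputableVia φ fun a => φ (f a) :=
  ⟨f, hf, fun _ => rfl⟩

theorem comp {f : β → A} {g : α → β} (hf : ComputableVia φ f) (hg : Computable g) :
    ComputableVia φ fun a => f (g a) := by
  obtain ⟨u, hu, h⟩ := hf
  exact ⟨fun a => u (g a), by fun_prop, fun a => h _⟩

/-- The accumulator is carried as an index, so the step has to be computable only at values of `φ`.
-/
theorem foldr {l : α → List β} {g : α → A} {h : α → β → A → A} (hl : Computable l)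
    (hg : ComputableVia φ g)
    (hh : ComputableVia φ fun x : (α × β) × ℕ => h x.1.1 x.1.2 (φ x.2)) :
    ComputableVia φ fun a => (l a).foldr (h a) (g a) := by
  obtain ⟨u, hu, hug⟩ := hg
  obtain ⟨w, hw, hwh⟩ := hh
  refine ⟨fun a => (l a).foldr (fun b n => w ((a, b), n)) (u a), by fun_prop, fun a => ?_⟩
  beta_reduce
  induction l a with
  | nil => exact hug a
  | cons b t ih => rw [List.foldr_cons, List.foldr_cons, hwh]; beta_reduce; rw [ih]

end ComputableVia

namespace ComputableEnum

variable {α β A : Type*} [Primcodable α] [Primcodable β] [Field A] {φ : ℕ → A}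

theorem via_const (hφ : ComputableEnum φ) (x : A) : ComputableVia φ fun _ : α => x := by
  obtain ⟨n, rfl⟩ := hφ.surjective x
  exact ⟨fun _ => n, by fun_prop, fun _ => rfl⟩

theorem via_add (hφ : ComputableEnum φ) {f g : α → A} (hf : ComputableVia φ f)
    (hg : ComputableVia φ g) : ComputableVia φ fun a => f a + g a := by
  obtain ⟨u, hu, hf⟩ := hf
  obtain ⟨w, hw, hg⟩ := hg
  obtain ⟨s, hs, h⟩ := hφ.add
  exact ⟨fun a => s (u a) (w a), hs.comp (hu.pair hw), fun a => by rw [h, hf, hg]⟩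

theorem via_mul (hφ : ComputableEnum φ) {f g : α → A} (hf : ComputableVia φ f)
    (hg : ComputableVia φ g) : ComputableVia φ fun a => f a * g a := by
  obtain ⟨u, hu, hf⟩ := hf
  obtain ⟨w, hw, hg⟩ := hg
  obtain ⟨s, hs, h⟩ := hφ.mul
  exact ⟨fun a => s (u a) (w a), hs.comp (hu.pair hw), fun a => by rw [h, hf, hg]⟩

theorem computablePred_eq (hφ : ComputableEnum φ) {f g : α → A} (hf : ComputableVia φ f)
    (hg : ComputableVia φ g) : ComputablePred fun a => f a = g a := by
  obtain ⟨u, hu, hf⟩ := hf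
  obtain ⟨w, hw, hg⟩ := hg
  exact (hφ.eq.comp' (hu.pair hw)).of_eq fun a => by rw [hf, hg]

/-- Found by search for a solution of y + g = f, only addition and equality being given. -/
theorem via_sub (hφ : ComputableEnum φ) {f g : α → A} (hf : ComputableVia φ f)
    (hg : ComputableVia φ g) : ComputableVia φ fun a => f a - g a := by
  obtain ⟨u, hu, h⟩ := REPred.exists_computable (R := fun a n => φ n + g a = f a)
    (hφ.computablePred_eq (hφ.via_add (.apply (by fun_prop)) (hg.comp Computable.fst))
      (hf.comp Computable.fst)).to_re
    (fun a => (hφ.surjective (f a - g a)).imp fun n hn => by rw [hn, sub_add_cancel])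
  exact ⟨u, hu, fun a => eq_sub_of_add_eq (h a)⟩

theorem via_inv (hφ : ComputableEnum φ) {f : α → A} (hf : ComputableVia φ f) :
    ComputableVia φ fun a => (f a)⁻¹ := by
  obtain ⟨u, hu, h⟩ := REPred.exists_computable
    (R := fun a n => (f a = 0 ∧ φ n = 0) ∨ f a * φ n = 1)
    (((hφ.computablePred_eq (hf.comp Computable.fst) (hφ.via_const 0)).and'
      (hφ.computablePred_eq (.apply (by fun_prop)) (hφ.via_const 0))).or'
      (hφ.computablePred_eq (hφ.via_mul (hf.comp Computable.fst) (.apply (by fun_prop)))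
        (hφ.via_const 1))).to_re
    (fun a => (hφ.surjective (f a)⁻¹).imp fun n hn => by
      rw [hn]
      by_cases h : f a = 0
      · left; simp [h]
      · right; exact mul_inv_cancel₀ h)
  refine ⟨u, hu, fun a => ?_⟩
  rcases h a with ⟨h1, h2⟩ | h
  · simp [h1, h2]
  · exact eq_inv_of_mul_eq_one_right h

theorem via_natCast (hφ : ComputableEnum φ) {f : α → ℕ} (hf : Computable f) :
    ComputableVia φ fun a => (f a : A) := by
  obtain ⟨u, hu, h⟩ : ComputableVia φ fun a => (List.range (f a)).foldr (fun _ r => r + 1) 0 :=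
    .foldr (by fun_prop) (hφ.via_const 0) (hφ.via_add (.apply (by fun_prop)) (hφ.via_const 1))
  refine ⟨u, hu, fun a => (h a).trans ?_⟩
  have : ∀ l : List ℕ, l.foldr (fun _ (r : A) => r + 1) 0 = (l.length : A) := fun l => by
    induction l with
    | nil => simp
    | cons b l ih => simp [ih]
  beta_reduce
  rw [this, List.length_range]

theorem via_intCast (hφ : ComputableEnum φ) {f : α → ℤ} (hf : Computable f) :
    ComputableVia φ fun a => (f a : A) := by
  obtain ⟨u, hu, h⟩ := hφ.via_sub (hφ.via_natCast (f := fun a => (f a).toNat) (by fun_prop))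
    (hφ.via_natCast (f := fun a => (-f a).toNat) (by fun_prop))
  refine ⟨u, hu, fun a => (h a).trans ?_⟩
  beta_reduce
  conv_rhs => rw [← Int.toNat_sub_toNat_neg (f a)]
  push_cast; rfl

theorem via_pow (hφ : ComputableEnum φ) {f : α → A} {g : α → ℕ} (hf : ComputableVia φ f)
    (hg : Computable g) : ComputableVia φ fun a => f a ^ g a := by
  obtain ⟨u, hu, h⟩ : ComputableVia φ fun a => (List.range (g a)).foldr (fun _ r => r * f a) 1 :=
    .foldr (by fun_prop) (hφ.via_const 1) (hφ.via_mul (.apply (by fun_prop))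
      (hf.comp (by fun_prop)))
  refine ⟨u, hu, fun a => (h a).trans ?_⟩
  have : ∀ l : List ℕ, l.foldr (fun _ (r : A) => r * f a) 1 = f a ^ l.length := fun l => by
    induction l with
    | nil => simp
    | cons b l ih => simp [ih, pow_succ]
  beta_reduce
  rw [this, List.length_range]

theorem via_aeval (hφ : ComputableEnum φ) {f : α → A} {l : α → List ℤ} (hf : ComputableVia φ f)
    (hl : Computable l) : ComputableVia φ fun a => aeval (f a) (IntPoly.toPoly (l a)) := by
  simp only [IntPoly.aeval_toPoly]
  exact .foldr hl (hφ.via_const 0) (hφ.via_add (hφ.via_intCast (by fun_prop))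
    (hφ.via_mul (hf.comp (by fun_prop)) (.apply (by fun_prop))))

/-! ### Deciding membership in simple extensions -/

section Membership

variable (k : Type*) [Field k] [CharZero k] [IsFractionRing ℤ k] [Algebra k A]
  [Algebra.IsAlgebraic k A]

open IntPoly

/-- An annihilating polynomial certifies an upper bound for the degree. -/
theorem natDegree_minpoly_le_iff (y : A) (D : ℕ) : (minpoly k y).natDegree ≤ D ↔
    ∃ g : List ℤ, g.length = D + 1 ∧ toPoly g ≠ 0 ∧ aeval y (toPoly g) = 0 := by
  have hy : IsIntegral k y := (Algebra.IsAlgebraic.isAlgebraic y).isIntegral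
  obtain ⟨g, hg, hdeg, -, hdvd⟩ := exists_primitive_minpoly k y hy
  constructor
  · intro h
    obtain ⟨l, h1, h2, -⟩ := toPoly_surjective g (D + 1)
      (degree_lt_iff_coeff_zero _ _ |>.2 fun m hm => coeff_eq_zero_of_natDegree_lt (by omega))
    exact ⟨l, h1, by rw [h2]; exact hg.ne_zero, by rw [h2]; exact (hdvd g).2 dvd_rfl⟩
  · rintro ⟨l, h1, h2, h3⟩
    rw [← hdeg]
    have := natDegree_le_of_dvd ((hdvd _).1 h3) h2
    have h4 := degree_toPoly_lt l
    rw [← natDegree_lt_iff_degree_lt h2] at h4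
    omega

/-- Once some annihilating `p` is known, the primitive minimal polynomial divides it and has bounded
coefficients. A finite check then certifies a lower bound for the degree. -/
theorem lt_natDegree_minpoly_iff (y : A) (D : ℕ) : D < (minpoly k y).natDegree ↔
    ∃ p : List ℤ, toPoly p ≠ 0 ∧ aeval y (toPoly p) = 0 ∧
      ∀ g ∈ tuples (intRange (factorBound p)) (D + 1), toPoly g = 0 ∨ aeval y (toPoly g) ≠ 0 := by
  have hy : IsIntegral k y := (Algebra.IsAlgebraic.isAlgebraic y).isIntegral
  constructor
  · intro h
    obtain ⟨l, -, h1, h2⟩ := (natDegree_minpoly_le_iff k y (minpoly k y).natDegree).1 le_rfl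
    refine ⟨l, h1, h2, fun g hg => ?_⟩
    by_contra! hcon
    exact absurd ((natDegree_minpoly_le_iff k y D).2 ⟨g, (mem_tuples.1 hg).1, hcon⟩) (by omega)
  · rintro ⟨p, h1, h2, h3⟩
    by_contra! hle
    obtain ⟨g, hg, hdeg, -, hdvd⟩ := exists_primitive_minpoly k y hy
    obtain ⟨l, hl, rfl⟩ := mem_tuples_of_dvd h1 ((hdvd _).1 h2) (d := D + 1)
      (degree_lt_iff_coeff_zero _ _ |>.2 fun m hm => coeff_eq_zero_of_natDegree_lt (by omega))
    rcases h3 l hl with h | h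
    · exact hg.ne_zero h
    · exact h ((hdvd _).2 dvd_rfl)

open IntermediateField in
-- If x is not in k(y), some y + tx generates k(x, y) and has larger degree than y; if x is in k(y),
-- every y + tx stays in k(y). Separating the degrees by `D` makes the condition c.e.
theorem notMem_adjoin_simple_iff (x y : A) : x ∉ k⟮y⟯ ↔ ∃ t D : ℕ,
    (minpoly k y).natDegree ≤ D ∧ D < (minpoly k (y + t * x)).natDegree := by
  have hint : ∀ z : A, IsIntegral k z := fun z => (Algebra.IsAlgebraic.isAlgebraic z).isIntegral
  constructor
  · intro h
    obtain ⟨t, h1, h2⟩ := exists_nat_primitive k y x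
    refine ⟨t, _, le_rfl, ?_⟩
    by_contra! hle
    rw [← adjoin.finrank (hint _), ← adjoin.finrank (hint _)] at hle
    have hle' : k⟮y⟯ ≤ k⟮y + t * x⟯ := adjoin_simple_le_iff.2 h1
    have := adjoin.finiteDimensional (hint (y + t * x))
    exact h (eq_of_le_of_finrank_le hle' hle ▸ h2)
  · rintro ⟨t, D, h1, h2⟩ h
    have hle : k⟮y + t * x⟯ ≤ k⟮y⟯ := adjoin_simple_le_iff.2
      (add_mem (mem_adjoin_simple_self k y) (mul_mem (_root_.natCast_mem _ t) h))
    have := adjoin.finiteDimensional (hint y)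
    have := finrank_le_of_le_right hle
    rw [adjoin.finrank (hint _), adjoin.finrank (hint _)] at this
    omega

theorem rePred_natDegree_minpoly_le (hφ : ComputableEnum φ) {y : α → A} {D : α → ℕ}
    (hy : ComputableVia φ y) (hD : Computable D) :
    REPred fun a => (minpoly k (y a)).natDegree ≤ D a := by
  refine REPred.of_eq ?_ fun a => (natDegree_minpoly_le_iff k (y a) (D a)).symm
  refine REPred.exists' (p := fun a (l : List ℤ) => l.length = D a + 1 ∧
    toPoly l ≠ 0 ∧ aeval (y a) (toPoly l) = 0) ?_
  have h1 : ComputablePred fun x : α × List ℤ => x.2.length = D x.1 + 1 :=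
    ComputablePred.eq' (by fun_prop) (by fun_prop)
  have h2 : ComputablePred fun x : α × List ℤ => toPoly x.2 = 0 :=
    computablePred_eq_zero (by fun_prop)
  exact (h1.and' (h2.not.and' (hφ.computablePred_eq (hφ.via_aeval (hy.comp Computable.fst)
    Computable.snd) (hφ.via_const 0)))).to_re

theorem rePred_lt_natDegree_minpoly (hφ : ComputableEnum φ) {y : α → A} {D : α → ℕ}
    (hy : ComputableVia φ y) (hD : Computable D) :
    REPred fun a => D a < (minpoly k (y a)).natDegree := by
  refine REPred.of_eq ?_ fun a => (lt_natDegree_minpoly_iff k (y a) (D a)).symm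
  refine REPred.exists' (p := fun a (p : List ℤ) => toPoly p ≠ 0 ∧
    aeval (y a) (toPoly p) = 0 ∧ ∀ l ∈ tuples (intRange (factorBound p)) (D a + 1),
      toPoly l = 0 ∨ aeval (y a) (toPoly l) ≠ 0) ?_
  have h1 : ComputablePred fun x : α × List ℤ => toPoly x.2 = 0 :=
    computablePred_eq_zero (by fun_prop)
  have h2 : ComputablePred fun x : α × List ℤ => aeval (y x.1) (toPoly x.2) = 0 :=
    hφ.computablePred_eq (hφ.via_aeval (hy.comp Computable.fst) Computable.snd) (hφ.via_const 0)
  refine (h1.not.and' (h2.and' (ComputablePred.forall_mem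
    (L := fun x : α × List ℤ => tuples (intRange (factorBound x.2)) (D x.1 + 1))
    (p := fun x l => toPoly l = 0 ∨ aeval (y x.1) (toPoly l) ≠ 0) (by fun_prop) ?_))).to_re
  exact (h1.or' h2.not).comp' (f := fun x : (α × List ℤ) × List ℤ => (x.1.1, x.2)) (by fun_prop)

open IntermediateField in
/-- Membership in the field generated by an element is decidable, uniformly in both elements. -/
theorem computablePred_mem_adjoin (hφ : ComputableEnum φ) {f g : α → A}
    (hf : ComputableVia φ f) (hg : ComputableVia φ g) :
    ComputablePred fun a => f a ∈ k⟮g a⟯ := by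
  have : CharZero A := charZero_of_injective_algebraMap (algebraMap k A).injective
  refine ComputablePred.computable_iff_re_compl_re'.2 ⟨?_, ?_⟩
  · refine (REPred.exists' (p := fun a (z : ℤ × List ℤ) => z.1 ≠ 0 ∧
      (z.1 : A) * f a = aeval (g a) (toPoly z.2)) ((ComputablePred.eq' (by fun_prop)
        (by fun_prop)).not.and' (hφ.computablePred_eq (hφ.via_mul (hφ.via_intCast (by fun_prop))
        (hf.comp (by fun_prop))) (hφ.via_aeval (hg.comp (by fun_prop)) (by fun_prop)))).to_re).of_eq
      fun a => ?_
    constructor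
    · rintro ⟨⟨N, p⟩, hN, h⟩
      have hN' : (N : A) ≠ 0 := by exact_mod_cast hN
      rw [(eq_inv_mul_iff_mul_eq₀ hN').2 h, ← aeval_map_algebraMap k]
      refine mul_mem (inv_mem (_root_.intCast_mem _ N)) ?_
      exact algebra_adjoin_le_adjoin k _ (aeval_mem_adjoin_singleton k _)
    · intro h
      obtain ⟨N, p, hN, h⟩ := exists_int_mul_eq_aeval k h
      obtain ⟨l, rfl⟩ := exists_toPoly p
      exact ⟨(N, l), hN, h⟩
  · refine REPred.of_eq ?_ fun a => (notMem_adjoin_simple_iff k (f a) (g a)).symm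
    refine REPred.exists' (p := fun a t => ∃ D, (minpoly k (g a)).natDegree ≤ D ∧
      D < (minpoly k (g a + (t : ℕ) * f a)).natDegree) ?_
    refine REPred.exists' (p := fun (x : α × ℕ) D => (minpoly k (g x.1)).natDegree ≤ D ∧
      D < (minpoly k (g x.1 + (x.2 : ℕ) * f x.1)).natDegree) ?_
    exact (rePred_natDegree_minpoly_le k hφ (hg.comp (by fun_prop)) Computable.snd).and'
      (rePred_lt_natDegree_minpoly k hφ (hφ.via_add (hg.comp (by fun_prop))
        (hφ.via_mul (hφ.via_natCast (by fun_prop)) (hf.comp (by fun_prop)))) Computable.snd)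

end Membership

end ComputableEnum

/-! ### Valuations on ramified extensions by a root of prime degree -/

section RadicalExtension

variable {F E Γ₀ : Type*} [Field F] [Field E] [Algebra F E] [LinearOrderedCommGroupWithZero Γ₀]

/-- Bézout: with um + vq = 1, take x = z^u p^v. -/
theorem Valuation.exists_pow_eq_of_coprime (w : Valuation F Γ₀) {z p : F} (hz0 : z ≠ 0)
    (hp : p ≠ 0) {q m : ℕ} (h : Nat.Coprime m q) (hz : w z ^ q = w p ^ m) :
    ∃ x, w x ^ q = w p := by
  have hb := Nat.gcd_eq_gcd_ab m q
  rw [h.gcd_eq_one] at hb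
  refine ⟨z ^ (m.gcdA q) * p ^ (m.gcdB q), ?_⟩
  have hz0' : w z ≠ 0 := (Valuation.ne_zero_iff _).2 hz0
  have hp' : w p ≠ 0 := (Valuation.ne_zero_iff _).2 hp
  have hz' : w z ^ (q : ℤ) = w p ^ (m : ℤ) := by exact_mod_cast hz
  calc w (z ^ (m.gcdA q) * p ^ (m.gcdB q)) ^ q
      = (w z ^ (q : ℤ)) ^ (m.gcdA q) * (w p) ^ (q * m.gcdB q) := by
        rw [map_mul, map_zpow₀, map_zpow₀, mul_pow, ← zpow_natCast, ← zpow_natCast, ← zpow_mul,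
          ← zpow_mul, ← zpow_mul, mul_comm (q : ℤ), mul_comm (q : ℤ)]
    _ = w p := by
        rw [hz', ← zpow_mul, ← zpow_add₀ hp']
        have : (m : ℤ) * m.gcdA q + q * m.gcdB q = 1 := by exact_mod_cast hb.symm
        rw [this, zpow_one]

/-- In a sum of monomials `cᵢ bⁱ`, `i < q`, where `b ^ q = t` and `t` is not a `q`-th power up to
units, one of the monomials determines the value. -/
theorem Valuation.exists_dominant_term (w : Valuation E Γ₀) {q : ℕ} (hq : q.Prime) {b : E} {t : F}
    (hb : b ^ q = algebraMap F E t) (ht : t ≠ 0)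
    (hG : ∀ x : F, w (algebraMap F E x) ^ q ≠ w (algebraMap F E t)) (c : ℕ → F) :
    ∃ i < q, w (∑ j ∈ Finset.range q, algebraMap F E (c j) * b ^ j) =
      w (algebraMap F E (c i) * b ^ i) ∧
      ∀ j < q, w (algebraMap F E (c j) * b ^ j) ≤ w (algebraMap F E (c i) * b ^ i) := by
  have ht' : algebraMap F E t ≠ 0 := by simpa using ht
  have hb0 : b ≠ 0 := by
    rintro rfl; rw [zero_pow hq.ne_zero] at hb; exact ht' hb.symm
  -- If the monomials i < j had equal values, the (j - i)-th power of the value of t would be a q-th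
  -- power from F. As j - i is prime to q, Bézout would make the value of t itself one.
  have hdist : ∀ i j, i < j → j < q → c i ≠ 0 → c j ≠ 0 →
      w (algebraMap F E (c i) * b ^ i) ≠ w (algebraMap F E (c j) * b ^ j) := by
    intro i j hij hj hi0 hj0 h
    have h1 : w (algebraMap F E (c i / c j)) ^ q = w (algebraMap F E t) ^ (j - i) := by
      have hcj : w (algebraMap F E (c j)) ≠ 0 := by simpa using hj0
      have hbi : w b ≠ 0 := by simpa using hb0
      have h2 : w (algebraMap F E (c i / c j)) = w b ^ (j - i) := by
        rw [map_mul, map_mul, map_pow, map_pow, ← pow_sub_mul_pow (w b) hij.le, ← mul_assoc] at h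
        have h3 := mul_right_cancel₀ (pow_ne_zero i hbi) h
        rw [map_div₀, map_div₀, h3, mul_div_cancel_left₀ _ hcj]
      rw [h2, ← hb, map_pow, ← pow_mul, ← pow_mul, mul_comm]
    obtain ⟨x, hx⟩ := (w.comap (algebraMap F E)).exists_pow_eq_of_coprime
      (div_ne_zero hi0 hj0) ht (m := j - i)
      (((Nat.Prime.coprime_iff_not_dvd hq).2 (Nat.not_dvd_of_pos_of_lt (by omega) (by omega))).symm)
      h1
    exact hG x hx
  obtain ⟨i, hi, hmax⟩ := Finset.exists_max_image (Finset.range q)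
    (fun j => w (algebraMap F E (c j) * b ^ j)) ⟨0, by simpa using hq.pos⟩
  have hi' := Finset.mem_range.1 hi
  refine ⟨i, hi', ?_, fun j hj => hmax j (by simpa using hj)⟩
  by_cases hi0 : w (algebraMap F E (c i) * b ^ i) = 0
  · have : ∀ j ∈ Finset.range q, algebraMap F E (c j) * b ^ j = 0 := fun j hj => by
      have := hmax j hj
      rwa [hi0, le_zero_iff, map_eq_zero] at this
    rw [Finset.sum_eq_zero this, map_zero, hi0]
  · have hci : c i ≠ 0 := by rintro h; simp [h] at hi0
    rw [← Finset.add_sum_erase _ _ hi]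
    apply Valuation.map_add_eq_of_lt_left
    refine Valuation.map_sum_lt _ hi0 fun j hj => ?_
    obtain ⟨hji, hj⟩ := Finset.mem_erase.1 hj
    have hj' := Finset.mem_range.1 hj
    refine lt_of_le_of_ne (hmax j hj) ?_
    by_cases hcj : c j = 0
    · rw [hcj]; simpa using Ne.symm hi0
    · rcases lt_or_gt_of_ne hji with h | h
      · exact hdist j i h hi' hcj hci
      · exact (hdist i j h hj' hci hcj).symm

open IntermediateField in
-- Division by the monic polynomial X^q - t leaves a remainder of degree below q; irreducibility
-- plays no role.
theorem exists_coeff_of_mem_adjoin {q : ℕ} (hq : q ≠ 0) {b : E} {t : F}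
    (hb : b ^ q = algebraMap F E t) {y : E} (hy : y ∈ F⟮b⟯) :
    ∃ c : ℕ → F, y = ∑ j ∈ Finset.range q, algebraMap F E (c j) * b ^ j := by
  have hroot : aeval b (X ^ q - C t) = 0 := by simp [hb]
  have hmonic : (X ^ q - C t).Monic := monic_X_pow_sub_C t hq
  have hint : IsIntegral F b := ⟨_, hmonic, by simpa [aeval_def] using hroot⟩
  rw [← mem_toSubalgebra, adjoin_simple_toSubalgebra_of_isAlgebraic hint.isAlgebraic,
    Algebra.adjoin_singleton_eq_range_aeval] at hy
  obtain ⟨p, rfl⟩ := hy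
  refine ⟨(p %ₘ (X ^ q - C t)).coeff, ?_⟩
  change aeval b p = _
  rw [← aeval_modByMonic_eq_self_of_root hroot, aeval_eq_sum_range' (n := q)]
  · simp [Algebra.smul_def]
  · have := natDegree_modByMonic_lt p hmonic (by
      intro h; have := congrArg natDegree h; rw [natDegree_X_pow_sub_C] at this; simp at this
      exact hq this)
    rwa [natDegree_X_pow_sub_C] at this

open IntermediateField in
/-- A valuation has at most one extension to the ramified extension generated by a `q`-th root. -/
theorem ValuationSubring.mem_iff_of_mem_adjoin_root {q : ℕ} (hq : q.Prime) {b : E} {t : F}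
    (hb : b ^ q = algebraMap F E t) (ht : t ≠ 0) (W W' : ValuationSubring E)
    (hWW' : ∀ x : F, algebraMap F E x ∈ W ↔ algebraMap F E x ∈ W')
    (hG : ∀ x : F, W.valuation (algebraMap F E x) ^ q ≠ W.valuation (algebraMap F E t))
    (hG' : ∀ x : F, W'.valuation (algebraMap F E x) ^ q ≠ W'.valuation (algebraMap F E t))
    {y : E} (hy : y ∈ F⟮b⟯) : y ∈ W ↔ y ∈ W' := by
  obtain ⟨c, rfl⟩ := exists_coeff_of_mem_adjoin hq.ne_zero hb hy
  -- The dominant term shows that a sum is integral iff all its terms are, and a term is integral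
  -- iff its q-th power is. That power lies in F, so the criterion refers only to the trace of W on
  -- F.
  have key : ∀ W : ValuationSubring E,
      (∀ x : F, W.valuation (algebraMap F E x) ^ q ≠ W.valuation (algebraMap F E t)) →
      ((∑ j ∈ Finset.range q, algebraMap F E (c j) * b ^ j) ∈ W ↔
        ∀ j < q, algebraMap F E (c j ^ q * t ^ j) ∈ W) := by
    intro W hG
    obtain ⟨i, hi, hval, hmax⟩ := W.valuation.exists_dominant_term hq hb ht hG c
    have hterm : ∀ j, algebraMap F E (c j ^ q * t ^ j) ∈ W ↔
        W.valuation (algebraMap F E (c j) * b ^ j) ≤ 1 := fun j => by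
      rw [← ValuationSubring.valuation_le_one_iff, map_mul, map_pow, map_pow, ← hb, ← pow_mul,
        mul_comm q j, pow_mul, ← mul_pow, map_pow, pow_le_one_iff hq.ne_zero]
    rw [← ValuationSubring.valuation_le_one_iff, hval]
    constructor
    · intro h j hj
      exact (hterm j).2 ((hmax j hj).trans h)
    · intro h
      exact (hterm i).1 (h i hi)
  rw [key W hG, key W' hG']
  exact forall₂_congr fun j _ => hWW' _

open IntermediateField in
-- The value of y is that of one monomial c_i b^i, so y^q has the value of some z in F. If y^q' had
-- the value of p, then z^q' would have that of p^q, and Bézout for q and q' would produce an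
-- element of F with q'-th power of the value of p.
theorem Valuation.pow_ne_of_mem_adjoin_root (w : Valuation E Γ₀) {q q' : ℕ} (hq : q.Prime)
    (hq' : q'.Prime) (hqq' : q ≠ q') {b : E} {t p : F} (hb : b ^ q = algebraMap F E t) (ht : t ≠ 0)
    (hp : p ≠ 0) (htp : w (algebraMap F E t) = w (algebraMap F E p))
    (hG : ∀ x : F, w (algebraMap F E x) ^ q ≠ w (algebraMap F E p))
    (hG' : ∀ x : F, w (algebraMap F E x) ^ q' ≠ w (algebraMap F E p))
    {y : E} (hy : y ∈ F⟮b⟯) : w y ^ q' ≠ w (algebraMap F E p) := by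
  intro hval
  obtain ⟨c, rfl⟩ := exists_coeff_of_mem_adjoin hq.ne_zero hb hy
  obtain ⟨i, hi, hi', -⟩ := w.exists_dominant_term hq hb ht (by rwa [htp]) c
  rw [hi'] at hval
  have hp' : w (algebraMap F E p) ≠ 0 := by simpa using hp
  have hci : c i ≠ 0 := by
    intro h
    simp only [h, map_zero, zero_mul, zero_pow hq'.ne_zero] at hval
    exact hp' hval.symm
  obtain ⟨x, hx⟩ := (w.comap (algebraMap F E)).exists_pow_eq_of_coprime
    (z := c i ^ q * t ^ i) (p := p) (mul_ne_zero (pow_ne_zero _ hci) (pow_ne_zero _ ht)) hp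
    (q := q') (m := q) ((Nat.coprime_primes hq hq').2 hqq') (by
      rw [Valuation.comap_apply, Valuation.comap_apply, ← hval, map_mul, map_pow, map_pow, ← hb,
        ← pow_mul, mul_comm q i, pow_mul, ← mul_pow, map_pow, ← pow_mul, ← pow_mul, mul_comm q q'])
  exact hG' x hx

end RadicalExtension

/-! ### Roots of 1-units in residue characteristic 2 -/

section Conjugates

variable {F Ω : Type*} [Field F] [Field Ω] [CharZero Ω] [Algebra F Ω] [IsAlgClosed Ω]
  [Algebra.IsAlgebraic F Ω]

theorem ValuationSubring.valuation_natCast_eq_one {E : Type*} [Field E] (W : ValuationSubring E)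
    (h2 : W.valuation 2 < 1) {n : ℕ} (hn : Odd n) : W.valuation (n : E) = 1 := by
  obtain ⟨m, rfl⟩ := hn
  have hm : W.valuation (m : E) ≤ 1 := (W.valuation_le_one_iff _).2 (natCast_mem W m)
  have : W.valuation (2 * (m : E)) < 1 := by
    rw [map_mul]
    exact mul_lt_one_of_lt_of_le h2 hm
  push_cast
  rw [Valuation.map_add_eq_of_lt_right _ (by rwa [map_one]), map_one]

/-- If `c ^ q` is a 1-unit of odd prime degree `q` over `F`, then `c` has conjugates which are
1-units and conjugates which are not. -/
theorem exists_algEquiv_not_mem_iff (W : ValuationSubring Ω) (h2 : W.valuation 2 < 1) {q : ℕ}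
    (hq : q.Prime) (hodd : Odd q) {c : Ω} {t : F} (hc : c ^ q = algebraMap F Ω t)
    (ht : W.valuation (algebraMap F Ω t - 1) < 1) (hirr : Irreducible (X ^ q - C t)) :
    ∃ σ : Ω ≃ₐ[F] Ω, ¬ ((1 - c)⁻¹ ∈ W ↔ σ (1 - c)⁻¹ ∈ W) := by
  have : IsAlgClosure F Ω := ⟨inferInstance, inferInstance⟩
  have : Normal F Ω := IsAlgClosure.normal F Ω
  have hqne : NeZero (q : Ω) := ⟨by exact_mod_cast hq.ne_zero⟩
  obtain ⟨ζ, hζ⟩ := HasEnoughRootsOfUnity.exists_primitiveRoot Ω q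
  have htW : W.valuation (algebraMap F Ω t) = 1 := by
    rw [← sub_add_cancel (algebraMap F Ω t) 1, Valuation.map_add_eq_of_lt_right _ (by rwa [map_one]),
      map_one]
  have hroot : ∀ ρ : Ω, ρ ^ q = algebraMap F Ω t → W.valuation ρ = 1 := fun ρ h => by
    have := congrArg W.valuation h
    rw [map_pow, htW] at this
    exact (pow_eq_one_iff_of_nonneg zero_le hq.ne_zero).1 this
  have hconj : ∀ ρ : Ω, ρ ^ q = algebraMap F Ω t → ∃ σ : Ω ≃ₐ[F] Ω, σ c = ρ := by
    intro ρ hρ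
    have hmin : ∀ z : Ω, z ^ q = algebraMap F Ω t → minpoly F z = X ^ q - C t := fun z hz =>
      (minpoly.eq_of_irreducible_of_monic hirr (by simp [hz])
        (monic_X_pow_sub_C t hq.ne_zero)).symm
    exact isConjRoot_iff_exists_algEquiv.1 ((hmin ρ hρ).trans (hmin c hc).symm)
  -- The product of the factors 1 - ρ over all q-th roots ρ of t is 1 - t, which has value below 1;
  -- so one factor does too.
  obtain ⟨ρ, hρ, hρ1⟩ : ∃ ρ : Ω, ρ ^ q = algebraMap F Ω t ∧ W.valuation (1 - ρ) < 1 := by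
    have hprod := hζ.pow_sub_pow_eq_prod_sub_mul 1 c hq.pos
    rw [one_pow, hc] at hprod
    by_contra! hcon
    have : W.valuation (1 - algebraMap F Ω t) = 1 := by
      rw [hprod, map_prod]
      refine Finset.prod_eq_one fun z hz => ?_
      have hz1 : z ^ q = 1 := (mem_nthRootsFinset hq.pos 1).1 hz
      have hzc : (z * c) ^ q = algebraMap F Ω t := by rw [mul_pow, hz1, one_mul, hc]
      refine le_antisymm ?_ (hcon _ hzc)
      exact (Valuation.map_sub _ _ _).trans (by rw [map_one, hroot _ hzc, max_self])
    rw [Valuation.map_sub_swap, this] at ht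
    exact lt_irrefl _ ht
  have hρζ : (ρ * ζ) ^ q = algebraMap F Ω t := by rw [mul_pow, hζ.pow_eq_one, mul_one, hρ]
  -- Two distinct roots that are 1-units would give ζ ≡ 1. Then q = ∑ (1 - ζ^i) would have value
  -- below 1, while an odd number is a unit over 2.
  have hρ2 : ¬ W.valuation (1 - ρ * ζ) < 1 := by
    intro hlt
    have hζ1 : W.valuation (1 - ζ) < 1 := by
      have h1 : ρ * (1 - ζ) = (1 - ρ * ζ) - (1 - ρ) := by ring
      have h2 : W.valuation (ρ * (1 - ζ)) < 1 := by
        rw [h1]; exact (Valuation.map_sub _ _ _).trans_lt (max_lt hlt hρ1)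
      rwa [map_mul, hroot ρ hρ, one_mul] at h2
    have hζW : W.valuation ζ = 1 := by
      have := congrArg W.valuation hζ.pow_eq_one
      rw [map_pow, map_one] at this
      exact (pow_eq_one_iff_of_nonneg zero_le hq.ne_zero).1 this
    have hsum := hζ.geom_sum_eq_zero hq.one_lt
    have h3 : (q : Ω) = ∑ i ∈ Finset.range q, (1 - ζ ^ i) := by
      rw [Finset.sum_sub_distrib, hsum]; simp
    have h4 : W.valuation (q : Ω) < 1 := by
      rw [h3]
      refine Valuation.map_sum_lt _ one_ne_zero fun i _ => ?_
      have h5 := geom_sum_mul_neg ζ i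
      rw [← h5, map_mul]
      rw [mul_comm]
      refine mul_lt_one_of_lt_of_le hζ1 ?_
      refine Valuation.map_sum_le _ fun j _ => ?_
      rw [map_pow, hζW, one_pow]
    rw [W.valuation_natCast_eq_one h2 hodd] at h4
    exact lt_irrefl _ h4
  -- Membership of (1 - z)⁻¹ in W expresses that z is not a 1-unit.
  have hmem : ∀ z : Ω, z ≠ 1 → ((1 - z)⁻¹ ∈ W ↔ ¬ W.valuation (1 - z) < 1) := fun z hz => by
    rw [← ValuationSubring.valuation_le_one_iff, map_inv₀, not_lt]
    exact inv_le_one₀ (zero_lt_iff.2 (by simpa [sub_eq_zero] using hz.symm))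
  have hne : ∀ z : Ω, z ^ q = algebraMap F Ω t → z ≠ 1 := by
    rintro z hz rfl
    rw [one_pow, ← map_one (algebraMap F Ω)] at hz
    have h1 := (algebraMap F Ω).injective hz
    rw [← h1] at hirr
    exact (X_pow_sub_C_irreducible_iff_of_prime hq).1 hirr 1 (one_pow q)
  by_cases hc1 : W.valuation (1 - c) < 1
  · obtain ⟨σ, hσ⟩ := hconj _ hρζ
    refine ⟨σ, ?_⟩
    rw [map_inv₀, map_sub, map_one, hσ, hmem _ (hne _ hρζ), hmem _ (hne _ hc)]
    tauto
  · obtain ⟨σ, hσ⟩ := hconj _ hρ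
    refine ⟨σ, ?_⟩
    rw [map_inv₀, map_sub, map_one, hσ, hmem _ (hne _ hρ), hmem _ (hne _ hc)]
    tauto

end Conjugates

theorem ValuationSubring.valuation_lt_one_iff_inv_notMem {E : Type*} [Field E]
    (W : ValuationSubring E) {x : E} (hx : x ≠ 0) : W.valuation x < 1 ↔ x⁻¹ ∉ W := by
  rw [← ValuationSubring.valuation_le_one_iff, map_inv₀, not_le,
    one_lt_inv₀ (zero_lt_iff.2 (by simpa using hx))]

/-! ### Certificates for membership in valuation rings over 2 -/

section TwoAdic

variable {Ω : Type*} [Field Ω]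

/-- All valuation rings of `Ω` over `2` have the same trace on `S`. -/
def ValDetermined (S : Set Ω) : Prop :=
  ∀ W W' : ValuationSubring Ω, W.valuation 2 < 1 → W'.valuation 2 < 1 → ∀ x ∈ S, x ∈ W → x ∈ W'

/-- The value of `2` is not `q` times the value of an element of `S`. -/
def NoRootOfTwo (q : ℕ) (S : Set Ω) : Prop :=
  ∀ W : ValuationSubring Ω, W.valuation 2 < 1 → ∀ x ∈ S, W.valuation x ^ q ≠ W.valuation 2

theorem exists_valuationSubring_of_subring (A : Subring Ω) (I : Ideal A) (hI : I ≠ ⊤) :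
    ∃ W : ValuationSubring Ω, (∀ x ∈ A, x ∈ W) ∧ ∀ x ∈ I, W.valuation (x : Ω) < 1 := by
  obtain ⟨W, h1, h2⟩ := I.image_subset_nonunits_valuationSubring hI
  exact ⟨W, fun x hx => h1 hx, fun x hx => (W.mem_nonunits_iff).1 (h2 ⟨x, hx, rfl⟩)⟩

/-- Either `x` is integral for some valuation over `2`, or this is excluded by an equation. -/
theorem exists_mem_valuationSubring_or (x : Ω) :
    (∃ W : ValuationSubring Ω, W.valuation 2 < 1 ∧ x ∈ W) ∨ ∃ f : ℤ[X], 2 * aeval x f = 1 := by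
  by_cases hI : (Ideal.span {2} : Ideal (Algebra.adjoin ℤ {x}).toSubring) = ⊤
  · right
    obtain ⟨⟨y, hy⟩, h⟩ := Ideal.mem_span_singleton'.1 ((Ideal.eq_top_iff_one _).1 hI)
    have hy' : y ∈ Algebra.adjoin ℤ {x} := hy
    rw [Algebra.adjoin_singleton_eq_range_aeval] at hy'
    obtain ⟨f, rfl⟩ := hy'
    exact ⟨f, (mul_comm _ _).trans (congrArg Subtype.val h)⟩
  · left
    obtain ⟨W, h1, h2⟩ := exists_valuationSubring_of_subring _ _ hI
    exact ⟨W, h2 2 (Ideal.mem_span_singleton_self 2), h1 x (Algebra.self_mem_adjoin_singleton ℤ x)⟩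

/-- A proper ideal (2, x) of ℤ[x] is dominated by a valuation ring; otherwise 1 lies in the ideal,
and the expression for it is the certificate. -/
theorem exists_valuation_lt_one_or (x : Ω) :
    (∃ W : ValuationSubring Ω, W.valuation 2 < 1 ∧ W.valuation x < 1) ∨
      ∃ f g : ℤ[X], 2 * aeval x f + x * aeval x g = 1 := by
  have hx : x ∈ (Algebra.adjoin ℤ {x}).toSubring := Algebra.self_mem_adjoin_singleton ℤ x
  by_cases hI : (Ideal.span {2, ⟨x, hx⟩} : Ideal (Algebra.adjoin ℤ {x}).toSubring) = ⊤
  · right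
    obtain ⟨⟨y, hy⟩, ⟨z, hz⟩, h⟩ := Ideal.mem_span_pair.1 ((Ideal.eq_top_iff_one _).1 hI)
    have hy' : y ∈ Algebra.adjoin ℤ {x} := hy
    have hz' : z ∈ Algebra.adjoin ℤ {x} := hz
    rw [Algebra.adjoin_singleton_eq_range_aeval] at hy' hz'
    obtain ⟨f, rfl⟩ := hy'
    obtain ⟨g, rfl⟩ := hz'
    refine ⟨f, g, ?_⟩
    rw [mul_comm, mul_comm x]
    exact congrArg Subtype.val h
  · left
    obtain ⟨W, -, h2⟩ := exists_valuationSubring_of_subring _ _ hI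
    exact ⟨W, h2 2 (Ideal.subset_span (by simp)), h2 ⟨x, hx⟩ (Ideal.subset_span (by simp))⟩

/-- At x = 0 the excluding certificate would say that 2 divides 1 in ℤ. -/
theorem exists_valuationSubring_two [CharZero Ω] :
    ∃ W : ValuationSubring Ω, W.valuation 2 < 1 := by
  rcases exists_mem_valuationSubring_or (0 : Ω) with ⟨W, h, -⟩ | ⟨f, h⟩
  · exact ⟨W, h⟩
  · exfalso
    have h0 : aeval (0 : Ω) f = (f.coeff 0 : Ω) := by
      rw [aeval_def, eval₂_at_zero]; simp
    rw [h0] at h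
    have : (2 : ℤ) * f.coeff 0 = 1 := by exact_mod_cast h
    omega

theorem ValuationSubring.aeval_int_mem (W : ValuationSubring Ω) {x : Ω} (hx : x ∈ W) (f : ℤ[X]) :
    aeval x f ∈ W := by
  have h := aeval_algebraMap_apply Ω (⟨x, hx⟩ : W) f
  exact h ▸ (aeval (⟨x, hx⟩ : W) f).2

/-- On `S` all valuation rings over 2 agree, so x is outside one iff it is outside all, and then a
certificate exists. This makes non-membership c.e. -/
theorem ValDetermined.notMem_iff {S : Set Ω} (hS : ValDetermined S) {W : ValuationSubring Ω}
    (hW : W.valuation 2 < 1) {x : Ω} (hx : x ∈ S) : x ∉ W ↔ ∃ f : ℤ[X], 2 * aeval x f = 1 := by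
  constructor
  · intro h
    refine (exists_mem_valuationSubring_or x).resolve_left ?_
    rintro ⟨W', h2, hx'⟩
    exact h (hS W' W h2 hW x hx hx')
  · rintro ⟨f, hf⟩ hxW
    have h1 := (W.valuation_le_one_iff _).2 (W.aeval_int_mem hxW f)
    have h2 := congrArg W.valuation hf
    rw [map_mul, map_one] at h2
    exact absurd h2 (mul_lt_one_of_lt_of_le hW h1).ne

/-- A nonzero x is outside W iff 1/x has value below 1. By determination, x is in W iff this happens
for no valuation over 2, which again has a certificate; so membership is c.e. -/
theorem ValDetermined.mem_iff {S : Set Ω} (hS : ValDetermined S) {W : ValuationSubring Ω}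
    (hW : W.valuation 2 < 1) {x : Ω} (hx : x ∈ S) :
    x ∈ W ↔ x = 0 ∨ ∃ f g : ℤ[X], 2 * aeval x⁻¹ f + x⁻¹ * aeval x⁻¹ g = 1 := by
  by_cases hx0 : x = 0
  · simp [hx0]
  have hiff : ∀ W : ValuationSubring Ω, W.valuation x⁻¹ < 1 ↔ x ∉ W := fun W => by
    rw [W.valuation_lt_one_iff_inv_notMem (inv_ne_zero hx0), inv_inv]
  simp only [hx0, false_or]
  constructor
  · intro h
    refine (exists_valuation_lt_one_or x⁻¹).resolve_left ?_
    rintro ⟨W', h2, hx'⟩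
    exact (hiff W').1 hx' (hS W W' hW h2 x hx h)
  · rintro ⟨f, g, hfg⟩
    by_contra hxW
    have hlt := (hiff W).2 hxW
    have hm : x⁻¹ ∈ W := (W.valuation_le_one_iff _).1 hlt.le
    have h1 := (W.valuation_le_one_iff _).2 (W.aeval_int_mem hm f)
    have h2 := (W.valuation_le_one_iff _).2 (W.aeval_int_mem hm g)
    have h3 := Valuation.map_add_lt W.valuation
      (x := 2 * aeval x⁻¹ f) (y := x⁻¹ * aeval x⁻¹ g) (g := 1)
      (by rw [map_mul]; exact mul_lt_one_of_lt_of_le hW h1)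
      (by rw [map_mul]; exact mul_lt_one_of_lt_of_le hlt h2)
    rw [hfg, map_one] at h3
    exact lt_irrefl _ h3

end TwoAdic

/-! ### The 2-adic valuation on the rational numbers -/

section Base

variable (k : Type*) [Field k] [CharZero k] [IsFractionRing ℤ k]
  {Ω : Type*} [Field Ω] [Algebra k Ω]

theorem exists_valuation_intCast_eq [CharZero Ω] {a : ℤ} (ha : a ≠ 0) :
    ∃ n : ℕ, ∀ W : ValuationSubring Ω, W.valuation 2 < 1 →
      W.valuation (a : Ω) = W.valuation 2 ^ n := by
  obtain ⟨n, m, hm, h⟩ := Nat.exists_eq_two_pow_mul_odd (Int.natAbs_ne_zero.2 ha)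
  refine ⟨n, fun W hW => ?_⟩
  have h1 : W.valuation (a : Ω) = W.valuation ((a.natAbs : ℕ) : Ω) := by
    rcases Int.natAbs_eq a with h | h
    · conv_lhs => rw [h, Int.cast_natCast]
    · conv_lhs => rw [h, Int.cast_neg, Int.cast_natCast, Valuation.map_neg]
  rw [h1, h]
  push_cast
  rw [map_mul, map_pow, W.valuation_natCast_eq_one hW hm, mul_one]

/-- Odd integers are units over 2, so only the power of 2 in x counts. The exponent does not depend
on `W`, which gives uniqueness on the base field. -/
theorem exists_valuation_eq_zpow {x : k} (hx : x ≠ 0) :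
    ∃ e : ℤ, ∀ W : ValuationSubring Ω, W.valuation 2 < 1 →
      W.valuation (algebraMap k Ω x) = W.valuation 2 ^ e := by
  have : CharZero Ω := charZero_of_injective_algebraMap (algebraMap k Ω).injective
  obtain ⟨a, b, hb, rfl⟩ := IsFractionRing.div_surjective (A := ℤ) x
  have hb0 : b ≠ 0 := nonZeroDivisors.ne_zero hb
  have ha0 : a ≠ 0 := by rintro rfl; simp at hx
  obtain ⟨m, hm⟩ := exists_valuation_intCast_eq (Ω := Ω) ha0
  obtain ⟨n, hn⟩ := exists_valuation_intCast_eq (Ω := Ω) hb0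
  refine ⟨m - n, fun W hW => ?_⟩
  have h2 : W.valuation (2 : Ω) ≠ 0 := by simp
  rw [map_div₀, map_div₀, zpow_sub₀ h2, zpow_natCast, zpow_natCast, ← hm W hW, ← hn W hW]
  simp

theorem valDetermined_bot : ValDetermined ((⊥ : IntermediateField k Ω) : Set Ω) := by
  have : CharZero Ω := charZero_of_injective_algebraMap (algebraMap k Ω).injective
  rintro W W' hW hW' _ ⟨x, rfl⟩ hx
  by_cases hx0 : x = 0
  · simp [hx0]
  obtain ⟨e, he⟩ := exists_valuation_eq_zpow k (Ω := Ω) hx0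
  have hx' : algebraMap k Ω x ∈ W := hx
  change algebraMap k Ω x ∈ W'
  have key : ∀ W : ValuationSubring Ω, W.valuation 2 < 1 → (W.valuation (2 : Ω) ^ e ≤ 1 ↔ 0 ≤ e) :=
    fun W hW => zpow_le_one_iff_right_of_lt_one₀ (zero_lt_iff.2 (by simp)) hW
  rw [← ValuationSubring.valuation_le_one_iff, he W hW, key W hW] at hx'
  rwa [← ValuationSubring.valuation_le_one_iff, he W' hW', key W' hW']

theorem noRootOfTwo_bot {q : ℕ} (hq : 2 ≤ q) :
    NoRootOfTwo q ((⊥ : IntermediateField k Ω) : Set Ω) := by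
  have : CharZero Ω := charZero_of_injective_algebraMap (algebraMap k Ω).injective
  rintro W hW _ ⟨x, rfl⟩ h
  have h' : W.valuation (algebraMap k Ω x) ^ q = W.valuation 2 := h
  have h20 : W.valuation (2 : Ω) ≠ 0 := by simp
  by_cases hx0 : x = 0
  · rw [hx0, map_zero, map_zero, zero_pow (by omega)] at h'
    exact h20 h'.symm
  obtain ⟨e, he⟩ := exists_valuation_eq_zpow k (Ω := Ω) hx0
  rw [he W hW, ← zpow_natCast, ← zpow_mul] at h'
  have h1 : e * q = 1 := zpow_right_injective₀ (zero_lt_iff.2 h20) hW.ne (by simpa using h')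
  have h2 := Int.eq_one_or_neg_one_of_mul_eq_one' h1
  omega

/-- A quotient of coprime integers with a prime numerator is not a power. -/
theorem pow_mul_natCast_ne {q r s : ℕ} (hq : 2 ≤ q) (hr : r.Prime) (hrs : ¬ r ∣ s) (hs : s ≠ 0)
    (y : k) : y ^ q * s ≠ r := by
  intro h
  obtain ⟨a, b, hb, rfl⟩ := IsFractionRing.div_surjective (A := ℤ) y
  have hb0 : b ≠ 0 := nonZeroDivisors.ne_zero hb
  have hb0' : (b : k) ≠ 0 := by exact_mod_cast hb0
  have h1 : a ^ q * s = r * b ^ q := by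
    have : (a : k) ^ q * s = r * b ^ q := by
      rw [← h]; simp only [eq_intCast, div_pow]; field_simp
    exact_mod_cast this
  have h2 : a.natAbs ^ q * s = r * b.natAbs ^ q := by
    have := congrArg Int.natAbs h1
    simpa [Int.natAbs_mul, Int.natAbs_pow] using this
  have ha0 : a.natAbs ≠ 0 := by
    intro h0
    rw [h0, zero_pow (by omega), zero_mul] at h2
    exact (mul_ne_zero hr.ne_zero (pow_ne_zero q (Int.natAbs_ne_zero.2 hb0))) h2.symm
  -- The exponent of r is divisible by q on the left and congruent to 1 modulo q on the right.
  have h3 := congrArg (fun n => n.factorization r) h2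
  rw [Nat.factorization_mul (pow_ne_zero _ ha0) hs,
    Nat.factorization_mul hr.ne_zero (pow_ne_zero _ (Int.natAbs_ne_zero.2 hb0))] at h3
  simp [Nat.factorization_eq_zero_of_not_dvd hrs, hr.factorization_self] at h3
  have h4 : q ∣ 1 := (Nat.dvd_add_left (dvd_mul_right q (b.natAbs.factorization r))).1
    (h3 ▸ dvd_mul_right _ _)
  have := Nat.le_of_dvd one_pos h4
  omega

end Base

open IntermediateField

/-! ### Adjoining a root of 2r -/

section Step

variable {k Ω : Type*} [Field k] [Field Ω] [CharZero Ω] [Algebra k Ω]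

/-- Since r is a unit over 2, the radicand 2r has the value of 2, which is not a q-th power of a
value on F. The extension is therefore ramified and the valuation extends in only one way. -/
theorem ValDetermined.adjoin_root {F : IntermediateField k Ω} (hF : ValDetermined (F : Set Ω))
    {q r : ℕ} (hq : q.Prime) (hr : Odd r) (hG : NoRootOfTwo q (F : Set Ω)) {b : Ω}
    (hb : b ^ q = 2 * r) : ValDetermined (F⟮b⟯ : Set Ω) := by
  intro W W' hW hW' y hy hyW
  have hr0 : (r : F) ≠ 0 := by
    have : CharZero F := (algebraMap F Ω).charZero
    exact_mod_cast hr.pos.ne'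
  have ht : (2 * r : F) ≠ 0 := mul_ne_zero (by
    have : CharZero F := (algebraMap F Ω).charZero
    exact two_ne_zero) hr0
  have hval : ∀ W : ValuationSubring Ω, W.valuation 2 < 1 →
      ∀ x : F, W.valuation (algebraMap F Ω x) ^ q ≠ W.valuation (algebraMap F Ω (2 * r)) := by
    intro W hW x
    rw [map_mul (algebraMap F Ω), map_mul, map_natCast, W.valuation_natCast_eq_one hW hr, mul_one,
      map_ofNat]
    exact hG W hW _ x.2
  exact (ValuationSubring.mem_iff_of_mem_adjoin_root hq (t := (2 * r : F)) (by rw [hb, map_mul, map_natCast, map_ofNat]) ht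
    W W' (fun x => ⟨hF W W' hW hW' x x.2, hF W' W hW' hW x x.2⟩) (hval W hW) (hval W' hW') hy).1 hyW

theorem NoRootOfTwo.adjoin_root {F : IntermediateField k Ω}
    {q q' r : ℕ} (hq : q.Prime) (hq' : q'.Prime) (hqq' : q ≠ q') (hr : Odd r)
    (hG : NoRootOfTwo q (F : Set Ω)) (hG' : NoRootOfTwo q' (F : Set Ω)) {b : Ω}
    (hb : b ^ q = 2 * r) : NoRootOfTwo q' (F⟮b⟯ : Set Ω) := by
  intro W hW y hy
  have : CharZero F := (algebraMap F Ω).charZero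
  have hr0 : (r : F) ≠ 0 := by exact_mod_cast hr.pos.ne'
  have := W.valuation.pow_ne_of_mem_adjoin_root hq hq' hqq' (t := (2 * r : F)) (p := (2 : F))
    (by rw [hb, map_mul, map_natCast, map_ofNat]) (mul_ne_zero two_ne_zero hr0) two_ne_zero
    (by rw [map_mul (algebraMap F Ω), map_mul, map_natCast, W.valuation_natCast_eq_one hW hr,
      mul_one]) (fun x => by rw [map_ofNat]; exact hG W hW _ x.2)
    (fun x => by rw [map_ofNat]; exact hG' W hW _ x.2) hy
  rwa [map_ofNat] at this

/-- For prime q it is enough that there is no root in F, and a root would have q-th power of the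
value of 2. -/
theorem NoRootOfTwo.irreducible {F : IntermediateField k Ω} {q r : ℕ} (hq : q.Prime) (hr : Odd r)
    (hG : NoRootOfTwo q (F : Set Ω)) : Irreducible (X ^ q - C (2 * r : F)) := by
  obtain ⟨W, hW⟩ := exists_valuationSubring_two (Ω := Ω)
  refine X_pow_sub_C_irreducible_of_prime hq fun b hb => hG W hW b b.2 ?_
  have h := congrArg (fun x : F => W.valuation (algebraMap F Ω x)) hb
  simp only [map_pow, map_mul, map_natCast, W.valuation_natCast_eq_one hW hr, mul_one,
    map_ofNat] at h
  exact h

theorem ValuationSubring.comap_valuation_two (W : ValuationSubring Ω) (hW : W.valuation 2 < 1)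
    {E : Type*} [Field E] [CharZero E] (σ : E →+* Ω) : (W.comap σ).valuation 2 < 1 := by
  rw [ValuationSubring.valuation_lt_one_iff_inv_notMem _ two_ne_zero] at hW ⊢
  rwa [ValuationSubring.mem_comap, map_inv₀, map_ofNat]

theorem ValuationSubring.valuation_sub_one_lt (W : ValuationSubring Ω) (hW : W.valuation 2 < 1)
    {r s : ℕ} (hr : Odd r) (hs : Odd s) : W.valuation ((r / s : Ω) - 1) < 1 := by
  obtain ⟨a, rfl⟩ := hr
  have hs' := W.valuation_natCast_eq_one hW hs
  have hs0 : (s : Ω) ≠ 0 := by exact_mod_cast hs.pos.ne'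
  obtain ⟨b, rfl⟩ := hs
  rw [div_sub_one hs0, map_div₀, hs', div_one]
  have : (((2 * a + 1 : ℕ) : Ω) - ((2 * b + 1 : ℕ) : Ω)) = 2 * ((a - b : ℤ) : Ω) := by
    push_cast; ring
  rw [this, map_mul]
  exact mul_lt_one_of_lt_of_le hW ((W.valuation_le_one_iff _).2 (intCast_mem W _))

variable [CharZero k] [IsFractionRing ℤ k] [IsAlgClosed Ω] [Algebra.IsAlgebraic k Ω]

/-- A field with a determined valuation contains no `q`-th roots of odd rational numbers which are
not `q`-th powers. -/
theorem ValDetermined.pow_mul_ne {F : IntermediateField k Ω} (hF : ValDetermined (F : Set Ω))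
    {q r s : ℕ} (hq : q.Prime) (hq2 : Odd q) (hr : r.Prime) (hr2 : Odd r) (hs : Odd s)
    (hrs : ¬ r ∣ s) {c : Ω} (hc : c ∈ F) : c ^ q * s ≠ r := by
  intro h
  obtain ⟨W, hW⟩ := exists_valuationSubring_two (Ω := Ω)
  have hs0 : (s : Ω) ≠ 0 := by exact_mod_cast hs.pos.ne'
  have hs0' : (s : k) ≠ 0 := by exact_mod_cast hs.pos.ne'
  -- Here c is a root of the 1-unit r/s, irreducibly over k. Some σ changes the membership of (1 -
  -- c)⁻¹ in W, so W and its pullback along σ, both over 2, disagree on an element of F.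
  obtain ⟨σ, hσ⟩ := exists_algEquiv_not_mem_iff (F := k) W hW hq hq2 (c := c) (t := (r / s : k))
    (by rw [eq_div_of_mul_eq hs0 h]; simp) (by simpa using W.valuation_sub_one_lt hW hr2 hs)
    (X_pow_sub_C_irreducible_of_prime hq fun y hy =>
      pow_mul_natCast_ne k hq.two_le hr hrs hs.pos.ne' y (by rw [hy]; field_simp))
  have hc' : (1 - c)⁻¹ ∈ (F : Set Ω) := F.inv_mem (F.sub_mem F.one_mem hc)
  have hW' := W.comap_valuation_two hW (σ : Ω →+* Ω)
  exact hσ ⟨hF W _ hW hW' _ hc', hF _ W hW' hW _ hc'⟩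

/-- Finitely many elements can be kept out of the extension by the root of `2 r`, for a
suitable `r`. -/
theorem exists_generic_root {F : IntermediateField k Ω} (hF : ValDetermined (F : Set Ω)) {q : ℕ}
    (hq : q.Prime) (hq2 : Odd q) (hG : NoRootOfTwo q (F : Set Ω)) (S : Finset Ω) :
    ∃ r : ℕ, r.Prime ∧ Odd r ∧ ∃ b : Ω, b ^ q = 2 * r ∧ ∀ x ∈ S, x ∈ F⟮b⟯ → x ∈ F := by
  by_contra! hcon
  -- The shift by one skips the prime 2.
  have hprime : ∀ n, (Nat.nth Nat.Prime (n + 1)).Prime := fun n => Nat.prime_nth_prime _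
  have hinj : Function.Injective fun n => Nat.nth Nat.Prime (n + 1) := fun m n h => by
    simpa using Nat.nth_injective Nat.infinite_setOfPred_prime h
  have hodd : ∀ n, Odd (Nat.nth Nat.Prime (n + 1)) := fun n => by
    refine (hprime n).odd_of_ne_two fun h => ?_
    rw [← Nat.nth_prime_zero_eq_two] at h
    have := Nat.nth_injective Nat.infinite_setOfPred_prime h
    omega
  have hb : ∀ n, ∃ b : Ω, b ^ q = 2 * (Nat.nth Nat.Prime (n + 1) : ℕ) := fun n =>
    IsAlgClosed.exists_pow_nat_eq _ hq.pos
  choose b hb using hb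
  choose f hfS hfF hf using fun n => hcon _ (hprime n) (hodd n) (b n) (hb n)
  -- Every odd prime fails because of some element of the finite set `S`, so two different primes
  -- fail because of the same one.
  obtain ⟨m, n, hmn, heq⟩ := Finite.exists_ne_map_eq_of_infinite fun n => (⟨f n, hfS n⟩ : S)
  have heq' : f m = f n := congrArg Subtype.val heq
  -- The degree q is prime, so an element outside F generates the whole extension.
  have hadj : ∀ n, F⟮f n⟯ = F⟮b n⟯ := by
    intro n
    have hle : F⟮f n⟯ ≤ F⟮b n⟯ := adjoin_simple_le_iff.2 (hfF n)
    have hirr := hG.irreducible hq (hodd n)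
    have hmin := minpoly.eq_of_irreducible_of_monic hirr (x := b n) (by
        rw [map_sub, map_pow, aeval_X, aeval_C, hb, map_mul, map_natCast, map_ofNat, sub_self])
      (monic_X_pow_sub_C _ hq.ne_zero)
    have hint : IsIntegral F (b n) := (Algebra.IsAlgebraic.isAlgebraic (b n)).isIntegral
    have hfin : Module.finrank F F⟮b n⟯ = q := by
      rw [adjoin.finrank hint, ← hmin, natDegree_X_pow_sub_C]
    have := adjoin.finiteDimensional hint
    refine eq_of_le_of_finrank_eq hle ?_
    rw [hfin]
    have hdvd : Module.finrank F F⟮f n⟯ ∣ q := hfin ▸ finrank_dvd_of_le_right hle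
    refine ((Nat.dvd_prime hq).1 hdvd).resolve_left fun h1 => ?_
    obtain ⟨z, hz⟩ := mem_bot.1 (finrank_adjoin_simple_eq_one_iff.1 h1)
    exact hf n (hz ▸ z.2)
  have hbm : b m ∈ F⟮b n⟯ := by
    rw [← hadj n, ← heq', hadj m]; exact mem_adjoin_simple_self _ _
  have hbn : b n ∈ F⟮b n⟯ := mem_adjoin_simple_self _ _
  -- The two extensions coincide and contain b_m / b_n, a q-th root of a quotient of distinct odd
  -- primes. This is impossible, as the valuation is still determined there.
  have hU := hF.adjoin_root hq (hodd n) hG (hb n)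
  refine ValDetermined.pow_mul_ne (F := F⟮b n⟯.restrictScalars k) hU hq hq2 (hprime m) (hodd m)
    (hodd n) (fun h => ?_) (F⟮b n⟯.div_mem hbm hbn) ?_
  · exact hmn (hinj (((Nat.prime_dvd_prime_iff_eq (hprime m) (hprime n)).1 h)))
  · have h0 : ((Nat.nth Nat.Prime (n + 1) : ℕ) : Ω) ≠ 0 := by exact_mod_cast (hprime n).ne_zero
    rw [div_pow, hb m, hb n]
    field_simp

end Step

theorem computablePred_prime : ComputablePred Nat.Prime := by
  have h : ComputablePred fun p : ℕ => 2 ≤ p ∧ ∀ m < p, p % m = 0 → m = 1 := by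
    refine (ComputablePred.le' (by fun_prop) (by fun_prop)).and' ?_
    refine ComputablePred.forall_lt (p := fun p m => p % m = 0 → m = 1) (by fun_prop) ?_
    exact (ComputablePred.eq' (by fun_prop) (by fun_prop)).imp'
      (ComputablePred.eq' (by fun_prop) (by fun_prop))
  exact h.of_eq fun p => by simp only [Nat.prime_def_lt, Nat.dvd_iff_mod_eq_zero]

theorem computablePred_odd : ComputablePred fun n : ℕ => Odd n :=
  (ComputablePred.eq' (f := fun n : ℕ => n % 2) (g := fun _ => 1) (by fun_prop)
    (by fun_prop)).of_eq fun n => Nat.odd_iff.symm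

theorem exists_computable_oddPrimes : ∃ q : ℕ → ℕ, Computable q ∧ Function.Injective q ∧
    ∀ n, (q n).Prime ∧ Odd (q n) := by
  obtain ⟨q, hq, -, h⟩ := REPred.exists_sequence (R := fun _ p p' => p + 1 ≤ p' ∧ p'.Prime)
    (fun _ p => p.Prime ∧ 3 ≤ p) (x₀ := 3)
    ((ComputablePred.le' (by fun_prop) (by fun_prop)).and'
      (computablePred_prime.comp' (by fun_prop))).to_re ⟨Nat.prime_three, le_rfl⟩
    (fun _ p _ => Nat.exists_infinite_primes (p + 1))
    (fun _ p p' hp h => ⟨h.2, by omega⟩)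
  refine ⟨q, hq, (strictMono_nat_of_lt_succ fun n => (h n).2.1).injective, fun n => ?_⟩
  exact ⟨(h n).1.1, (h n).1.1.odd_of_ne_two (by have := (h n).1.2; omega)⟩

theorem adjoin_add_mul_le {k Ω : Type*} [Field k] [Field Ω] [Algebra k Ω] {x b : Ω} (j : ℕ) :
    (k⟮x + j * b⟯ : Set Ω) ⊆ ((k⟮x⟯)⟮b⟯ : IntermediateField k⟮x⟯ Ω) := by
  have hx : x ∈ ((k⟮x⟯)⟮b⟯ : IntermediateField k⟮x⟯ Ω) :=
    IntermediateField.algebraMap_mem _ (⟨x, mem_adjoin_simple_self k x⟩ : k⟮x⟯)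
  have : k⟮x + j * b⟯ ≤ ((k⟮x⟯)⟮b⟯).restrictScalars k := by
    rw [adjoin_simple_le_iff, IntermediateField.mem_restrictScalars]
    exact add_mem hx (mul_mem (_root_.natCast_mem _ j) (mem_adjoin_simple_self _ b))
  exact this

/-! ### The decidable field K -/

section Construction

variable (k : Type*) [Field k] {Ω : Type*} [Field Ω] [Algebra k Ω] (φ : ℕ → Ω)

/-- `β'` generates the extension of `k(β)` by a `q`-th root of `2 r`, for an odd prime `r`, and none
of the first `s + 1` elements belongs to this extension unless it belongs to `k(β)`. -/
def GenericStep (q s β β' : ℕ) : Prop :=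
  ∃ r m j : ℕ, r.Prime ∧ Odd r ∧ φ m ^ q = 2 * r ∧ φ β' = φ β + j * φ m ∧
    φ β ∈ k⟮φ β'⟯ ∧ φ m ∈ k⟮φ β'⟯ ∧ ∀ i < s + 1, φ i ∈ k⟮φ β'⟯ → φ i ∈ k⟮φ β⟯

variable {φ} [CharZero k] [IsFractionRing ℤ k] [Algebra.IsAlgebraic k Ω]

theorem rePred_genericStep (hφ : ComputableEnum φ) {α : Type*} [Primcodable α]
    {q s β β' : α → ℕ} (hq : Computable q) (hs : Computable s) (hβ : Computable β)
    (hβ' : Computable β') : REPred fun a => GenericStep k φ (q a) (s a) (β a) (β' a) := by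
  have h : REPred fun a => ∃ x : ℕ × ℕ × ℕ, x.1.Prime ∧ Odd x.1 ∧ φ x.2.1 ^ q a = 2 * x.1 ∧
      φ (β' a) = φ (β a) + (x.2.2 : ℕ) * φ x.2.1 ∧ φ (β a) ∈ k⟮φ (β' a)⟯ ∧
      φ x.2.1 ∈ k⟮φ (β' a)⟯ ∧ ∀ i < s a + 1, φ i ∈ k⟮φ (β' a)⟯ → φ i ∈ k⟮φ (β a)⟯ := by
    refine REPred.exists' (p := fun a (x : ℕ × ℕ × ℕ) => x.1.Prime ∧ Odd x.1 ∧
      φ x.2.1 ^ q a = 2 * x.1 ∧ φ (β' a) = φ (β a) + (x.2.2 : ℕ) * φ x.2.1 ∧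
      φ (β a) ∈ k⟮φ (β' a)⟯ ∧ φ x.2.1 ∈ k⟮φ (β' a)⟯ ∧
      ∀ i < s a + 1, φ i ∈ k⟮φ (β' a)⟯ → φ i ∈ k⟮φ (β a)⟯) ?_
    refine ((computablePred_prime.comp' (by fun_prop)).and' ((computablePred_odd.comp'
      (by fun_prop)).and' (ComputablePred.and' ?_ (ComputablePred.and' ?_ (ComputablePred.and' ?_
      (ComputablePred.and' ?_ ?_)))))).to_re
    · exact hφ.computablePred_eq (hφ.via_pow (.apply (by fun_prop)) (by fun_prop))
        (hφ.via_mul (hφ.via_const 2) (hφ.via_natCast (by fun_prop)))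
    · exact hφ.computablePred_eq (.apply (by fun_prop)) (hφ.via_add (.apply (by fun_prop))
        (hφ.via_mul (hφ.via_natCast (by fun_prop)) (.apply (by fun_prop))))
    · exact hφ.computablePred_mem_adjoin k (.apply (by fun_prop)) (.apply (by fun_prop))
    · exact hφ.computablePred_mem_adjoin k (.apply (by fun_prop)) (.apply (by fun_prop))
    · refine ComputablePred.forall_lt (N := fun a : α × ℕ × ℕ × ℕ => s a.1 + 1)
        (p := fun a i => φ i ∈ k⟮φ (β' a.1)⟯ → φ i ∈ k⟮φ (β a.1)⟯) (by fun_prop) ?_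
      exact (hφ.computablePred_mem_adjoin k (.apply (by fun_prop)) (.apply (by fun_prop))).imp'
        (hφ.computablePred_mem_adjoin k (.apply (by fun_prop)) (.apply (by fun_prop)))
  exact h.of_eq fun a => ⟨fun ⟨⟨r, m, j⟩, h⟩ => ⟨r, m, j, h⟩, fun ⟨r, m, j, h⟩ => ⟨⟨r, m, j⟩, h⟩⟩

variable {k}

theorem GenericStep.valDetermined [CharZero Ω] {q s β β' : ℕ} (h : GenericStep k φ q s β β')
    (hq : q.Prime) (hF : ValDetermined (k⟮φ β⟯ : Set Ω)) (hG : NoRootOfTwo q (k⟮φ β⟯ : Set Ω)) :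
    ValDetermined (k⟮φ β'⟯ : Set Ω) := by
  obtain ⟨r, m, j, hr, hr2, hm, hβ', -⟩ := h
  have hU := hF.adjoin_root hq hr2 hG hm
  intro W W' hW hW' x hx
  rw [hβ'] at hx
  exact hU W W' hW hW' x (adjoin_add_mul_le j hx)

theorem GenericStep.noRootOfTwo [CharZero Ω] {q q' s β β' : ℕ} (h : GenericStep k φ q s β β')
    (hq : q.Prime) (hq' : q'.Prime) (hqq' : q ≠ q') (hG : NoRootOfTwo q (k⟮φ β⟯ : Set Ω))
    (hG' : NoRootOfTwo q' (k⟮φ β⟯ : Set Ω)) : NoRootOfTwo q' (k⟮φ β'⟯ : Set Ω) := by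
  obtain ⟨r, m, j, hr, hr2, hm, hβ', -⟩ := h
  have hU := hG.adjoin_root hq hq' hqq' hr2 hG' hm
  intro W hW x hx
  rw [hβ'] at hx
  exact hU W hW x (adjoin_add_mul_le j hx)

theorem exists_genericStep [CharZero Ω] [IsAlgClosed Ω] (hφ : Function.Surjective φ) {q β : ℕ}
    (hq : q.Prime) (hq2 : Odd q) (hF : ValDetermined (k⟮φ β⟯ : Set Ω))
    (hG : NoRootOfTwo q (k⟮φ β⟯ : Set Ω)) (s : ℕ) : ∃ β', GenericStep k φ q s β β' := by
  classical
  obtain ⟨r, hr, hr2, b, hb, h⟩ := exists_generic_root hF hq hq2 hG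
    ((Finset.range (s + 1)).image φ)
  obtain ⟨m, rfl⟩ := hφ b
  obtain ⟨j, h1, h2⟩ := exists_nat_primitive k (φ β) (φ m)
  obtain ⟨β', hβ'⟩ := hφ (φ β + j * φ m)
  refine ⟨β', r, m, j, hr, hr2, hb, hβ', hβ' ▸ h1, hβ' ▸ h2, fun i hi hx => ?_⟩
  rw [hβ'] at hx
  exact h _ (Finset.mem_image_of_mem φ (Finset.mem_range.2 hi)) (adjoin_add_mul_le j hx)

variable (k) in
/-- There is a decidable algebraic extension of `k`, in which the valuation over `2` is determined,
and which contains a `q n`-th root of an odd multiple of `2` exactly for the elements `n` of a given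
c.e. set. -/
theorem exists_decidable_field [CharZero Ω] [IsAlgClosed Ω] (hφ : ComputableEnum φ) {q : ℕ → ℕ}
    (hq : Computable q) (hinj : Function.Injective q) (hprime : ∀ n, (q n).Prime ∧ Odd (q n))
    {p : ℕ → Prop} (hp : REPred p) :
    ∃ K : IntermediateField k Ω, (ComputablePred fun n => φ n ∈ K) ∧ ValDetermined (K : Set Ω) ∧
      (∀ n, ¬ p n → NoRootOfTwo (q n) (K : Set Ω)) ∧
      ∀ n, p n → ∃ r : ℕ, r.Prime ∧ Odd r ∧ ∃ b ∈ K, b ^ q n = 2 * r := by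
  obtain ⟨f, hf, -, hpf⟩ := hp.exists_stages
  -- The first stage at which n is seen in the set. Step s of the construction treats the pair (n,
  -- t) coded by s, so it acts at most once for each n.
  let Enters : ℕ → ℕ → Prop := fun n t => f n t = true ∧ ∀ t' < t, ¬ f n t' = true
  have hEnt : ComputablePred fun s : ℕ => Enters s.unpair.1 s.unpair.2 := by
    refine (ComputablePred.eq' (by fun_prop) (by fun_prop)).and' ?_
    exact ComputablePred.forall_lt (N := fun s : ℕ => s.unpair.2)
      (p := fun s t' => ¬ f s.unpair.1 t' = true) (by fun_prop)
      (ComputablePred.eq' (by fun_prop) (by fun_prop)).not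
  have hEntU : ∀ n t t', Enters n t → Enters n t' → t = t' := by
    intro n t t' h h'
    rcases lt_trichotomy t t' with hlt | heq | hlt
    · exact absurd h.1 (h'.2 t hlt)
    · exact heq
    · exact absurd h'.1 (h.2 t' hlt)
  obtain ⟨z, hz⟩ := hφ.surjective 0
  have hz' : k⟮φ z⟯ = ⊥ := by rw [hz, adjoin_zero]
  let R : ℕ → ℕ → ℕ → Prop := fun s x y : ℕ => (¬ Enters s.unpair.1 s.unpair.2 ∧ y = x) ∨
    (Enters s.unpair.1 s.unpair.2 ∧ GenericStep k φ (q s.unpair.1) s x y)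
  -- The valuation is determined, and the primes not yet used still have no root of the value of 2;
  -- the latter allows a later step for them.
  let Inv : ℕ → ℕ → Prop := fun s x => ValDetermined (k⟮φ x⟯ : Set Ω) ∧ ∀ n,
    (∀ s' < s, s'.unpair.1 = n → ¬ Enters n s'.unpair.2) → NoRootOfTwo (q n) (k⟮φ x⟯ : Set Ω)
  have hR : REPred fun x : ℕ × ℕ × ℕ => R x.1 x.2.1 x.2.2 := by
    have hE : ComputablePred fun x : ℕ × ℕ × ℕ => Enters x.1.unpair.1 x.1.unpair.2 :=
      hEnt.comp' (f := fun x : ℕ × ℕ × ℕ => x.1) (by fun_prop)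
    have heq : ComputablePred fun x : ℕ × ℕ × ℕ => x.2.2 = x.2.1 :=
      ComputablePred.eq' (by fun_prop) (by fun_prop)
    exact (hE.not.and' heq).to_re.or' (hE.to_re.and'
      (rePred_genericStep k hφ (by fun_prop) (by fun_prop) (by fun_prop) (by fun_prop)))
  have hInv₀ : Inv 0 z := by
    simp only [Inv]
    rw [hz']
    exact ⟨valDetermined_bot k, fun n _ => noRootOfTwo_bot k (hprime n).1.two_le⟩
  have hnext : ∀ s x, Inv s x → ∃ y, R s x y := by
    rintro s x ⟨h1, h2⟩
    by_cases hE : Enters s.unpair.1 s.unpair.2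
    -- No earlier step has used this prime: the entry time of n is unique, so such a step would code
    -- the same pair as s.
    · obtain ⟨y, hy⟩ := exists_genericStep hφ.surjective (hprime s.unpair.1).1 (hprime _).2 h1
        (h2 _ fun s' hs' hn hE' => by
          have := hEntU _ _ _ hE hE'
          rw [← Nat.pair_unpair s, this, ← hn, Nat.pair_unpair s'] at hs'
          exact lt_irrefl _ hs') s
      exact ⟨y, Or.inr ⟨hE, hy⟩⟩
    · exact ⟨x, Or.inl ⟨hE, rfl⟩⟩
  have hInv : ∀ s x y, Inv s x → R s x y → Inv (s + 1) y := by
    rintro s x y ⟨h1, h2⟩ (⟨hE, rfl⟩ | ⟨hE, hy⟩)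
    · exact ⟨h1, fun n hn => h2 n fun s' hs' => hn s' (by omega)⟩
    · have hG := h2 s.unpair.1 fun s' hs' hn hE' => by
        have := hEntU _ _ _ hE hE'
        rw [← Nat.pair_unpair s, this, ← hn, Nat.pair_unpair s'] at hs'
        exact lt_irrefl _ hs'
      refine ⟨hy.valDetermined (hprime _).1 h1 hG, fun n hn => ?_⟩
      refine hy.noRootOfTwo (hprime _).1 (hprime n).1 (fun heq => ?_) hG
        (h2 n fun s' hs' => hn s' (by omega))
      have heq' := hinj heq
      exact hn s (by omega) heq' (heq' ▸ hE)
  obtain ⟨β, hβ, -, h⟩ := REPred.exists_sequence Inv hR hInv₀ hnext hInv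
  have hstep : ∀ s, k⟮φ (β s)⟯ ≤ k⟮φ (β (s + 1))⟯ := by
    intro s
    rcases (h s).2 with ⟨-, hs⟩ | ⟨-, r, m, j, -, -, -, -, hm, -⟩
    · rw [hs]
    · exact adjoin_simple_le_iff.2 hm
  have hmono : Monotone fun s => k⟮φ (β s)⟯ := monotone_nat_of_le_succ hstep
  -- From step i on, the i-th element is protected, so its membership no longer changes.
  have hgen : ∀ i s, i ≤ s → φ i ∈ k⟮φ (β (s + 1))⟯ → φ i ∈ k⟮φ (β s)⟯ := by
    intro i s his hi
    rcases (h s).2 with ⟨-, hs⟩ | ⟨-, r, m, j, -, -, -, -, -, -, hs⟩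
    · rwa [hs] at hi
    · exact hs i (by omega) hi
  have hmem : ∀ x, x ∈ (⨆ s, k⟮φ (β s)⟯) ↔ ∃ s, x ∈ k⟮φ (β s)⟯ := fun x => by
    rw [← SetLike.mem_coe, coe_iSup_of_directed hmono.directed_le, Set.mem_iUnion]
    rfl
  refine ⟨⨆ s, k⟮φ (β s)⟯, ?_, ?_, ?_, ?_⟩
  -- To decide whether the i-th element is in K it suffices to look at the i-th field of the chain.
  · refine (hφ.computablePred_mem_adjoin k (f := fun i => φ i) (g := fun i => φ (β i))
      (.apply (by fun_prop)) (.apply (by fun_prop))).of_eq fun i => ?_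
    rw [hmem]
    refine ⟨fun hi => ⟨i, hi⟩, fun ⟨s, hs⟩ => ?_⟩
    rcases le_total s i with hsi | his
    · exact hmono hsi hs
    · induction s, his using Nat.le_induction with
      | base => exact hs
      | succ s his ih => exact ih (hgen i s his hs)
  · intro W W' hW hW' x hx
    obtain ⟨s, hs⟩ := (hmem x).1 hx
    exact (h s).1.1 W W' hW hW' x hs
  · intro n hn W hW x hx
    obtain ⟨s, hs⟩ := (hmem x).1 hx
    exact (h s).1.2 n (fun s' _ _ hE => hn ((hpf n).2 ⟨_, hE.1⟩)) W hW x hs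
  · intro n hn
    have hex := (hpf n).1 hn
    classical
    have hE : Enters n (Nat.find hex) := ⟨Nat.find_spec hex, fun t' ht' => Nat.find_min hex ht'⟩
    have hs := (h (Nat.pair n (Nat.find hex))).2
    simp only [R, Nat.unpair_pair] at hs
    rcases hs with ⟨hs, -⟩ | ⟨-, r, m, j, hr, hr2, hm, -, -, hmem', -⟩
    · exact absurd hE hs
    · exact ⟨r, hr, hr2, φ m, (hmem _).2 ⟨_, hmem'⟩, hm⟩

end Construction

/-! ### Polynomials compared through their values at natural numbers -/

section PolyOfList

variable {A : Type} [Field A]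

theorem eval_polyOfList (x : A) (l : List A) :
    eval x (polyOfList l) = l.foldr (fun a r => a + x * r) 0 := by
  induction l with
  | nil => simp [polyOfList]
  | cons a l ih => simp [polyOfList, ih]

theorem coeff_polyOfList (l : List A) (n : ℕ) : (polyOfList l).coeff n = l.getD n 0 := by
  induction l generalizing n with
  | nil => simp [polyOfList]
  | cons a l ih =>
    cases n with
    | zero => simp [polyOfList]
    | succ n => simp [polyOfList, ih]

theorem degree_polyOfList_lt (l : List A) : (polyOfList l).degree < l.length := by
  rw [degree_lt_iff_coeff_zero]
  intro m hm
  rw [coeff_polyOfList, List.getD_eq_default _ _ hm]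

theorem exists_polyOfList (p : A[X]) : ∃ l : List A, polyOfList l = p := by
  refine ⟨(List.range (p.natDegree + 1)).map p.coeff, ?_⟩
  ext n
  rw [coeff_polyOfList]
  by_cases hn : n < p.natDegree + 1
  · simp [List.getD_eq_getElem?_getD, hn]
  · rw [List.getD_eq_default _ _ (by simp; omega), coeff_eq_zero_of_natDegree_lt (by omega)]

theorem polyOfList_map {B : Type} [Field B] (f : A →+* B) (l : List A) :
    polyOfList (l.map f) = (polyOfList l).map f := by
  induction l with
  | nil => simp [polyOfList]
  | cons a l ih => simp [polyOfList, ih]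

/-- In characteristic zero the naturals below `N` are distinct points, so testing values replaces
the computation of coefficients in products. -/
theorem eq_of_eval_natCast_eq [CharZero A] {p q : A[X]} {N : ℕ} (hp : p.degree < N)
    (hq : q.degree < N) (h : ∀ j < N, eval (j : A) p = eval (j : A) q) : p = q :=
  eq_of_degrees_lt_of_eval_index_eq (Finset.range N) (v := fun j : ℕ => (j : A))
    (fun _ _ _ _ h => Nat.cast_injective h) (by simpa using hp) (by simpa using hq)
    fun j hj => h j (Finset.mem_range.1 hj)

theorem natDegree_pos_iff_exists_eval_ne [CharZero A] (p : A[X]) :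
    0 < p.natDegree ↔ ∃ j : ℕ, eval (j : A) p ≠ eval 0 p := by
  constructor
  · intro h
    by_contra! hcon
    have : p = C (eval 0 p) := by
      refine eq_of_eval_natCast_eq (N := p.natDegree + 1) ?_ ?_ fun j _ => by simp [hcon]
      · exact (degree_le_natDegree).trans_lt (by exact_mod_cast Nat.lt_succ_self _)
      · exact degree_C_le.trans_lt (by exact_mod_cast Nat.succ_pos _)
    rw [this, natDegree_C] at h
    exact lt_irrefl _ h
  · rintro ⟨j, hj⟩
    by_contra! h
    rw [eq_C_of_natDegree_eq_zero (Nat.le_zero.1 h)] at hj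
    simp at hj

/-- A polynomial with values in a subfield at the natural numbers has coefficients there. -/
theorem exists_map_eq_of_eval_natCast_mem {K : Type} [Field K] [CharZero K] [CharZero A]
    [Algebra K A] (p : A[X]) (h : ∀ j : ℕ, ∃ x : K, algebraMap K A x = eval (j : A) p) :
    ∃ f : K[X], f.map (algebraMap K A) = p := by
  choose x hx using h
  have hinj : Set.InjOn (fun j : ℕ => (j : K)) (Finset.range (p.natDegree + 1)) :=
    fun _ _ _ _ h => Nat.cast_injective h
  refine ⟨Lagrange.interpolate (Finset.range (p.natDegree + 1)) (fun j : ℕ => (j : K)) x, ?_⟩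
  refine eq_of_eval_natCast_eq (N := p.natDegree + 1) ?_ ?_ fun j hj => ?_
  · rw [degree_map]
    simpa using Lagrange.degree_interpolate_lt x hinj
  · exact (degree_le_natDegree).trans_lt (by exact_mod_cast Nat.lt_succ_self _)
  · rw [← hx, ← map_natCast (algebraMap K A), eval_map_apply,
      Lagrange.eval_interpolate_at_node x hinj (Finset.mem_range.2 hj)]

end PolyOfList

namespace ComputableEnum

variable {α β A : Type} [Primcodable α] [Primcodable β] [Field A] {φ : ℕ → A}

theorem via_eval_polyOfList (hφ : ComputableEnum φ) {u : ℕ → A} {l : α → List ℕ} {j : α → ℕ}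
    (hu : ComputableVia φ u) (hl : Computable l) (hj : Computable j) :
    ComputableVia φ fun a => eval (j a : A) (polyOfList ((l a).map u)) := by
  simp only [eval_polyOfList, List.foldr_map]
  exact .foldr hl (hφ.via_const 0) (hφ.via_add (hu.comp (by fun_prop))
    (hφ.via_mul (hφ.via_natCast (by fun_prop)) (.apply (by fun_prop))))

theorem exists_polyOfList_map (hφ : ComputableEnum φ) (p : A[X]) :
    ∃ l : List ℕ, polyOfList (l.map φ) = p := by
  obtain ⟨l, rfl⟩ := exists_polyOfList p
  obtain ⟨l', rfl⟩ := (List.map_surjective_iff.2 hφ.surjective) l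
  exact ⟨l', rfl⟩

/-- Non-constancy and the factorization are expressed by values. The sum of the lengths bounds the
degrees on both sides, so agreement at that many points is enough. -/
theorem isReduciblePoly_iff [CharZero A] (hφ : ComputableEnum φ) (l : List ℕ) :
    IsReduciblePoly (polyOfList (l.map φ)) ↔ ∃ x : (List ℕ × ℕ) × (List ℕ × ℕ),
      eval (x.1.2 : A) (polyOfList (x.1.1.map φ)) ≠ eval ((0 : ℕ) : A) (polyOfList (x.1.1.map φ)) ∧
      eval (x.2.2 : A) (polyOfList (x.2.1.map φ)) ≠ eval ((0 : ℕ) : A) (polyOfList (x.2.1.map φ)) ∧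
      ∀ j < l.length + (x.1.1.length + x.2.1.length), eval (j : A) (polyOfList (l.map φ)) =
        eval (j : A) (polyOfList (x.1.1.map φ)) * eval (j : A) (polyOfList (x.2.1.map φ)) := by
  simp only [Nat.cast_zero]
  constructor
  · rintro ⟨f, g, hf, hg, h⟩
    obtain ⟨l₁, rfl⟩ := hφ.exists_polyOfList_map f
    obtain ⟨l₂, rfl⟩ := hφ.exists_polyOfList_map g
    obtain ⟨j₁, h₁⟩ := (natDegree_pos_iff_exists_eval_ne _).1 hf
    obtain ⟨j₂, h₂⟩ := (natDegree_pos_iff_exists_eval_ne _).1 hg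
    exact ⟨((l₁, j₁), (l₂, j₂)), h₁, h₂, fun j _ => by rw [h, eval_mul]⟩
  · rintro ⟨⟨⟨l₁, j₁⟩, ⟨l₂, j₂⟩⟩, h₁, h₂, h⟩
    refine ⟨_, _, (natDegree_pos_iff_exists_eval_ne _).2 ⟨_, h₁⟩,
      (natDegree_pos_iff_exists_eval_ne _).2 ⟨_, h₂⟩, ?_⟩
    have hd : ∀ l : List ℕ, (polyOfList (l.map φ)).degree < (l.length : ℕ) := fun l => by
      simpa using degree_polyOfList_lt (l.map φ)
    refine eq_of_eval_natCast_eq (N := l.length + (l₁.length + l₂.length)) ?_ ?_ fun j hj => by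
      rw [eval_mul]; exact h j hj
    · exact (hd l).trans_le (by exact_mod_cast Nat.le_add_right _ _)
    · rw [degree_mul]
      have h3 : (polyOfList (l₁.map φ)).degree + (polyOfList (l₂.map φ)).degree ≤
          ((l₁.length : ℕ) : WithBot ℕ) + (polyOfList (l₂.map φ)).degree := by
        gcongr; exact (hd l₁).le
      refine h3.trans_lt ?_
      have h4 : ((l₁.length : ℕ) : WithBot ℕ) + (polyOfList (l₂.map φ)).degree <
          ((l₁.length : ℕ) : WithBot ℕ) + (l₂.length : ℕ) :=
        WithBot.add_lt_add_left (by simp) (hd l₂)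
      refine h4.trans_le ?_
      exact_mod_cast Nat.le_add_left _ _

theorem rePred_isReduciblePoly [CharZero A] (hφ : ComputableEnum φ) :
    REPred fun l : List ℕ => IsReduciblePoly (polyOfList (l.map φ)) := by
  refine REPred.of_eq ?_ fun l => (hφ.isReduciblePoly_iff l).symm
  refine REPred.exists' (p := fun (l : List ℕ) (x : (List ℕ × ℕ) × (List ℕ × ℕ)) =>
    eval (x.1.2 : A) (polyOfList (x.1.1.map φ)) ≠ eval ((0 : ℕ) : A) (polyOfList (x.1.1.map φ)) ∧
    eval (x.2.2 : A) (polyOfList (x.2.1.map φ)) ≠ eval ((0 : ℕ) : A) (polyOfList (x.2.1.map φ)) ∧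
    ∀ j < l.length + (x.1.1.length + x.2.1.length), eval (j : A) (polyOfList (l.map φ)) =
      eval (j : A) (polyOfList (x.1.1.map φ)) * eval (j : A) (polyOfList (x.2.1.map φ))) ?_
  have hid : ComputableVia φ φ := .apply (f := fun n => n) (by fun_prop)
  refine (ComputablePred.and' ?_ (ComputablePred.and' ?_ ?_)).to_re
  · exact (hφ.computablePred_eq (hφ.via_eval_polyOfList hid (by fun_prop) (by fun_prop))
      (hφ.via_eval_polyOfList hid (by fun_prop) (by fun_prop))).not
  · exact (hφ.computablePred_eq (hφ.via_eval_polyOfList hid (by fun_prop) (by fun_prop))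
      (hφ.via_eval_polyOfList hid (by fun_prop) (by fun_prop))).not
  · refine ComputablePred.forall_lt
      (N := fun x : List ℕ × (List ℕ × ℕ) × (List ℕ × ℕ) =>
        x.1.length + (x.2.1.1.length + x.2.2.1.length))
      (p := fun x j => eval (j : A) (polyOfList (x.1.map φ)) =
        eval (j : A) (polyOfList (x.2.1.1.map φ)) * eval (j : A) (polyOfList (x.2.2.1.map φ)))
      (by fun_prop) ?_
    exact hφ.computablePred_eq (hφ.via_eval_polyOfList hid (by fun_prop) (by fun_prop))
      (hφ.via_mul (hφ.via_eval_polyOfList hid (by fun_prop) (by fun_prop))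
        (hφ.via_eval_polyOfList hid (by fun_prop) (by fun_prop)))

end ComputableEnum

/-! ### Polynomials given by lists of roots -/

section RootList

variable {Ω : Type} [Field Ω] (φ : ℕ → Ω)

/-- The monic polynomial with the listed roots. -/
noncomputable def rootPoly (S : List ℕ) : Polynomial Ω := (S.map fun n => X - C (φ n)).prod

theorem eval_rootPoly (x : Ω) (S : List ℕ) :
    eval x (rootPoly φ S) = S.foldr (fun n r => (x - φ n) * r) 1 := by
  induction S with
  | nil => simp [rootPoly]
  | cons n S ih =>
    rw [rootPoly] at ih
    simp [rootPoly, ih]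

theorem natDegree_rootPoly (S : List ℕ) : (rootPoly φ S).natDegree = S.length := by
  have := natDegree_multiset_prod_X_sub_C_eq_card (Multiset.ofList (S.map φ))
  simpa [rootPoly, Function.comp_def] using this

theorem monic_rootPoly (S : List ℕ) : (rootPoly φ S).Monic := by
  have := monic_multisetProd_X_sub_C (Multiset.ofList (S.map φ))
  simpa [rootPoly, Function.comp_def] using this

theorem isRoot_rootPoly {S : List ℕ} {x : Ω} :
    IsRoot (rootPoly φ S) x ↔ ∃ n ∈ S, φ n = x := by
  rw [IsRoot, rootPoly, eval_list_prod, List.prod_eq_zero_iff]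
  simp [sub_eq_zero, eq_comm]

/-- The set `T` records where the root indices come from: all indices for a polynomial, or the roots
of a multiple for a factor of it. -/
theorem exists_rootPoly_eq [IsAlgClosed Ω] {φ : ℕ → Ω} {T : Set ℕ} {p : Polynomial Ω}
    (h : ∀ x, IsRoot p x → ∃ n ∈ T, φ n = x) (hp : p ≠ 0) :
    ∃ S : List ℕ, (∀ n ∈ S, n ∈ T) ∧ p = C p.leadingCoeff * rootPoly φ S := by
  have key : ∀ L : List Ω, (∀ x ∈ L, ∃ n ∈ T, φ n = x) →
      ∃ S : List ℕ, (∀ n ∈ S, n ∈ T) ∧ S.map φ = L := by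
    intro L hL
    induction L with
    | nil => exact ⟨[], by simp, rfl⟩
    | cons x L ih =>
      obtain ⟨S, h1, h2⟩ := ih fun y hy => hL y (by simp [hy])
      obtain ⟨n, hn, hx⟩ := hL x (by simp)
      exact ⟨n :: S, by simpa using ⟨hn, h1⟩, by simp [hx, h2]⟩
  obtain ⟨S, h1, h2⟩ := key p.roots.toList fun x hx =>
    h x ((mem_roots hp).1 (Multiset.mem_toList.1 hx))
  refine ⟨S, h1, ?_⟩
  have h3 := (IsAlgClosed.splits p).eq_prod_roots
  have h4 : (p.roots.map fun x => X - C x).prod = rootPoly φ S := by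
    have : p.roots = Multiset.ofList (S.map φ) := by rw [h2, Multiset.coe_toList]
    rw [this, rootPoly]
    simp [Function.comp_def]
  rwa [h4] at h3

end RootList

/-! ### The splitting algorithm of a decidable subfield -/

section Splitting

variable {K Ω : Type} [Field K] [Field Ω] [CharZero K] [CharZero Ω] [Algebra K Ω] [IsAlgClosed Ω]
  {φ : ℕ → Ω} {ψ : ℕ → K}

theorem irreducible_of_not_isReduciblePoly {K : Type} [Field K] {p : K[X]} (hp : 0 < p.natDegree)
    (h : ¬ IsReduciblePoly p) : Irreducible p := by
  have hp0 : p ≠ 0 := by rintro rfl; simp at hp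
  refine ⟨fun hu => ?_, fun {f g} hfg => ?_⟩
  · rw [natDegree_eq_zero_of_isUnit hu] at hp
    exact lt_irrefl _ hp
  · have hf0 : f ≠ 0 := by rintro rfl; simp at hfg; exact hp0 hfg
    have hg0 : g ≠ 0 := by rintro rfl; simp at hfg; exact hp0 hfg
    by_contra! hcon
    refine h ⟨f, g, ?_, ?_, hfg⟩
    · refine Nat.pos_of_ne_zero fun h0 => hcon.1 ?_
      exact isUnit_iff_degree_eq_zero.2 (by rw [degree_eq_natDegree hf0, h0]; rfl)
    · refine Nat.pos_of_ne_zero fun h0 => hcon.2 ?_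
      exact isUnit_iff_degree_eq_zero.2 (by rw [degree_eq_natDegree hg0, h0]; rfl)

/-- A polynomial is not reducible iff no tuple of its roots forms a factor over `K`. -/
theorem not_isReduciblePoly_iff (hφ : Function.Surjective φ) (l : List ℕ) :
    ¬ IsReduciblePoly (polyOfList (l.map ψ)) ↔ ∃ x : ℕ × List ℕ,
      (∀ j < l.length + (x.2.length + 1),
        eval (j : Ω) (polyOfList (l.map fun n => algebraMap K Ω (ψ n))) =
          φ x.1 * eval (j : Ω) (rootPoly φ x.2)) ∧
      (φ x.1 = 0 ∨ ∀ m < x.2.length, ∀ S ∈ tuples x.2 m, S.length = 0 ∨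
        ∃ i : ℕ, eval (i : Ω) (rootPoly φ S) ∉ Set.range (algebraMap K Ω)) := by
  set p := polyOfList (l.map ψ) with hp
  have hP : polyOfList (l.map fun n => algebraMap K Ω (ψ n)) = p.map (algebraMap K Ω) := by
    rw [hp, ← polyOfList_map, List.map_map]; rfl
  rw [hP]
  have hmap0 : p ≠ 0 → p.map (algebraMap K Ω) ≠ 0 := fun h =>
    (Polynomial.map_ne_zero_iff (algebraMap K Ω).injective).2 h
  constructor
  · intro hred
    -- The zero polynomial is not a product of two non-constant ones; it is certified by a zero
    -- leading coefficient.
    by_cases hp0 : p = 0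
    · obtain ⟨a, ha⟩ := hφ 0
      exact ⟨(a, []), fun j _ => by simp [hp0, ha], Or.inl ha⟩
    obtain ⟨ρ, -, hρ⟩ := exists_rootPoly_eq (φ := φ) (T := Set.univ)
      (fun x _ => (hφ x).imp fun n hn => ⟨trivial, hn⟩) (hmap0 hp0)
    obtain ⟨a, ha⟩ := hφ (p.map (algebraMap K Ω)).leadingCoeff
    refine ⟨(a, ρ), fun j _ => ?_, Or.inr fun m hm S hS => ?_⟩
    · conv_lhs => rw [hρ]
      rw [eval_mul, eval_C, ha]
    · obtain ⟨hSm, hSρ⟩ := mem_tuples.1 hS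
      change m < ρ.length at hm
      by_contra! hcon
      obtain ⟨hS0, hcon⟩ := hcon
      have hdeg : p.natDegree = ρ.length := by
        rw [← natDegree_map_eq_of_injective (algebraMap K Ω).injective, hρ,
          natDegree_C_mul (leadingCoeff_ne_zero.2 (hmap0 hp0)), natDegree_rootPoly]
      obtain ⟨f, hf⟩ := exists_map_eq_of_eval_natCast_mem (K := K) (rootPoly φ S)
        fun j => hcon j
      have hfdeg : f.natDegree = m := by
        rw [← natDegree_map_eq_of_injective (algebraMap K Ω).injective, hf, natDegree_rootPoly, hSm]
      have hf0 : f ≠ 0 := by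
        rintro rfl
        rw [Polynomial.map_zero] at hf
        exact (monic_rootPoly φ S).ne_zero hf.symm
      have hirr := irreducible_of_not_isReduciblePoly (by omega) hred
      obtain ⟨n, hn⟩ := List.exists_mem_of_length_pos (Nat.pos_of_ne_zero hS0)
      have h1 : aeval (φ n) f = 0 := by
        rw [← eval_map_algebraMap, hf]; exact (isRoot_rootPoly φ).2 ⟨n, hn, rfl⟩
      have h2 : aeval (φ n) p = 0 := by
        rw [← eval_map_algebraMap, hρ, eval_mul,
          show eval (φ n) (rootPoly φ ρ) = 0 from (isRoot_rootPoly φ).2 ⟨n, hSρ n hn, rfl⟩, mul_zero]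
      -- Tuples may repeat roots, so `f` need not divide `p`. It shares a root with the irreducible
      -- `p`, so the two are not coprime and `p` divides `f`, against the degrees.
      rcases (EuclideanDomain.dvd_or_coprime p f hirr).symm with ⟨u, v, huv⟩ | hdvd
      · have := congrArg (aeval (φ n)) huv
        rw [map_add, map_mul, map_mul, h1, h2] at this
        simp at this
      · have := natDegree_le_of_dvd hdvd hf0
        omega
  · rintro ⟨⟨a, ρ⟩, heq, hS⟩ ⟨f, g, hf, hg, hfg⟩
    have hf0 : f ≠ 0 := by rintro rfl; simp at hf
    have hg0 : g ≠ 0 := by rintro rfl; simp at hg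
    have hp0 : p ≠ 0 := hfg ▸ mul_ne_zero hf0 hg0
    have hPeq : p.map (algebraMap K Ω) = C (φ a) * rootPoly φ ρ := by
      refine eq_of_eval_natCast_eq (N := l.length + (ρ.length + 1)) ?_ ?_ fun j hj => by
        rw [eval_mul, eval_C]; exact heq j hj
      · rw [degree_map]
        refine (degree_polyOfList_lt (l.map ψ)).trans_le ?_
        rw [List.length_map]
        exact_mod_cast Nat.le_add_right _ _
      · refine degree_le_natDegree.trans_lt ?_
        have h1 := natDegree_C_mul_le (φ a) (rootPoly φ ρ)
        rw [natDegree_rootPoly] at h1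
        exact_mod_cast (by omega)
    have ha : φ a ≠ 0 := by
      intro h0
      rw [h0, C_0, zero_mul] at hPeq
      exact hmap0 hp0 hPeq
    have hdeg : p.natDegree = ρ.length := by
      rw [← natDegree_map_eq_of_injective (algebraMap K Ω).injective, hPeq,
        natDegree_C_mul ha, natDegree_rootPoly]
    have hfm0 : f.map (algebraMap K Ω) ≠ 0 :=
      (Polynomial.map_ne_zero_iff (algebraMap K Ω).injective).2 hf0
    obtain ⟨S, hSρ, hSf⟩ := exists_rootPoly_eq (φ := φ) (T := {n | n ∈ ρ})
      (p := f.map (algebraMap K Ω)) (fun x hx => by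
        have h1 : IsRoot (C (φ a) * rootPoly φ ρ) x := by
          rw [← hPeq, hfg, Polynomial.map_mul]
          exact root_mul_right_of_isRoot _ hx
        rw [IsRoot, eval_mul, eval_C, mul_eq_zero] at h1
        exact (isRoot_rootPoly φ).1 (h1.resolve_left ha)) hfm0
    have hlc : (f.map (algebraMap K Ω)).leadingCoeff ≠ 0 := leadingCoeff_ne_zero.2 hfm0
    have hSdeg : S.length = f.natDegree := by
      rw [← natDegree_map_eq_of_injective (algebraMap K Ω).injective, hSf, natDegree_C_mul hlc,
        natDegree_rootPoly]
    have hpdeg : p.natDegree = f.natDegree + g.natDegree := by rw [hfg, natDegree_mul hf0 hg0]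
    rcases hS.resolve_left ha S.length (by simp only; omega) S
      (mem_tuples.2 ⟨rfl, hSρ⟩) with h | ⟨i, hi⟩
    · omega
    -- The product over the roots of the factor `f` is `f` made monic, so its values lie in K.
    · refine hi ⟨f.leadingCoeff⁻¹ * eval (i : K) f, ?_⟩
      have h1 := congrArg (eval (i : Ω)) hSf
      rw [eval_mul, eval_C, leadingCoeff_map, ← map_natCast (algebraMap K Ω), eval_map_apply] at h1
      rw [map_mul, map_inv₀, h1, map_natCast, inv_mul_cancel_left₀]
      simpa using hf0

/-- A decidable subfield of an algebraically closed computable field has a splitting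
algorithm. -/
theorem computablePred_isReduciblePoly (hφ : ComputableEnum φ) (hψ : ComputableEnum ψ)
    (hψφ : ComputableVia φ fun n => algebraMap K Ω (ψ n))
    (hK : ComputablePred fun n => φ n ∈ Set.range (algebraMap K Ω)) :
    ComputablePred fun l : List ℕ => IsReduciblePoly (polyOfList (l.map ψ)) := by
  refine ComputablePred.computable_iff_re_compl_re'.2 ⟨hψ.rePred_isReduciblePoly, ?_⟩
  refine REPred.of_eq ?_ fun l => (not_isReduciblePoly_iff (φ := φ) hφ.surjective l).symm
  refine REPred.exists' (p := fun (l : List ℕ) (x : ℕ × List ℕ) =>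
    (∀ j < l.length + (x.2.length + 1),
      eval (j : Ω) (polyOfList (l.map fun n => algebraMap K Ω (ψ n))) =
        φ x.1 * eval (j : Ω) (rootPoly φ x.2)) ∧
    (φ x.1 = 0 ∨ ∀ m < x.2.length, ∀ S ∈ tuples x.2 m, S.length = 0 ∨
      ∃ i : ℕ, eval (i : Ω) (rootPoly φ S) ∉ Set.range (algebraMap K Ω))) ?_
  have hroot : ∀ {α : Type} [Primcodable α] {j : α → ℕ} {S : α → List ℕ}, Computable j →
      Computable S → ComputableVia φ fun a => eval (j a : Ω) (rootPoly φ (S a)) := by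
    intro α _ j S hj hS
    simp only [eval_rootPoly]
    exact .foldr hS (hφ.via_const 1) (hφ.via_mul (hφ.via_sub (hφ.via_natCast (by fun_prop))
      (.apply (by fun_prop))) (.apply (by fun_prop)))
  refine REPred.and' (ComputablePred.to_re ?_) (REPred.or' (ComputablePred.to_re ?_) ?_)
  · refine ComputablePred.forall_lt
      (N := fun x : List ℕ × ℕ × List ℕ => x.1.length + (x.2.2.length + 1))
      (p := fun x j => eval (j : Ω) (polyOfList (x.1.map fun n => algebraMap K Ω (ψ n))) =
        φ x.2.1 * eval (j : Ω) (rootPoly φ x.2.2)) (by fun_prop) ?_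
    exact hφ.computablePred_eq (hφ.via_eval_polyOfList hψφ (by fun_prop) (by fun_prop))
      (hφ.via_mul (.apply (by fun_prop)) (hroot (by fun_prop) (by fun_prop)))
  · exact hφ.computablePred_eq (.apply (by fun_prop)) (hφ.via_const 0)
  · refine REPred.forall_lt (N := fun x : List ℕ × ℕ × List ℕ => x.2.2.length)
      (p := fun x m => ∀ S ∈ tuples x.2.2 m, S.length = 0 ∨
        ∃ i : ℕ, eval (i : Ω) (rootPoly φ S) ∉ Set.range (algebraMap K Ω)) (by fun_prop) ?_
    refine REPred.forall_mem (L := fun x : (List ℕ × ℕ × List ℕ) × ℕ => tuples x.1.2.2 x.2)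
      (p := fun _ S => S.length = 0 ∨
        ∃ i : ℕ, eval (i : Ω) (rootPoly φ S) ∉ Set.range (algebraMap K Ω)) (by fun_prop) ?_
    refine REPred.or' (ComputablePred.eq' (by fun_prop) (by fun_prop)).to_re ?_
    refine REPred.exists' (p := fun (x : ((List ℕ × ℕ × List ℕ) × ℕ) × List ℕ) (i : ℕ) =>
      eval (i : Ω) (rootPoly φ x.2) ∉ Set.range (algebraMap K Ω)) ?_
    obtain ⟨g, hg, hgr⟩ := hroot (α := (((List ℕ × ℕ × List ℕ) × ℕ) × List ℕ) × ℕ)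
      (j := fun x => x.2) (S := fun x => x.1.2) (by fun_prop) (by fun_prop)
    exact ((hK.comp' hg).not.of_eq fun x => by rw [hgr]).to_re

end Splitting

/-! ### Additive valuations of valuation rings -/

namespace ValuationSubring

variable {K : Type} [Field K] (V : ValuationSubring K)

/-- The value group of a valuation ring, written additively. -/
abbrev AddValueGroup : Type := (Additive V.ValueGroupˣ)ᵒᵈ

open Classical in
/-- The value of a nonzero element, in additive notation. -/
noncomputable def value (x : K) : V.AddValueGroup :=
  if h : x = 0 then 0 else
    OrderDual.toDual (Additive.ofMul (Units.mk0 (V.valuation x) ((Valuation.ne_zero_iff _).2 h)))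

variable {V}

theorem value_le_value_iff {x y : K} (hx : x ≠ 0) (hy : y ≠ 0) :
    V.value x ≤ V.value y ↔ V.valuation y ≤ V.valuation x := by
  rw [value, value, dif_neg hx, dif_neg hy, OrderDual.toDual_le_toDual, Additive.ofMul_le,
    ← Units.val_le_val]
  rfl

theorem value_mul {x y : K} (hx : x ≠ 0) (hy : y ≠ 0) :
    V.value (x * y) = V.value x + V.value y := by
  rw [value, value, value, dif_neg hx, dif_neg hy, dif_neg (mul_ne_zero hx hy), ← toDual_add,
    ← ofMul_mul]
  congr 2
  ext
  simp

theorem value_one : V.value (1 : K) = 0 := by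
  have := value_mul (V := V) (one_ne_zero (α := K)) (one_ne_zero (α := K))
  rw [one_mul] at this
  exact left_eq_add.1 this

theorem value_surjective (γ : V.AddValueGroup) : ∃ x : K, x ≠ 0 ∧ V.value x = γ := by
  obtain ⟨x, hx⟩ := V.valuation_surjective ((OrderDual.ofDual γ).toMul : V.ValueGroupˣ)
  have hx0 : x ≠ 0 := by
    rintro rfl
    rw [map_zero] at hx
    exact (Units.ne_zero _) hx.symm
  refine ⟨x, hx0, ?_⟩
  rw [value, dif_neg hx0]
  apply congrArg OrderDual.toDual
  apply congrArg Additive.ofMul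
  exact Units.ext hx

variable (V) in
open Classical in
/-- The additive valuation of a valuation ring. -/
noncomputable def addValuation : AddValuation K (WithTop V.AddValueGroup) :=
  AddValuation.of (fun x => if x = 0 then ⊤ else (V.value x : WithTop V.AddValueGroup)) (by simp)
    (by simp [value_one])
    (by
      intro x y
      by_cases hxy : x + y = 0
      · simp [hxy]
      by_cases hx : x = 0
      · simp [hx]
      by_cases hy : y = 0
      · simp [hy]
      simp only [hx, hy, hxy, if_false]
      rw [← WithTop.coe_min, WithTop.coe_le_coe, min_le_iff, value_le_value_iff hx hxy,
        value_le_value_iff hy hxy, ← le_max_iff]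
      exact V.valuation.map_add x y)
    (by
      intro x y
      by_cases hx : x = 0
      · simp [hx]
      by_cases hy : y = 0
      · simp [hy]
      simp [hx, hy, value_mul])

theorem addValuation_apply {x : K} (hx : x ≠ 0) : V.addValuation x = (V.value x : WithTop _) := by
  classical
  exact if_neg hx

theorem addValuation_eq_coe_iff {x : K} {γ : V.AddValueGroup} :
    V.addValuation x = (γ : WithTop V.AddValueGroup) ↔ x ≠ 0 ∧ V.value x = γ := by
  by_cases hx : x = 0
  · simp [hx]
  · rw [addValuation_apply hx, WithTop.coe_inj]
    simp [hx]

theorem zero_le_addValuation_iff (x : K) : 0 ≤ V.addValuation x ↔ x ∈ V := by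
  by_cases hx : x = 0
  · simp [hx]
  · rw [addValuation_apply hx, ← WithTop.coe_zero, WithTop.coe_le_coe, ← value_one,
      value_le_value_iff one_ne_zero hx, map_one, V.valuation_le_one_iff]

end ValuationSubring

/-! ### Extensions counted as valuation rings -/

section Counting

theorem AddValuation.isEquiv_iff_zero_le {K Γ Δ : Type} [Field K] [AddCommGroup Γ] [LinearOrder Γ]
    [IsOrderedAddMonoid Γ] [AddCommGroup Δ] [LinearOrder Δ] [IsOrderedAddMonoid Δ]
    (v : AddValuation K (WithTop Γ)) (w : AddValuation K (WithTop Δ)) :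
    v.IsEquiv w ↔ ∀ x, 0 ≤ v x ↔ 0 ≤ w x :=
  Valuation.isEquiv_iff_val_le_one (v := AddValuation.toValuation v)
    (v' := AddValuation.toValuation w)

/-- The valuation ring of an additive valuation. -/
noncomputable def AddValuation.ring {K Γ : Type} [Field K] [AddCommGroup Γ] [LinearOrder Γ]
    [IsOrderedAddMonoid Γ] (v : AddValuation K (WithTop Γ)) : ValuationSubring K :=
  (AddValuation.toValuation v).valuationSubring

theorem AddValuation.mem_ring {K Γ : Type} [Field K] [AddCommGroup Γ] [LinearOrder Γ]
    [IsOrderedAddMonoid Γ] (v : AddValuation K (WithTop Γ)) (x : K) : x ∈ v.ring ↔ 0 ≤ v x :=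
  Iff.rfl

/-- Extensions of a valuation correspond to valuation rings. -/
theorem numExtensions_addValuation {K : Type} [Field K] (V : ValuationSubring K)
    (L : Type) [Field L] [Algebra K L] : numExtensions V.addValuation L =
      Nat.card {W : ValuationSubring L // W.comap (algebraMap K L) = V} := by
  have hcomap : ∀ e : ValExtension V.addValuation L, e.w.ring.comap (algebraMap K L) = V := by
    intro e
    ext x
    rw [ValuationSubring.mem_comap, AddValuation.mem_ring, ← V.zero_le_addValuation_iff]
    exact ((AddValuation.isEquiv_iff_zero_le _ _).1 e.isEquiv_comap x).symm
  let T : Quotient (ValExtension.setoid V.addValuation L) →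
      {W : ValuationSubring L // W.comap (algebraMap K L) = V} :=
    Quotient.lift (fun e => ⟨e.w.ring, hcomap e⟩) fun e₁ e₂ h => by
      apply Subtype.ext
      ext x
      exact (AddValuation.isEquiv_iff_zero_le _ _).1 h x
  refine Nat.card_congr (Equiv.ofBijective T ⟨?_, ?_⟩)
  · intro a b
    induction a using Quotient.inductionOn
    induction b using Quotient.inductionOn
    rename_i e₁ e₂
    intro h
    apply Quotient.sound
    refine (AddValuation.isEquiv_iff_zero_le _ _).2 fun x => ?_
    have h' : e₁.w.ring = e₂.w.ring := congrArg Subtype.val h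
    rw [← AddValuation.mem_ring, ← AddValuation.mem_ring, h']
  · rintro ⟨W, hW⟩
    let e : ValExtension V.addValuation L :=
      { Δ := W.AddValueGroup
        w := W.addValuation
        surjective := fun δ => by
          obtain ⟨x, hx0, hx⟩ := ValuationSubring.value_surjective δ
          exact ⟨x, ValuationSubring.addValuation_eq_coe_iff.2 ⟨hx0, hx⟩⟩
        isEquiv_comap := by
          refine (AddValuation.isEquiv_iff_zero_le _ _).2 fun x => ?_
          exact (V.zero_le_addValuation_iff x).trans ((SetLike.ext_iff.1 hW x).symm.trans
            (W.zero_le_addValuation_iff (algebraMap K L x)).symm) }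
    refine ⟨⟦e⟧, Subtype.ext ?_⟩
    ext x
    exact W.zero_le_addValuation_iff x

end Counting

/-! ### Computable valued fields from decidable valuation rings -/

section ValuedField

variable {K : Type} [Field K] {ψ : ℕ → K}

/-- The presentation given by an enumeration. -/
noncomputable def ComputableEnum.coding (hψ : ComputableEnum ψ) : Coding K :=
  Coding.ofSurjective ψ hψ.surjective hψ.eq

theorem ComputableEnum.apply_code (hψ : ComputableEnum ψ) (x : K) : ψ (hψ.coding.code x) = x :=
  Coding.apply_ofSurjective_code x

theorem ComputableEnum.isComputableField (hψ : ComputableEnum ψ) :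
    hψ.coding.IsComputableField := by
  obtain ⟨f, hf, h⟩ := hψ.add
  obtain ⟨g, hg, h'⟩ := hψ.mul
  exact ⟨Coding.isComputableOp_ofSurjective f hf h, Coding.isComputableOp_ofSurjective g hg h'⟩

/-- A decidable valuation ring of a computable field gives a computable valued field. -/
theorem ComputableEnum.exists_isComputableValuedField (hψ : ComputableEnum ψ)
    (V : ValuationSubring K) (hV : ComputablePred fun n => ψ n ∈ V) :
    ∃ cΓ : Coding V.AddValueGroup, IsComputableValuedField hψ.coding cΓ V.addValuation := by
  classical
  -- Replacing 0 by 1 lets every index name an element of the value group.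
  let u : K → K := fun x => if x = 0 then 1 else x
  have hu0 : ∀ x, u x ≠ 0 := fun x => by by_cases hx : x = 0 <;> simp [u, hx]
  have hu : ∀ x, x ≠ 0 → u x = x := fun x hx => if_neg hx
  have huψ : ComputableVia ψ fun n => u (ψ n) := by
    obtain ⟨e, he⟩ := hψ.surjective 1
    refine ⟨fun n => if ψ n = 0 then e else n, ComputablePred.ite' (hψ.computablePred_eq
      (.apply (f := fun n => n) (by fun_prop)) (hψ.via_const 0)) (by fun_prop) (by fun_prop),
      fun n => ?_⟩
    by_cases hn : ψ n = 0 <;> simp [u, hn, he]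
  -- Comparing two values means testing whether a quotient lies in V.
  have hle : ComputablePred fun x : ℕ × ℕ => V.value (u (ψ x.1)) ≤ V.value (u (ψ x.2)) := by
    obtain ⟨g, hg, h⟩ := hψ.via_mul (huψ.comp (g := fun x : ℕ × ℕ => x.2) (by fun_prop))
      (hψ.via_inv (huψ.comp (g := fun x : ℕ × ℕ => x.1) (by fun_prop)))
    refine (hV.comp' hg).of_eq fun x => ?_
    rw [h, ← V.valuation_le_one_iff, map_mul, map_inv₀, ← div_eq_mul_inv,
      div_le_one₀ (zero_lt_iff.2 (by simpa using hu0 _)),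
      ValuationSubring.value_le_value_iff (hu0 _) (hu0 _)]
  let χ : ℕ → V.AddValueGroup := fun n => V.value (u (ψ n))
  have hχ : Function.Surjective χ := by
    intro γ
    obtain ⟨x, hx0, hx⟩ := ValuationSubring.value_surjective γ
    obtain ⟨n, rfl⟩ := hψ.surjective x
    exact ⟨n, by simp only [χ]; rw [hu _ hx0, hx]⟩
  have hχd : ComputablePred fun x : ℕ × ℕ => χ x.1 = χ x.2 :=
    (hle.and' (hle.comp' (f := fun x : ℕ × ℕ => (x.2, x.1)) (by fun_prop))).of_eq fun x =>
      le_antisymm_iff.symm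
  refine ⟨Coding.ofSurjective χ hχ hχd, hψ.isComputableField, ⟨?_, ?_⟩, ?_, ?_⟩
  · obtain ⟨g, hg, h⟩ := hψ.via_mul (huψ.comp (g := fun x : ℕ × ℕ => x.1) (by fun_prop))
      (huψ.comp (g := fun x : ℕ × ℕ => x.2) (by fun_prop))
    refine Coding.isComputableOp_ofSurjective (fun m n => g (m, n)) (by fun_prop) fun m n => ?_
    simp only [χ]
    rw [h, hu _ (mul_ne_zero (hu0 _) (hu0 _)), ValuationSubring.value_mul (hu0 _) (hu0 _)]
  · obtain ⟨d, hd, h⟩ := ComputablePred.computable_iff.1 hle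
    refine ⟨fun m n => d (m, n), Computable₂.mk (by fun_prop), fun a b => ?_⟩
    have h1 := congrFun h
      ((Coding.ofSurjective χ hχ hχd).code a, (Coding.ofSurjective χ hχ hχd).code b)
    refine (iff_of_eq h1.symm).trans ?_
    change χ _ ≤ χ _ ↔ _
    rw [Coding.apply_ofSurjective_code (φ := χ), Coding.apply_ofSurjective_code (φ := χ)]
  · intro γ
    obtain ⟨x, hx0, hx⟩ := ValuationSubring.value_surjective γ
    exact ⟨x, ValuationSubring.addValuation_eq_coe_iff.2 ⟨hx0, hx⟩⟩
  · obtain ⟨g, hg, h⟩ := Coding.exists_normalForm (hφ := hχ) (h := hχd)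
    refine ⟨g, hg, fun x γ hx => ?_⟩
    obtain ⟨hx0, rfl⟩ := ValuationSubring.addValuation_eq_coe_iff.1 hx
    rw [h]
    simp only [χ]
    rw [hψ.apply_code, hu x hx0]

end ValuedField

/-! ### The number of extensions to K(a) with a^q = 2 -/

section Extensions

variable {K E : Type*} [Field K] [Field E] [Algebra K E]

/-- Chevalley's theorem for the image of V and its maximal ideal. If x is not in V, then 1/x is in
the maximal ideal, which keeps x out of the dominating ring. -/
theorem ValuationSubring.exists_comap_algebraMap_eq (V : ValuationSubring K) :
    ∃ W : ValuationSubring E, W.comap (algebraMap K E) = V := by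
  let f : V →+* E := (algebraMap K E).comp V.subtype
  have hf : Function.Injective f := (algebraMap K E).injective.comp Subtype.val_injective
  let e : V ≃+* f.range := RingEquiv.ofBijective f.rangeRestrict
    ⟨fun x y h => hf (congrArg Subtype.val h), f.rangeRestrict_surjective⟩
  let I : Ideal f.range := (IsLocalRing.maximalIdeal V).comap e.symm.toRingHom
  have hI : I ≠ ⊤ := Ideal.comap_ne_top _ (IsLocalRing.maximalIdeal.isMaximal V).ne_top
  obtain ⟨W, h1, h2⟩ := exists_valuationSubring_of_subring _ I hI
  refine ⟨W, ?_⟩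
  ext x
  rw [ValuationSubring.mem_comap]
  constructor
  · intro hx
    by_contra hxV
    have hx0 : x ≠ 0 := by rintro rfl; exact hxV V.zero_mem
    have hlt : V.valuation x⁻¹ < 1 := by
      rw [V.valuation_lt_one_iff_inv_notMem (inv_ne_zero hx0), inv_inv]; exact hxV
    let y : V := ⟨x⁻¹, (V.valuation_le_one_iff _).1 hlt.le⟩
    have hy : e y ∈ I := by
      change e.symm (e y) ∈ IsLocalRing.maximalIdeal V
      rw [RingEquiv.symm_apply_apply]
      exact (V.valuation_lt_one_iff y).2 hlt
    have h3 : W.valuation (algebraMap K E x⁻¹) < 1 := h2 _ hy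
    rw [map_inv₀, W.valuation_lt_one_iff_inv_notMem (by simpa using hx0), inv_inv] at h3
    exact h3 hx
  · intro hx
    exact h1 _ ⟨⟨x, hx⟩, rfl⟩

theorem ValuationSubring.valuation_le_iff_of_comap {V : ValuationSubring K} {W : ValuationSubring E}
    (h : W.comap (algebraMap K E) = V) (x y : K) :
    W.valuation (algebraMap K E x) ≤ W.valuation (algebraMap K E y) ↔
      V.valuation x ≤ V.valuation y := by
  by_cases hy : y = 0
  · simp [hy]
  have hy1 : W.valuation (algebraMap K E y) ≠ 0 := by simpa using hy
  have hy2 : V.valuation y ≠ 0 := by simpa using hy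
  rw [← div_le_one₀ (zero_lt_iff.2 hy1), ← div_le_one₀ (zero_lt_iff.2 hy2), ← map_div₀, ← map_div₀,
    ← map_div₀, W.valuation_le_one_iff, V.valuation_le_one_iff, ← h, ValuationSubring.mem_comap]

theorem ValuationSubring.valuation_eq_iff_of_comap {V : ValuationSubring K} {W : ValuationSubring E}
    (h : W.comap (algebraMap K E) = V) (x y : K) :
    W.valuation (algebraMap K E x) = W.valuation (algebraMap K E y) ↔
      V.valuation x = V.valuation y := by
  rw [le_antisymm_iff, le_antisymm_iff, valuation_le_iff_of_comap h, valuation_le_iff_of_comap h]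

theorem ValuationSubring.valuation_two_lt_of_comap [CharZero K] {V : ValuationSubring K}
    {W : ValuationSubring E} (h : W.comap (algebraMap K E) = V) (hV : V.valuation 2 < 1) :
    W.valuation 2 < 1 := by
  have : CharZero E := charZero_of_injective_algebraMap (algebraMap K E).injective
  rw [valuation_lt_one_iff_inv_notMem _ two_ne_zero, ← h, ValuationSubring.mem_comap, map_inv₀,
    map_ofNat] at hV
  rwa [valuation_lt_one_iff_inv_notMem _ two_ne_zero]

/-- The valuation extends uniquely to `K(a)`, `a ^ q = 2`, if `2` is not a `q`-th power up to
units. -/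
theorem card_extensions_eq_one [CharZero K] (V : ValuationSubring K) {q : ℕ} (hq : q.Prime)
    (hG : ∀ x : K, V.valuation x ^ q ≠ V.valuation 2) {a : E} (ha : a ^ q = 2) :
    Nat.card {W : ValuationSubring K⟮a⟯ // W.comap (algebraMap K K⟮a⟯) = V} = 1 := by
  rw [Nat.card_eq_one_iff_unique]
  refine ⟨⟨?_⟩, ?_⟩
  · rintro ⟨W, hW⟩ ⟨W', hW'⟩
    -- Both rings are extended to E, where the uniqueness lemma compares them on K(a).
    obtain ⟨U, rfl⟩ := W.exists_comap_algebraMap_eq (E := E)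
    obtain ⟨U', rfl⟩ := W'.exists_comap_algebraMap_eq (E := E)
    apply Subtype.ext
    have hU : U.comap (algebraMap K E) = V := hW
    have hU' : U'.comap (algebraMap K E) = V := hW'
    have hval : ∀ U : ValuationSubring E, U.comap (algebraMap K E) = V → ∀ x : K,
        U.valuation (algebraMap K E x) ^ q ≠ U.valuation (algebraMap K E 2) := by
      intro U hU x hx
      rw [← map_pow, ← map_pow, ValuationSubring.valuation_eq_iff_of_comap hU, map_pow] at hx
      exact hG x hx
    ext y
    change (y : E) ∈ U ↔ (y : E) ∈ U'
    exact ValuationSubring.mem_iff_of_mem_adjoin_root hq (t := (2 : K)) (by rw [ha, map_ofNat])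
      two_ne_zero U U' (fun x => by
        rw [← ValuationSubring.mem_comap, hU, ← ValuationSubring.mem_comap, hU'])
      (hval U hU) (hval U' hU') y.2
  · obtain ⟨W, hW⟩ := V.exists_comap_algebraMap_eq (E := K⟮a⟯)
    exact ⟨⟨W, hW⟩⟩

/-- The valuation extends in several ways to `K(a)`, `a ^ q = 2`, if some `2 r`, where `r` is odd
and not a `q`-th power, is a `q`-th power. -/
theorem card_extensions_ne_one [CharZero K] [IsAlgClosed E] [Algebra.IsAlgebraic K E]
    (V : ValuationSubring K) (hV : V.valuation 2 < 1) {q r : ℕ} (hq : q.Prime) (hq2 : Odd q)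
    (hr : Odd r) {b : K} (hb : b ^ q = 2 * r) (hroot : ∀ c : K, c ^ q ≠ r) {a : E}
    (ha : a ^ q = 2) :
    Nat.card {W : ValuationSubring K⟮a⟯ // W.comap (algebraMap K K⟮a⟯) = V} ≠ 1 := by
  have : CharZero E := charZero_of_injective_algebraMap (algebraMap K E).injective
  obtain ⟨U, hU⟩ := V.exists_comap_algebraMap_eq (E := E)
  have hU2 := ValuationSubring.valuation_two_lt_of_comap hU hV
  have hr0 : (r : E) ≠ 0 := by exact_mod_cast hr.pos.ne'
  -- The quotient of the roots of 2 and 2r is a root of the 1-unit 1/r, which is irreducible over K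
  -- by `hroot`.
  have hc : (a / algebraMap K E b) ^ q = algebraMap K E (1 / r) := by
    rw [div_pow, ha, ← map_pow, hb]
    simp only [map_mul, map_natCast, map_ofNat, map_div₀, map_one]
    field_simp
  obtain ⟨σ, hσ⟩ := exists_algEquiv_not_mem_iff U hU2 hq hq2 hc
    (by simpa using U.valuation_sub_one_lt hU2 odd_one hr)
    (X_pow_sub_C_irreducible_of_prime hq fun y hy => hroot y⁻¹ (by rw [inv_pow, hy]; simp))
  -- Conjugating by σ gives a second extension of V; the two are separated by (1 - a/b)⁻¹, an
  -- element of K(a).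
  have hσU : (U.comap (σ : E →+* E)).comap (algebraMap K E) = V := by
    rw [← hU]
    ext x
    simp [ValuationSubring.mem_comap]
  intro hcard
  obtain ⟨⟨hsub⟩, -⟩ := Nat.card_eq_one_iff_unique.1 hcard
  have heq := congrArg Subtype.val (hsub
    ⟨U.comap (algebraMap K⟮a⟯ E), hU⟩
    ⟨(U.comap (σ : E →+* E)).comap (algebraMap K⟮a⟯ E), hσU⟩)
  have hmem : (1 - a / algebraMap K E b)⁻¹ ∈ K⟮a⟯ :=
    inv_mem (sub_mem (one_mem _) (div_mem (mem_adjoin_simple_self K a) (IntermediateField.algebraMap_mem _ b)))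
  have := SetLike.ext_iff.1 heq ⟨_, hmem⟩
  exact hσ this

end Extensions

/-- Numbers outside the domain are sent to 0. Since the domain is computable, the code of the named
element is computable from any index. -/
theorem Coding.exists_computableEnum {L : Type} [Field L] (c : Coding L)
    (hc : c.IsComputableField) : ∃ θ : ℕ → L, ComputableEnum θ ∧
      Computable fun n => c.code (θ n) := by
  classical
  let θ : ℕ → L := fun n => if h : n ∈ Set.range c.code then h.choose else 0
  have hθc : ∀ n, n ∈ Set.range c.code → c.code (θ n) = n := fun n hn => by
    simp only [θ, dif_pos hn]; exact hn.choose_spec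
  have hcode : ∀ x, θ (c.code x) = x := fun x => c.injective (hθc _ ⟨x, rfl⟩)
  have hnf : Computable fun n => c.code (θ n) := by
    have : Computable fun n => if n ∈ Set.range c.code then n else c.code 0 :=
      ComputablePred.ite' c.domain_computable (by fun_prop) (by fun_prop)
    refine this.of_eq fun n => ?_
    by_cases hn : n ∈ Set.range c.code
    · rw [if_pos hn, hθc n hn]
    · rw [if_neg hn]; simp only [θ, dif_neg hn]
  obtain ⟨f, hf, hfa⟩ := hc.add
  obtain ⟨g, hg, hgm⟩ := hc.mul
  refine ⟨θ, ⟨fun x => ⟨_, hcode x⟩, ?_, ?_, ?_⟩, hnf⟩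
  · exact (ComputablePred.eq' (f := fun x : ℕ × ℕ => c.code (θ x.1))
      (g := fun x : ℕ × ℕ => c.code (θ x.2)) (hnf.comp Computable.fst)
      (hnf.comp Computable.snd)).of_eq fun x => c.injective.eq_iff
  · refine ⟨fun m n => f (c.code (θ m)) (c.code (θ n)), ?_, fun m n => by
      beta_reduce; rw [hfa, hcode]⟩
    exact Computable₂.comp hf (hnf.comp Computable.fst) (hnf.comp Computable.snd)
  · refine ⟨fun m n => g (c.code (θ m)) (c.code (θ n)), ?_, fun m n => by
      beta_reduce; rw [hgm, hcode]⟩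
    exact Computable₂.comp hg (hnf.comp Computable.fst) (hnf.comp Computable.snd)

theorem exists_rePred_not_computablePred : ∃ p : ℕ → Prop, REPred p ∧ ¬ ComputablePred p := by
  refine ⟨fun n => ((Denumerable.ofNat Nat.Partrec.Code n).eval 0).Dom,
    (ComputablePred.halting_problem_re 0).comp' (f := fun n => Denumerable.ofNat _ n)
      (by fun_prop), fun h => ComputablePred.halting_problem 0 ?_⟩
  exact (h.comp' (f := fun c : Nat.Partrec.Code => Encodable.encode c) (by fun_prop)).of_eq
    fun c => by rw [Denumerable.ofNat_encode]

/-! ### Counting extensions decides the given set -/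

section Reduction

variable {K : Type} [Field K] {p : ℕ → Prop}

/-- The minimal polynomial X^(q n) - 2 can be written down from n, so a counting algorithm applied
to it would decide `p`. -/
theorem not_canCountExtensionsFromMinpoly (V : ValuationSubring K) (c : Coding K) {q : ℕ → ℕ}
    (hq : Computable q) (hq0 : ∀ n, q n ≠ 0) (hp : ¬ ComputablePred p)
    (hirr : ∀ n, Irreducible (X ^ q n - C (2 : K)))
    (hnum : ∀ n (a : AlgebraicClosure K), a ^ q n = 2 →
      (numExtensions V.addValuation K⟮a⟯ = 1 ↔ ¬ p n)) :
    ¬ CanCountExtensionsFromMinpoly c V.addValuation := by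
  rintro ⟨g, hg, h⟩
  choose a ha using fun n => IsAlgClosed.exists_pow_nat_eq (2 : AlgebraicClosure K)
    (Nat.pos_of_ne_zero (hq0 n))
  let l : ℕ → List K := fun n => -2 :: ((List.range (q n - 1)).map (fun _ => 0) ++ [1])
  have hl : ∀ n, polyOfList (l n) = minpoly K (a n) := by
    intro n
    rw [← minpoly.eq_of_irreducible_of_monic (hirr n) (by
      rw [map_sub, map_pow, aeval_X, aeval_C, ha, map_ofNat, sub_self])
      (monic_X_pow_sub_C _ (hq0 n))]
    have hz : ∀ (m : List ℕ), polyOfList (m.map (fun _ => (0 : K)) ++ [1]) = X ^ m.length := by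
      intro m
      induction m with
      | nil => simp [polyOfList]
      | cons i m ih =>
        rw [List.map_cons, List.cons_append, polyOfList, ih, List.length_cons, pow_succ', C_0, zero_add]
    obtain ⟨d, hd⟩ := Nat.exists_eq_succ_of_ne_zero (hq0 n)
    simp only [l, polyOfList, hz, List.length_range]
    rw [hd, Nat.succ_sub_one, Nat.succ_eq_add_one, pow_succ', C_neg]
    ring
  have hcomp : Computable fun n => (l n).map c.code := by
    have : Computable fun n => c.code (-2) ::
        ((List.range (q n - 1)).map (fun _ => c.code 0) ++ [c.code 1]) := by fun_prop
    refine this.of_eq fun n => ?_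
    simp [l]
  have hN : Computable fun n => numExtensions V.addValuation K⟮a n⟯ :=
    (hg.comp hcomp).of_eq_tot fun n => h (a n) (l n) (hl n)
  refine hp ((ComputablePred.eq' hN (Computable.const 1)).not.of_eq fun n => ?_)
  rw [hnum n (a n) (ha n), not_not]

/-- A q n-th root of 2 in L is found by search, and counting the extensions at it would decide `p`.
-/
theorem not_canCountExtensionsIn (V : ValuationSubring K) {q : ℕ → ℕ} (hq : Computable q)
    (hq0 : ∀ n, q n ≠ 0) (hp : ¬ ComputablePred p) {L : Type} [Field L] [Algebra K L]
    [IsAlgClosed L] (c : Coding L) (hc : c.IsComputableField)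
    (hnum : ∀ n (a : L), a ^ q n = 2 → (numExtensions V.addValuation K⟮a⟯ = 1 ↔ ¬ p n)) :
    ¬ CanCountExtensionsIn V.addValuation c := by
  rintro ⟨g, hg, h⟩
  obtain ⟨θ, hθ, hθc⟩ := c.exists_computableEnum hc
  obtain ⟨f, hf, hfq⟩ := REPred.exists_computable (R := fun n m => θ m ^ q n = 2)
    (hθ.computablePred_eq (hθ.via_pow (.apply (by fun_prop)) (by fun_prop)) (hθ.via_const 2)).to_re
    fun n => by
      obtain ⟨x, hx⟩ := IsAlgClosed.exists_pow_nat_eq (2 : L) (Nat.pos_of_ne_zero (hq0 n))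
      obtain ⟨m, rfl⟩ := hθ.surjective x
      exact ⟨m, hx⟩
  have hN : Computable fun n => numExtensions V.addValuation K⟮θ (f n)⟯ :=
    (hg.comp (hθc.comp hf)).of_eq_tot fun n => h (θ (f n))
  refine hp ((ComputablePred.eq' hN (Computable.const 1)).not.of_eq fun n => ?_)
  rw [hnum n _ (hfq n), not_not]

end Reduction

/-! ### Decidable subfields and the computability of v -/

section Subfield

variable {k Ω : Type} [Field k] [Field Ω] [Algebra k Ω] {φ : ℕ → Ω}

open Classical in
/-- The enumeration of a subfield obtained by replacing the elements outside by zero. -/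
noncomputable def restrictEnum (φ : ℕ → Ω) (K : IntermediateField k Ω) (n : ℕ) : K :=
  if h : φ n ∈ K then ⟨φ n, h⟩ else 0

theorem via_restrictEnum (hφ : ComputableEnum φ) {K : IntermediateField k Ω}
    (hK : ComputablePred fun n => φ n ∈ K) :
    ComputableVia φ fun n => algebraMap K Ω (restrictEnum φ K n) := by
  classical
  obtain ⟨z, hz⟩ := hφ.surjective 0
  refine ⟨fun n => if φ n ∈ K then n else z, ComputablePred.ite' hK (by fun_prop) (by fun_prop),
    fun n => ?_⟩
  by_cases hn : φ n ∈ K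
  · simp [restrictEnum, hn]
  · simp [restrictEnum, hn, hz]

theorem restrictEnum_of_mem {K : IntermediateField k Ω} {n : ℕ} (hn : φ n ∈ K) :
    restrictEnum φ K n = ⟨φ n, hn⟩ := dif_pos hn

theorem computableEnum_restrictEnum (hφ : ComputableEnum φ) {K : IntermediateField k Ω}
    (hK : ComputablePred fun n => φ n ∈ K) : ComputableEnum (restrictEnum φ K) := by
  have hv := via_restrictEnum hφ hK
  have hinj : Function.Injective (algebraMap K Ω) := (algebraMap K Ω).injective
  have hop : ∀ (op : Ω → Ω → Ω) (op' : K → K → K),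
      (∀ x y, algebraMap K Ω (op' x y) = op (algebraMap K Ω x) (algebraMap K Ω y)) →
      (ComputableVia φ fun x : ℕ × ℕ => op (algebraMap K Ω (restrictEnum φ K x.1))
        (algebraMap K Ω (restrictEnum φ K x.2))) →
      ∃ f : ℕ → ℕ → ℕ, (Computable fun x : ℕ × ℕ => f x.1 x.2) ∧
        ∀ m n, restrictEnum φ K (f m n) = op' (restrictEnum φ K m) (restrictEnum φ K n) := by
    rintro op op' hop ⟨g, hg, h⟩
    refine ⟨fun m n => g (m, n), hg, fun m n => ?_⟩
    have h1 : φ (g (m, n)) = algebraMap K Ω (op' (restrictEnum φ K m) (restrictEnum φ K n)) := by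
      rw [h, hop]
    have hmem : φ (g (m, n)) ∈ K := h1 ▸ (op' (restrictEnum φ K m) (restrictEnum φ K n)).2
    rw [restrictEnum_of_mem hmem]
    exact Subtype.ext h1
  have h1 := hv.comp (g := fun x : ℕ × ℕ => x.1) (by fun_prop)
  have h2 := hv.comp (g := fun x : ℕ × ℕ => x.2) (by fun_prop)
  refine ⟨fun x => ?_, ?_, hop (· + ·) (· + ·) (fun x y => map_add _ x y) (hφ.via_add h1 h2),
    hop (· * ·) (· * ·) (fun x y => map_mul _ x y) (hφ.via_mul h1 h2)⟩
  · obtain ⟨n, hn⟩ := hφ.surjective x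
    have hmem : φ n ∈ K := hn ▸ x.2
    exact ⟨n, by rw [restrictEnum_of_mem hmem]; exact Subtype.ext hn⟩
  · exact (hφ.computablePred_eq h1 h2).of_eq fun x => hinj.eq_iff

/-- The trace of a valuation ring over `2` is decidable on a decidable field where it is
determined. -/
theorem computablePred_mem_comap (hφ : ComputableEnum φ)
    {K : IntermediateField k Ω} (hK : ComputablePred fun n => φ n ∈ K)
    (hdet : ValDetermined (K : Set Ω)) {W : ValuationSubring Ω} (hW : W.valuation 2 < 1) :
    ComputablePred fun n => restrictEnum φ K n ∈ W.comap (algebraMap K Ω) := by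
  have hv := via_restrictEnum hφ hK
  refine ComputablePred.computable_iff_re_compl_re'.2 ⟨?_, ?_⟩
  · have h : REPred fun n => algebraMap K Ω (restrictEnum φ K n) = 0 ∨ ∃ x : List ℤ × List ℤ,
        2 * aeval (algebraMap K Ω (restrictEnum φ K n))⁻¹ (IntPoly.toPoly x.1) +
          (algebraMap K Ω (restrictEnum φ K n))⁻¹ *
            aeval (algebraMap K Ω (restrictEnum φ K n))⁻¹ (IntPoly.toPoly x.2) = 1 := by
      refine (hφ.computablePred_eq hv (hφ.via_const 0)).to_re.or' ?_
      refine REPred.exists' (p := fun n (x : List ℤ × List ℤ) =>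
        2 * aeval (algebraMap K Ω (restrictEnum φ K n))⁻¹ (IntPoly.toPoly x.1) +
          (algebraMap K Ω (restrictEnum φ K n))⁻¹ *
            aeval (algebraMap K Ω (restrictEnum φ K n))⁻¹ (IntPoly.toPoly x.2) = 1) ?_
      have hi := hφ.via_inv (hv.comp (g := fun x : ℕ × List ℤ × List ℤ => x.1) (by fun_prop))
      exact (hφ.computablePred_eq (hφ.via_add (hφ.via_mul (hφ.via_const 2) (hφ.via_aeval hi
        (by fun_prop))) (hφ.via_mul hi (hφ.via_aeval hi (by fun_prop)))) (hφ.via_const 1)).to_re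
    refine h.of_eq fun n => ?_
    refine Iff.trans ?_ (hdet.mem_iff hW (restrictEnum φ K n).2).symm
    refine or_congr Iff.rfl ⟨fun ⟨x, hx⟩ => ⟨_, _, hx⟩, fun ⟨f, g, hfg⟩ => ?_⟩
    obtain ⟨l, rfl⟩ := IntPoly.exists_toPoly f
    obtain ⟨l', rfl⟩ := IntPoly.exists_toPoly g
    exact ⟨(l, l'), hfg⟩
  · have h : REPred fun n => ∃ x : List ℤ,
        2 * aeval (algebraMap K Ω (restrictEnum φ K n)) (IntPoly.toPoly x) = 1 :=
      REPred.exists' (p := fun n (x : List ℤ) =>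
        2 * aeval (algebraMap K Ω (restrictEnum φ K n)) (IntPoly.toPoly x) = 1)
        (hφ.computablePred_eq (hφ.via_mul (hφ.via_const 2) (hφ.via_aeval
          (hv.comp (by fun_prop)) (by fun_prop))) (hφ.via_const 1)).to_re
    refine h.of_eq fun n => ?_
    refine Iff.trans ?_ (hdet.notMem_iff hW (restrictEnum φ K n).2).symm
    refine ⟨fun ⟨x, hx⟩ => ⟨_, hx⟩, fun ⟨f, hf⟩ => ?_⟩
    obtain ⟨l, rfl⟩ := IntPoly.exists_toPoly f
    exact ⟨l, hf⟩

end Subfield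

/-! ### Assembly -/

theorem exists_valuedField_not_canCount (k Ω : Type) [Field k] [CharZero k] [IsFractionRing ℤ k]
    [Field Ω] [Algebra k Ω] [IsAlgClosed Ω] [Algebra.IsAlgebraic k Ω] :
    ∃ (K : IntermediateField k Ω) (V : ValuationSubring K) (cK : Coding K)
      (cΓ : Coding V.AddValueGroup), IsComputableValuedField cK cΓ V.addValuation ∧
      Algebra.IsAlgebraic k K ∧ HasSplittingAlgorithm cK ∧
      ¬ CanCountExtensionsFromMinpoly cK V.addValuation ∧
      ∀ (L : Type) [Field L] [Algebra K L] [IsAlgClosure K L] (cL : Coding L),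
        cL.IsComputableField → ¬ CanCountExtensionsIn V.addValuation cL := by
  have : CharZero Ω := charZero_of_injective_algebraMap (algebraMap k Ω).injective
  obtain ⟨φ, hφ⟩ := IntPoly.exists_computableEnum k Ω
  obtain ⟨q, hq, hinj, hprime⟩ := exists_computable_oddPrimes
  obtain ⟨p, hp, hpn⟩ := exists_rePred_not_computablePred
  obtain ⟨K, hK, hdet, hout, hin⟩ := exists_decidable_field k hφ hq hinj hprime hp
  obtain ⟨W, hW⟩ := exists_valuationSubring_two (Ω := Ω)
  have : CharZero K := (algebraMap K Ω).charZero
  have hV2 : (W.comap (algebraMap K Ω)).valuation 2 < 1 := W.comap_valuation_two hW _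
  have hψ := computableEnum_restrictEnum hφ hK
  obtain ⟨cΓ, hcΓ⟩ := hψ.exists_isComputableValuedField (W.comap (algebraMap K Ω))
    (computablePred_mem_comap hφ hK hdet hW)
  have hroot : ∀ n, ∀ r : ℕ, r.Prime → Odd r → ∀ c : K, c ^ q n ≠ r := by
    intro n r hr hr2 c hc
    refine hdet.pow_mul_ne (hprime n).1 (hprime n).2 hr hr2 odd_one
      (fun h => hr.one_lt.ne' (Nat.dvd_one.1 h)) c.2 ?_
    have := congrArg (algebraMap K Ω) hc
    rw [map_pow, map_natCast] at this
    rw [Nat.cast_one, mul_one]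
    exact this
  have hin' : ∀ n, p n → ∃ r : ℕ, r.Prime ∧ Odd r ∧ ∃ b : K, b ^ q n = 2 * r := by
    intro n hn
    obtain ⟨r, hr, hr2, b, hbK, hb⟩ := hin n hn
    refine ⟨r, hr, hr2, ⟨b, hbK⟩, (algebraMap K Ω).injective ?_⟩
    rw [map_pow, map_mul, map_ofNat, map_natCast]
    exact hb
  -- Stated for every algebraically closed algebraic extension, so that it serves both the standard
  -- closure and a presented one.
  have hnum : ∀ (M : Type) [Field M] [Algebra K M] [IsAlgClosed M] [Algebra.IsAlgebraic K M] n
      (a : M), a ^ q n = 2 →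
      (numExtensions (W.comap (algebraMap K Ω)).addValuation K⟮a⟯ = 1 ↔ ¬ p n) := by
    intro M _ _ _ _ n a ha
    rw [numExtensions_addValuation]
    constructor
    · intro h hn
      obtain ⟨r, hr, hr2, b, hb⟩ := hin' n hn
      exact card_extensions_ne_one _ hV2 (hprime n).1 (hprime n).2 hr2 hb
        (hroot n r hr hr2) ha h
    · intro hn
      refine card_extensions_eq_one _ (hprime n).1 (fun x hx => ?_) ha
      rw [← map_pow, ← ValuationSubring.valuation_eq_iff_of_comap rfl, map_pow, map_pow,
        map_ofNat] at hx
      exact hout n hn W hW _ x.2 hx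
  refine ⟨K, W.comap (algebraMap K Ω), hψ.coding, cΓ, hcΓ, inferInstance, ?_, ?_, ?_⟩
  · obtain ⟨d, hd, h⟩ := ComputablePred.computable_iff.1 (computablePred_isReduciblePoly hφ hψ
      (via_restrictEnum hφ hK) (hK.of_eq fun n => by
        exact ⟨fun h => ⟨⟨_, h⟩, rfl⟩, by rintro ⟨x, hx⟩; exact hx ▸ x.2⟩))
    refine ⟨d, hd, fun l => ?_⟩
    have h1 := congrFun h (l.map hψ.coding.code)
    refine (iff_of_eq h1.symm).trans ?_
    have h2 : (l.map hψ.coding.code).map (restrictEnum φ K) = l := by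
      rw [List.map_map]
      conv_rhs => rw [← List.map_id l]
      exact List.map_congr_left fun x _ => hψ.apply_code x
    rw [h2]
  · refine not_canCountExtensionsFromMinpoly _ _ hq (fun n => (hprime n).1.ne_zero) hpn
      (fun n => X_pow_sub_C_irreducible_of_prime (hprime n).1 fun u hu => ?_)
      (fun n a ha => hnum _ n a ha)
    -- X^q - 2 has no root in K: if n is in the set, a root u would make b/u a q-th root of the odd
    -- prime r; if not, u would have q-th power of the value of 2.
    by_cases hn : p n
    · obtain ⟨r, hr, hr2, b, hb⟩ := hin' n hn
      refine hroot n r hr hr2 (b / u) ?_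
      rw [div_pow, hb, hu]
      field_simp
    · refine hout n hn W hW u u.2 ?_
      have := congrArg (fun x : K => W.valuation (algebraMap K Ω x)) hu
      rw [map_pow, map_pow, map_ofNat] at this
      exact this
  · intro L _ _ _ cL hcL
    have := IsAlgClosure.isAlgClosed K (K := L)
    have : Algebra.IsAlgebraic K L := IsAlgClosure.isAlgebraic
    exact not_canCountExtensionsIn _ hq (fun n => (hprime n).1.ne_zero) hpn cL hcL
      (fun n a ha => hnum _ n a ha)

theorem mainTheorem7 :
    ∃ (K Γ : Type) (_ : Field K) (_ : CharZero K) (_ : AddCommGroup Γ) (_ : LinearOrder Γ)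
      (_ : IsOrderedAddMonoid Γ) (v : AddValuation K (WithTop Γ)) (cK : Coding K) (cΓ : Coding Γ),
      IsComputableValuedField cK cΓ v ∧
      Algebra.IsAlgebraic ℚ K ∧
      HasSplittingAlgorithm cK ∧
      ¬ CanCountExtensionsFromMinpoly cK v ∧
      ∀ (L : Type) [Field L] [Algebra K L] [IsAlgClosure K L] (cL : Coding L),
        cL.IsComputableField → cK.IsComputableMap cL (algebraMap K L) →
        ¬ CanCountExtensionsIn v cL := by
  obtain ⟨K, V, cK, cΓ, h1, halg, h2, h3, h4⟩ :=
    @exists_valuedField_not_canCount ℚ (AlgebraicClosure ℚ) _ _ _ _ _ _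
      (AlgebraicClosure.isAlgebraic ℚ)
  refine ⟨K, V.AddValueGroup, inferInstance, inferInstance, inferInstance, inferInstance,
    inferInstance, V.addValuation, cK, cΓ, h1, ?_, h2, h3, fun L _ _ _ cL hcL _ => h4 L cL hcL⟩
  -- The ℚ-algebra structure from characteristic zero and the one from the intermediate field agree,
  -- as there is at most one.
  convert halg
  · rfl
  · exact Subsingleton.elim (α := Algebra ℚ K) _ _
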